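/- **Definitions.** A (left) *skew monoidal category* is a category $\mathcal C$ with a functor $\otimes:\mathcal C^2\to\mathcal C$, an object $i$ and natural transformations (not necessarily invertible) $\alpha:(a\otimes b)\otimes c\to a\otimes(b\otimes c)$, $\lambda:i\otimes a\to a$, $\rho:a\to a\otimes i$ satisfying $(1_a\otimes\alpha_{b,c,d})\circ\alpha_{a,b\otimes c,d}\circ(\alpha_{a,b,c}\otimes 1_d)=\alpha_{a,b,c\otimes d}\circ\alpha_{a\otimes b,c,d}$, $\ \lambda_{a\otimes b}\circ\alpha_{i,a,b}=\lambda_a\otimes 1_b$, $\ \alpha_{a,b,i}\circ\rho_{a\otimes b}=1_a\otimes\rho_b$, $\ (1_a\otimes\lambda_b)\circ\alpha_{a,i,b}\circ(\rho_a\otimes1_b)=1_{a\otimes b}$ and $\lambda_i\circ\rho_i=1_i$. It is *closed* if for all $b,c$ there are an object $[b,c]$ and a morphism $e:[b,c]\otimes b\to c$ such that $f\mapsto e\circ(f\otimes 1_b)$ is a bijection $\mathcal C(a,[b,c])\to\mathcal C(a\otimes b,c)$ for all $a$. $\mathbf{SkewMCl}_\ell$ is the 2-category of closed skew monoidal categories,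 lax monoidal functors and monoidal natural transformations. A *skew multicategory* $\mathbb A$ consists of a set of objects; for every list $\overline a=(a_1,\dots,a_n)$ of objects and every object $b$ a set $\mathbb A_\ell(\overline a;b)$ of *loose* multimaps and, if $n>0$, a set $\mathbb A_t(\overline a;b)$ of *tight* multimaps with a comparison function $j_{\overline a,b}:\mathbb A_t(\overline a;b)\to\mathbb A_\ell(\overline a;b)$; identities $1_a\in\mathbb A_t(a;a)$; and substitutions $(g,f_1,\dots,f_n)\mapsto g(f_1,\dots,f_n)$ sending $g\in\mathbb A_x(b_1,\dots,b_n;c)$ and $f_k\in\mathbb A_{x_k}(\overline a_k;b_k)$ to an element of $\mathbb A_y(\overline a_1,\dots,\overline a_n;c)$, where $x,x_1,\dots,x_n\in\{t,\ell\}$ and $y=t$ if $x=x_1=t$ and $y=\ell$ otherwise; substitution is compatible with the comparisons in each of its arguments, associative and unital. A morphism $F:\mathbb A\to\mathbb B$ consists of maps on objects and on tight and loose multimaps that preserve comparisons, identities and substitution. A 2-cell $\varphi:F\Rightarrow G$ is a family $\varphi_a\in\mathbb B_t(Fa;Ga)$ with $\varphi_b(Ff)=(Gf)(\varphi_{a_1},\dots,\varphi_{a_n})$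 for all multimaps $f:a_1,\dots,a_n\to b$, of each type. Skew multicategories form in this way a 2-category $\mathbf{R\text{-}Mult}$. Below, $x=t$ is allowed with $\overline a$ only if $\overline a$ is non-empty. A multimap $\theta\in\mathbb A_x(\overline a;m)$ is *universal* if $g\mapsto g(\theta)$ is a bijection $\mathbb A_t(m;b)\to\mathbb A_x(\overline a;b)$ for all $b$. $\mathbb A$ is *left representable* if for all $x$ and $\overline a$ there is a universal multimap in some $\mathbb A_x(\overline a;m)$, and for every universal $\theta\in\mathbb A_x(\overline a;m)$ and all $\overline b,c$ the function $g\mapsto g(\theta,1,\dots,1)$ is a bijection $\mathbb A_t(m,\overline b;c)\to\mathbb A_x(\overline a,\overline b;c)$. $\mathbb A$ is *closed* if for all $b,c$ there are an object $[b,c]$ and $e\in\mathbb A_t([b,c],b;c)$ such that $f\mapsto e(f,1_b)$ is a bijection $\mathbb A_x(\overline a;[b,c])\to\mathbb A_x(\overline a,b;c)$ for all $x,\overline a$. **Theorem.** There is a 2-equivalence between the full sub-2-category of $\mathbf{SkewMCl}_\ell$ on the closed skew monoidal categories all of whose left unit maps $\lambda:i\otimes a\to a$ are epimorphisms, and the full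 sub-2-category of $\mathbf{R\text{-}Mult}$ on the left representable closed skew multicategories all of whose comparisons $j_{\overline a,b}:\mathbb A_t(\overline a;b)\to\mathbb A_\ell(\overline a;b)$ ($\overline a$ non-empty) are injective. More precisely, there is a 2-equivalence between $\mathbf{SkewMCl}_\ell$ and the full sub-2-category of $\mathbf{R\text{-}Mult}$ on all left representable closed skew multicategories which restricts to a 2-equivalence between these full sub-2-categories. Here a *2-equivalence* is a strict 2-functor $\Phi$ for which there are a strict 2-functor $\Psi$ in the other direction and 2-natural isomorphisms $1\cong\Psi\Phi$ and $\Phi\Psi\cong1$. -/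

import Mathlib

open CategoryTheory

universe v u

attribute [-instance] CategoryTheory.catToReflQuiver

/-! ## 2-equivalences of 2-categories

A 2-category is a bicategory that is `Bicategory.Strict`; a 2-functor is a `StrictPseudofunctor`. -/

namespace TwoCat

open Bicategory

universe w₁ w₂ v₁ v₂ u₁ u₂

/-- A 2-natural isomorphism between 2-functors `F` and `G`: invertible 1-cells `F X ⟶ G X` that are
strictly natural with respect to 1-cells and 2-cells. -/
structure TwoNatIso {B : Type u₁} [Bicategory.{w₁, v₁} B] {C : Type u₂} [Bicategory.{w₂, v₂} C]
    (F G : StrictPseudofunctor B C) where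
  hom : ∀ X : B, F.obj X ⟶ G.obj X
  inv : ∀ X : B, G.obj X ⟶ F.obj X
  hom_inv : ∀ X : B, hom X ≫ inv X = 𝟙 (F.obj X)
  inv_hom : ∀ X : B, inv X ≫ hom X = 𝟙 (G.obj X)
  naturality : ∀ {X Y : B} (f : X ⟶ Y), F.map f ≫ hom Y = hom X ≫ G.map f
  naturality₂ : ∀ {X Y : B} {f g : X ⟶ Y} (η : f ⟶ g),
    F.map₂ η ▷ hom Y ≫ eqToHom (naturality g) = eqToHom (naturality f) ≫ hom X ◁ G.map₂ η

/-- A 2-equivalence between 2-categories: 2-functors in both directions whose composites are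
2-naturally isomorphic to the identity 2-functors. -/
structure TwoEquivalence (B : Type u₁) [Bicategory.{w₁, v₁} B] [Bicategory.Strict B]
    (C : Type u₂) [Bicategory.{w₂, v₂} C] [Bicategory.Strict C] where
  functor : StrictPseudofunctor B C
  inverse : StrictPseudofunctor C B
  unit : TwoNatIso (StrictPseudofunctor.id B) (functor.comp inverse)
  counit : TwoNatIso (inverse.comp functor) (StrictPseudofunctor.id C)

/-- The full sub-2-category on the objects satisfying `P`. -/
abbrev FullSub {B : Type u₁} [Bicategory.{w₁, v₁} B] (P : B → Prop) : Type u₁ :=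
  InducedBicategory B (Subtype.val : {X : B // P X} → B)

/-- The inclusion of a full sub-2-category. -/
abbrev FullSub.incl {B : Type u₁} [Bicategory.{w₁, v₁} B] (P : B → Prop) :
    StrictPseudofunctor (FullSub P) B :=
  InducedBicategory.forget

end TwoCat

/-! ## Skew monoidal categories -/

set_option linter.checkUnivs false in
/-- A (left) skew monoidal category. -/
structure SkewMonCat where
  carrier : Type u
  [category : Category.{v} carrier]
  tensorObj : carrier → carrier → carrier
  tensorHom : ∀ {a a' b b' : carrier}, (a ⟶ a') → (b ⟶ b') → (tensorObj a b ⟶ tensorObj a' b')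
  tensor_id : ∀ a b : carrier, tensorHom (𝟙 a) (𝟙 b) = 𝟙 (tensorObj a b)
  tensor_comp : ∀ {a a' a'' b b' b'' : carrier} (f : a ⟶ a') (f' : a' ⟶ a'')
    (g : b ⟶ b') (g' : b' ⟶ b''),
    tensorHom (f ≫ f') (g ≫ g') = tensorHom f g ≫ tensorHom f' g'
  unit : carrier
  /-- The associativity map `α : (a ⊗ b) ⊗ c ⟶ a ⊗ (b ⊗ c)`. -/
  assoc : ∀ a b c : carrier, tensorObj (tensorObj a b) c ⟶ tensorObj a (tensorObj b c)
  /-- The left unit map `λ : i ⊗ a ⟶ a`. -/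
  leftUnit : ∀ a : carrier, tensorObj unit a ⟶ a
  /-- The right unit map `ρ : a ⟶ a ⊗ i`. -/
  rightUnit : ∀ a : carrier, a ⟶ tensorObj a unit
  assoc_naturality : ∀ {a a' b b' c c' : carrier} (f : a ⟶ a') (g : b ⟶ b') (h : c ⟶ c'),
    tensorHom (tensorHom f g) h ≫ assoc a' b' c' = assoc a b c ≫ tensorHom f (tensorHom g h)
  leftUnit_naturality : ∀ {a a' : carrier} (f : a ⟶ a'),
    tensorHom (𝟙 unit) f ≫ leftUnit a' = leftUnit a ≫ f
  rightUnit_naturality : ∀ {a a' : carrier} (f : a ⟶ a'),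
    f ≫ rightUnit a' = rightUnit a ≫ tensorHom f (𝟙 unit)
  pentagon : ∀ a b c d : carrier,
    tensorHom (assoc a b c) (𝟙 d) ≫ assoc a (tensorObj b c) d ≫ tensorHom (𝟙 a) (assoc b c d) =
      assoc (tensorObj a b) c d ≫ assoc a b (tensorObj c d)
  assoc_leftUnit : ∀ a b : carrier,
    assoc unit a b ≫ leftUnit (tensorObj a b) = tensorHom (leftUnit a) (𝟙 b)
  rightUnit_assoc : ∀ a b : carrier,
    rightUnit (tensorObj a b) ≫ assoc a b unit = tensorHom (𝟙 a) (rightUnit b)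
  triangle : ∀ a b : carrier,
    tensorHom (rightUnit a) (𝟙 b) ≫ assoc a unit b ≫ tensorHom (𝟙 a) (leftUnit b) =
      𝟙 (tensorObj a b)
  rightUnit_leftUnit : rightUnit unit ≫ leftUnit unit = 𝟙 unit

namespace SkewMonCat

instance (C : SkewMonCat.{v, u}) : Category.{v} C.carrier := C.category

/-- A lax monoidal functor between skew monoidal categories. -/
structure LaxFunctor (C D : SkewMonCat.{v, u}) where
  functor : C.carrier ⥤ D.carrier
  mu : ∀ a b : C.carrier,
    D.tensorObj (functor.obj a) (functor.obj b) ⟶ functor.obj (C.tensorObj a b)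
  eps : D.unit ⟶ functor.obj C.unit
  mu_naturality : ∀ {a a' b b' : C.carrier} (f : a ⟶ a') (g : b ⟶ b'),
    D.tensorHom (functor.map f) (functor.map g) ≫ mu a' b' =
      mu a b ≫ functor.map (C.tensorHom f g)
  associativity : ∀ a b c : C.carrier,
    D.tensorHom (mu a b) (𝟙 (functor.obj c)) ≫ mu (C.tensorObj a b) c ≫
        functor.map (C.assoc a b c) =
      D.assoc (functor.obj a) (functor.obj b) (functor.obj c) ≫
        D.tensorHom (𝟙 (functor.obj a)) (mu b c) ≫ mu a (C.tensorObj b c)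
  left_unitality : ∀ a : C.carrier,
    D.tensorHom eps (𝟙 (functor.obj a)) ≫ mu C.unit a ≫ functor.map (C.leftUnit a) =
      D.leftUnit (functor.obj a)
  right_unitality : ∀ a : C.carrier,
    D.rightUnit (functor.obj a) ≫ D.tensorHom (𝟙 (functor.obj a)) eps ≫ mu a C.unit =
      functor.map (C.rightUnit a)

/-- A monoidal natural transformation between lax monoidal functors. -/
@[ext]
structure MonTrans {C D : SkewMonCat.{v, u}} (F G : LaxFunctor C D) where
  app : ∀ a : C.carrier, F.functor.obj a ⟶ G.functor.obj a
  naturality : ∀ {a b : C.carrier} (f : a ⟶ b),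
    F.functor.map f ≫ app b = app a ≫ G.functor.map f
  tensor : ∀ a b : C.carrier,
    F.mu a b ≫ app (C.tensorObj a b) = D.tensorHom (app a) (app b) ≫ G.mu a b
  unit : F.eps ≫ app C.unit = G.eps

theorem tensorHom_comp_left (D : SkewMonCat.{v, u}) {a a' a'' b : D.carrier} (f : a ⟶ a')
    (f' : a' ⟶ a'') :
    D.tensorHom (f ≫ f') (𝟙 b) = D.tensorHom f (𝟙 b) ≫ D.tensorHom f' (𝟙 b) := by
  rw [← D.tensor_comp, Category.comp_id]

theorem tensorHom_comp_right (D : SkewMonCat.{v, u}) {a b b' b'' : D.carrier} (g : b ⟶ b')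
    (g' : b' ⟶ b'') :
    D.tensorHom (𝟙 a) (g ≫ g') = D.tensorHom (𝟙 a) g ≫ D.tensorHom (𝟙 a) g' := by
  rw [← D.tensor_comp, Category.comp_id]

/-- The identity lax monoidal functor. -/
def LaxFunctor.id (C : SkewMonCat.{v, u}) : LaxFunctor C C where
  functor := 𝟭 C.carrier
  mu a b := 𝟙 (C.tensorObj a b)
  eps := 𝟙 C.unit
  mu_naturality f g := by simp
  associativity a b c := by simp [C.tensor_id]
  left_unitality a := by simp [C.tensor_id]
  right_unitality a := by simp [C.tensor_id]

/-- Composition of lax monoidal functors. -/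
def LaxFunctor.comp {C D E : SkewMonCat.{v, u}} (F : LaxFunctor C D) (G : LaxFunctor D E) :
    LaxFunctor C E where
  functor := F.functor ⋙ G.functor
  mu a b := G.mu (F.functor.obj a) (F.functor.obj b) ≫ G.functor.map (F.mu a b)
  eps := G.eps ≫ G.functor.map F.eps
  mu_naturality f g := by
    have h := congrArg G.functor.map (F.mu_naturality f g)
    simp only [Functor.map_comp] at h
    simp only [Functor.comp_map, Category.assoc, ← h]
    simp only [← Category.assoc, G.mu_naturality]
  associativity a b c := by
    have h := congrArg G.functor.map (F.associativity a b c)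
    have h1 := G.mu_naturality (F.mu a b) (𝟙 (F.functor.obj c))
    have h2 := G.mu_naturality (𝟙 (F.functor.obj a)) (F.mu b c)
    have h3 := G.associativity (F.functor.obj a) (F.functor.obj b) (F.functor.obj c)
    simp only [Functor.map_comp, CategoryTheory.Functor.map_id] at h h1 h2
    simp only [Functor.comp_map, Functor.comp_obj, Category.assoc, tensorHom_comp_left,
      tensorHom_comp_right]
    slice_lhs 2 3 => rw [h1]
    slice_rhs 3 4 => rw [h2]
    simp only [Category.assoc]
    rw [h]
    simp only [← Category.assoc] at h3 ⊢
    rw [h3]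
  left_unitality a := by
    have h := congrArg G.functor.map (F.left_unitality a)
    have h1 := G.mu_naturality F.eps (𝟙 (F.functor.obj a))
    simp only [Functor.map_comp, CategoryTheory.Functor.map_id] at h h1
    simp only [Functor.comp_map, Functor.comp_obj, Category.assoc, tensorHom_comp_left]
    slice_lhs 2 3 => rw [h1]
    simp only [Category.assoc]
    rw [h, G.left_unitality]
  right_unitality a := by
    have h := congrArg G.functor.map (F.right_unitality a)
    have h1 := G.mu_naturality (𝟙 (F.functor.obj a)) F.eps
    have h2 := G.right_unitality (F.functor.obj a)
    simp only [Functor.map_comp, CategoryTheory.Functor.map_id] at h h1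
    simp only [Functor.comp_map, Functor.comp_obj, Category.assoc, tensorHom_comp_right]
    slice_lhs 3 4 => rw [h1]
    rw [← h, ← h2]
    simp only [Category.assoc]

theorem LaxFunctor.ext {C D : SkewMonCat.{v, u}} {F G : LaxFunctor C D}
    (h : F.functor = G.functor) (hm : ∀ a b, HEq (F.mu a b) (G.mu a b)) (he : HEq F.eps G.eps) :
    F = G := by
  obtain ⟨F, m, e, _, _, _, _⟩ := F
  obtain ⟨G, m', e', _, _, _, _⟩ := G
  obtain rfl : F = G := h
  obtain rfl : e = e' := eq_of_heq he
  obtain rfl : m = m' := by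
    funext a b
    exact eq_of_heq (hm a b)
  rfl

instance : CategoryStruct SkewMonCat.{v, u} where
  Hom := LaxFunctor
  id := LaxFunctor.id
  comp := LaxFunctor.comp

instance (C D : SkewMonCat.{v, u}) : Category (C ⟶ D) where
  Hom F G := MonTrans F G
  id F :=
    { app := fun a => 𝟙 (F.functor.obj a)
      naturality := by intros; simp
      tensor := by intros; simp [D.tensor_id]
      unit := by simp }
  comp φ ψ :=
    { app := fun a => φ.app a ≫ ψ.app a
      naturality := by
        intro a b f
        rw [← Category.assoc, φ.naturality, Category.assoc, ψ.naturality, Category.assoc]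
      tensor := by
        intro a b
        rw [← Category.assoc, φ.tensor, Category.assoc, ψ.tensor, D.tensor_comp, Category.assoc]
      unit := by rw [← Category.assoc, φ.unit, ψ.unit] }
  id_comp φ := MonTrans.ext (funext fun a => Category.id_comp _)
  comp_id φ := MonTrans.ext (funext fun a => Category.comp_id _)
  assoc φ ψ χ := MonTrans.ext (funext fun a => Category.assoc _ _ _)

section

variable {C D E : SkewMonCat.{v, u}}

theorem hom₂_ext {F G : C ⟶ D} {φ ψ : F ⟶ G} (h : ∀ a, MonTrans.app φ a = MonTrans.app ψ a) :
    φ = ψ :=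
  MonTrans.ext (funext h)

/-- The 2-cell `φ` with components `φ_{F a}`. -/
def whiskerL (F : C ⟶ D) {G H : D ⟶ E} (φ : G ⟶ H) : F ≫ G ⟶ F ≫ H :=
  MonTrans.mk (F := F ≫ G) (G := F ≫ H) (fun a => MonTrans.app φ (F.functor.obj a))
    (fun f => MonTrans.naturality φ (F.functor.map f))
    (fun a b => by
      have h1 := MonTrans.naturality φ (F.mu a b)
      have h2 := MonTrans.tensor φ (F.functor.obj a) (F.functor.obj b)
      change (G.mu _ _ ≫ G.functor.map _) ≫ _ = _ ≫ (H.mu _ _ ≫ H.functor.map _)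
      rw [Category.assoc, h1, ← Category.assoc, h2, Category.assoc]
      rfl)
    (by
      have h1 := MonTrans.naturality φ F.eps
      have h2 := MonTrans.unit φ
      change (G.eps ≫ G.functor.map _) ≫ _ = (H.eps ≫ H.functor.map _)
      rw [Category.assoc, h1, ← Category.assoc, h2])

/-- The 2-cell with components `H φ_a`. -/
def whiskerR {F G : C ⟶ D} (φ : F ⟶ G) (H : D ⟶ E) : F ≫ H ⟶ G ≫ H :=
  MonTrans.mk (F := F ≫ H) (G := G ≫ H) (fun a => H.functor.map (MonTrans.app φ a))
    (fun f => by
      have h := congrArg H.functor.map (MonTrans.naturality φ f)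
      simp only [Functor.map_comp] at h
      exact h)
    (fun a b => by
      have h1 := congrArg H.functor.map (MonTrans.tensor φ a b)
      have h2 := H.mu_naturality (MonTrans.app φ a) (MonTrans.app φ b)
      simp only [Functor.map_comp] at h1
      change (H.mu _ _ ≫ H.functor.map _) ≫ _ = _ ≫ (H.mu _ _ ≫ H.functor.map _)
      rw [Category.assoc, h1, ← Category.assoc, ← h2, Category.assoc]
      rfl)
    (by
      have h1 := congrArg H.functor.map (MonTrans.unit φ)
      simp only [Functor.map_comp] at h1
      change (H.eps ≫ H.functor.map _) ≫ _ = (H.eps ≫ H.functor.map _)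
      rw [Category.assoc, h1])

theorem assoc_eq {B : SkewMonCat.{v, u}} (F : B ⟶ C) (G : C ⟶ D) (H : D ⟶ E) :
    (F ≫ G) ≫ H = F ≫ G ≫ H := by
  refine LaxFunctor.ext rfl (fun a b => heq_of_eq ?_) (heq_of_eq ?_)
  · change H.mu _ _ ≫ H.functor.map (G.mu _ _ ≫ G.functor.map _) =
      (H.mu _ _ ≫ H.functor.map (G.mu _ _)) ≫ H.functor.map (G.functor.map _)
    rw [Functor.map_comp, Category.assoc]
  · change H.eps ≫ H.functor.map (G.eps ≫ G.functor.map _) =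
      (H.eps ≫ H.functor.map G.eps) ≫ H.functor.map (G.functor.map _)
    rw [Functor.map_comp, Category.assoc]

theorem id_comp_eq (F : C ⟶ D) : 𝟙 C ≫ F = F := by
  refine LaxFunctor.ext rfl (fun a b => heq_of_eq ?_) (heq_of_eq ?_)
  · change F.mu _ _ ≫ F.functor.map (𝟙 _) = _
    exact (congrArg _ (F.functor.map_id _)).trans (Category.comp_id _)
  · change F.eps ≫ F.functor.map (𝟙 _) = _
    exact (congrArg _ (F.functor.map_id _)).trans (Category.comp_id _)

theorem comp_id_eq (F : C ⟶ D) : F ≫ 𝟙 D = F := by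
  refine LaxFunctor.ext rfl (fun a b => heq_of_eq ?_) (heq_of_eq ?_)
  · change 𝟙 _ ≫ F.mu _ _ = _
    rw [Category.id_comp]
  · change 𝟙 _ ≫ F.eps = _
    rw [Category.id_comp]

/-- The identity 2-cell between equal 1-cells. -/
def cellOfEq {F G : C ⟶ D} (h : F = G) : F ⟶ G :=
  MonTrans.mk (fun a => eqToHom (by rw [h]))
    (by subst h; intros; simp) (by subst h; intros; simp [D.tensor_id]) (by subst h; simp)

/-- The identity 2-cell between equal 1-cells, as an isomorphism. -/
def isoOfEq {F G : C ⟶ D} (h : F = G) : F ≅ G where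
  hom := cellOfEq h
  inv := cellOfEq h.symm
  hom_inv_id := by subst h; exact hom₂_ext fun a => Category.id_comp _
  inv_hom_id := by subst h; exact hom₂_ext fun a => Category.id_comp _

theorem isoOfEq_eq {F G : C ⟶ D} (h : F = G) : isoOfEq h = eqToIso h := by
  subst h
  rfl

end

/-- The 2-category of skew monoidal categories, lax monoidal functors and monoidal natural
transformations. -/
instance : Bicategory SkewMonCat.{v, u} where
  whiskerLeft F _ _ φ := whiskerL F φ
  whiskerRight φ H := whiskerR φ H
  associator F G H := isoOfEq (assoc_eq F G H)
  leftUnitor F := isoOfEq (id_comp_eq F)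
  rightUnitor F := isoOfEq (comp_id_eq F)
  whiskerLeft_id _ _ := rfl
  whiskerLeft_comp _ _ _ _ _ _ := rfl
  id_whiskerLeft _ := hom₂_ext fun _ => ((Category.id_comp _).trans (Category.comp_id _)).symm
  comp_whiskerLeft _ _ _ _ _ :=
    hom₂_ext fun _ => ((Category.id_comp _).trans (Category.comp_id _)).symm
  id_whiskerRight _ G := hom₂_ext fun _ => G.functor.map_id _
  comp_whiskerRight _ _ H := hom₂_ext fun _ => H.functor.map_comp _ _
  whiskerRight_id _ := hom₂_ext fun _ => ((Category.id_comp _).trans (Category.comp_id _)).symm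
  whiskerRight_comp _ _ _ :=
    hom₂_ext fun _ => ((Category.id_comp _).trans (Category.comp_id _)).symm
  whisker_assoc _ _ _ _ _ :=
    hom₂_ext fun _ => ((Category.id_comp _).trans (Category.comp_id _)).symm
  whisker_exchange φ ψ := hom₂_ext fun a => (MonTrans.naturality ψ (MonTrans.app φ a)).symm
  pentagon _ _ _ K := hom₂_ext fun _ =>
    (congrArg (· ≫ _) (K.functor.map_id _)).trans (Category.id_comp _)
  triangle _ G := hom₂_ext fun _ => (Category.id_comp _).trans (G.functor.map_id _).symm

instance : Bicategory.Strict SkewMonCat.{v, u} where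
  id_comp := id_comp_eq
  comp_id := comp_id_eq
  assoc := assoc_eq
  leftUnitor_eqToIso _ := isoOfEq_eq _
  rightUnitor_eqToIso _ := isoOfEq_eq _
  associator_eqToIso _ _ _ := isoOfEq_eq _

/-- A skew monoidal category is closed if every `- ⊗ b` has a right adjoint, given by universal
morphisms `[b, c] ⊗ b ⟶ c`. -/
def IsClosed (C : SkewMonCat.{v, u}) : Prop :=
  ∀ b c : C.carrier, ∃ (h : C.carrier) (e : C.tensorObj h b ⟶ c), ∀ a : C.carrier,
    Function.Bijective fun f : a ⟶ h => C.tensorHom f (𝟙 b) ≫ e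

/-- The left unit maps `λ : i ⊗ a ⟶ a` are epimorphisms. -/
def LeftUnitEpi (C : SkewMonCat.{v, u}) : Prop :=
  ∀ a : C.carrier, Epi (C.leftUnit a)

end SkewMonCat

/-! ## Skew multicategories -/

/-- The two types of multimaps. -/
inductive Tightness
  | tight
  | loose

namespace Tightness

/-- The arrows of the category `{λ : tight ⟶ loose}`. -/
inductive Arr : Tightness → Tightness → Type
  | id (x : Tightness) : Arr x x
  | lam : Arr tight loose

/-- `x` is an object of the category of types of `n`-ary multimaps: both types are allowed for
`n > 0`, and only `loose` is allowed for `n = 0`. -/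
def HasArity : Tightness → ℕ → Prop
  | tight, 0 => False
  | _, _ => True

/-- The type `x(x₁, …, xₙ)`: it is `tight` if `x = x₁ = tight`, and `loose` otherwise. -/
def subst : Tightness → List Tightness → Tightness
  | tight, tight :: _ => tight
  | _, _ => loose

/-- The action of the arrows on the sets of multimaps, for a comparison `j` from tight to loose. -/
def Arr.act {A : Type u} {H : Tightness → List A → A → Type v}
    (j : ∀ {as : List A} {b : A}, H tight as b → H loose as b) :
    ∀ {x y : Tightness} {as : List A} {b : A}, Arr x y → H x as b → H y as b
  | _, _, _, _, .id _, f => f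
  | _, _, _, _, .lam, f => j f

end Tightness

open Tightness (tight loose)

/-- For sets `H x as b` of multimaps `as ⟶ b` of type `x`, an element of `Maps H as [b₁, …, bₙ]` is
a tuple of multimaps `fᵢ ∈ H xᵢ asᵢ bᵢ` such that `as` is the concatenation of `as₁, …, asₙ`. -/
inductive Maps {A : Type u} (H : Tightness → List A → A → Type v) :
    List A → List A → Type (max u v)
  | nil : Maps H [] []
  | cons {x : Tightness} {as as' cs : List A} {b : A} {bs : List A} (f : H x as b)
      (fs : Maps H as' bs) (h : cs = as ++ as') : Maps H cs (b :: bs)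

namespace Maps

section

variable {A : Type u} {H : Tightness → List A → A → Type v}

/-- The list of the types `x₁, …, xₙ` of a tuple of multimaps. -/
def types : ∀ {as bs : List A}, Maps H as bs → List Tightness
  | _, _, .nil => []
  | _, _, .cons (x := x) _ fs _ => x :: fs.types

/-- The tuple consisting of one multimap. -/
def single {x : Tightness} {as : List A} {b : A} (f : H x as b) : Maps H as [b] :=
  .cons f .nil (List.append_nil as).symm

/-- The tuple of the tight unary multimaps `φ a₁, …, φ aₙ`. -/
def unary {A' : Type u} {F G : A' → A} (φ : ∀ a, H tight [F a] (G a)) :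
    ∀ as : List A', Maps H (as.map F) (as.map G)
  | [] => .nil
  | a :: as => .cons (φ a) (unary φ as) rfl

/-- The tuple of the tight unary multimaps `i a₁, …, i aₙ`, for `i a : a ⟶ a`. -/
def ids (i : ∀ a, H tight [a] a) : ∀ as : List A, Maps H as as
  | [] => .nil
  | a :: as => .cons (i a) (ids i as) rfl

/-- The image of a tuple of multimaps under a map of families of sets of multimaps. -/
def map {B : Type u} {K : Tightness → List B → B → Type v} (F : A → B)
    (m : ∀ {x : Tightness} {as : List A} {b : A}, H x as b → K x (as.map F) (F b)) :
    ∀ {as bs : List A}, Maps H as bs → Maps K (as.map F) (bs.map F)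
  | _, _, .nil => .nil
  | _, _, .cons f fs h => .cons (m f) (fs.map F m) (by rw [h, List.map_append])

/-- A tuple of multimaps with target `bs ++ bs'`, divided into one with target `bs` and one with
target `bs'`. -/
structure Split (H : Tightness → List A → A → Type v) (as bs bs' : List A) where
  left : List A
  right : List A
  eq : as = left ++ right
  fst : Maps H left bs
  snd : Maps H right bs'

/-- Division of a tuple of multimaps into two consecutive ones. -/
def split : ∀ (bs : List A) {bs' as : List A}, Maps H as (bs ++ bs') → Split H as bs bs'
  | [], _, as, fs => ⟨[], as, rfl, .nil, fs⟩
  | _ :: bs, _, _, .cons (as := p) f fs h =>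
    let s := split bs fs
    ⟨p ++ s.left, s.right, by rw [h, List.append_assoc, ← s.eq], .cons f s.fst rfl, s.snd⟩

/-- The tuple `g₁(f₁₁, …), …, gₙ(fₙ₁, …)` formed with a given operation of substitution. -/
def comp (c : ∀ {x y : Tightness} {as bs : List A} {b : A} (_ : H x bs b) (fs : Maps H as bs)
      (_ : y = x.subst fs.types), H y as b) :
    ∀ {as bs cs : List A}, Maps H bs cs → Maps H as bs → Maps H as cs
  | _, _, _, .nil, fs => fs
  | _, _, _, .cons (as := p) g gs rfl, fs =>
    .cons (c g (split p fs).fst rfl) (comp c gs (split p fs).snd) (split p fs).eq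

/-- `Arrow j fs fs'` states that `fs'` is obtained from `fs` by applying arrows of types to the
members of the tuple. -/
inductive Arrow (j : ∀ {as : List A} {b : A}, H tight as b → H loose as b) :
    ∀ {as bs : List A}, Maps H as bs → Maps H as bs → Prop
  | nil : Arrow (@j) .nil .nil
  | cons {x x' : Tightness} {as as' cs : List A} {b : A} {bs : List A} (t : x.Arr x')
      (f : H x as b) {fs fs' : Maps H as' bs} (h : cs = as ++ as') (hfs : Arrow (@j) fs fs') :
      Arrow (@j) (.cons f fs h) (.cons (t.act @j f) fs' h)

end

end Maps

set_option linter.checkUnivs false in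
/-- A skew multicategory. The multimaps `a₁, …, aₙ ⟶ b` of type `x` form the set
`Hom x [a₁, …, aₙ] b`. There are no tight nullary multimaps. -/
structure SkewMultiCat where
  Obj : Type u
  Hom : Tightness → List Obj → Obj → Type v
  isEmpty_tight_nil : ∀ b : Obj, IsEmpty (Hom tight [] b)
  /-- The comparison from tight to loose multimaps. -/
  j : ∀ {as : List Obj} {b : Obj}, Hom tight as b → Hom loose as b
  id : ∀ a : Obj, Hom tight [a] a
  /-- The substitution `g(f₁, …, fₙ)`, of type `x(x₁, …, xₙ)`. -/
  comp : ∀ {x y : Tightness} {as bs : List Obj} {c : Obj} (_ : Hom x bs c) (fs : Maps Hom as bs)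
    (_ : y = x.subst fs.types), Hom y as c
  /-- Substitution is natural in all the types of the multimaps involved. -/
  comp_naturality : ∀ {x x' y y' : Tightness} {as bs : List Obj} {c : Obj} (s : x.Arr x')
    (t : y.Arr y') (g : Hom x bs c) {fs fs' : Maps Hom as bs} (_ : Maps.Arrow @j fs fs')
    (h : y = x.subst fs.types) (h' : y' = x'.subst fs'.types),
    comp (s.act @j g) fs' h' = t.act @j (comp g fs h)
  id_comp : ∀ {x : Tightness} {as : List Obj} {b : Obj} (f : Hom x as b)
    (h : x = tight.subst (Maps.single f).types), comp (id b) (Maps.single f) h = f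
  comp_id : ∀ {x : Tightness} {as : List Obj} {b : Obj} (f : Hom x as b)
    (h : x = x.subst (Maps.ids (H := Hom) id as).types), comp f (Maps.ids id as) h = f
  assoc : ∀ {x y z : Tightness} {as bs cs : List Obj} {d : Obj} (g : Hom x cs d)
    (fs : Maps Hom bs cs) (es : Maps Hom as bs) (h : y = x.subst fs.types)
    (h' : z = y.subst es.types) (h'' : z = x.subst (Maps.comp comp fs es).types),
    comp (comp g fs h) es h' = comp g (Maps.comp comp fs es) h''

namespace SkewMultiCat

/-- A morphism of skew multicategories. -/
structure MultiFunctor (A B : SkewMultiCat.{v, u}) where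
  obj : A.Obj → B.Obj
  map : ∀ {x : Tightness} {as : List A.Obj} {b : A.Obj},
    A.Hom x as b → B.Hom x (as.map obj) (obj b)
  map_j : ∀ {as : List A.Obj} {b : A.Obj} (f : A.Hom tight as b), map (A.j f) = B.j (map f)
  map_id : ∀ a : A.Obj, map (A.id a) = B.id (obj a)
  map_comp : ∀ {x y : Tightness} {as bs : List A.Obj} {c : A.Obj} (g : A.Hom x bs c)
    (fs : Maps A.Hom as bs) (h : y = x.subst fs.types)
    (h' : y = x.subst (fs.map (K := B.Hom) obj map).types),
    map (A.comp g fs h) = B.comp (map g) (fs.map (K := B.Hom) obj map) h'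

/-- A 2-cell between morphisms of skew multicategories: tight unary multimaps `φ_a : F a ⟶ G a`
such that `φ_b ∘ F f = (G f)(φ_{a₁}, …, φ_{aₙ})` for all multimaps `f : a₁, …, aₙ ⟶ b`. -/
@[ext]
structure MultiTrans {A B : SkewMultiCat.{v, u}} (F G : MultiFunctor A B) where
  app : ∀ a : A.Obj, B.Hom tight [F.obj a] (G.obj a)
  naturality : ∀ {x : Tightness} {as : List A.Obj} {b : A.Obj} (f : A.Hom x as b)
    (h : x = tight.subst (Maps.single (H := B.Hom) (F.map f)).types)
    (h' : x = x.subst (Maps.unary (H := B.Hom) app as).types),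
    B.comp (app b) (Maps.single (F.map f)) h = B.comp (G.map f) (Maps.unary app as) h'

section

variable {A : SkewMultiCat.{v, u}}

theorem eq_subst_unary {A' : Type u} {F G : A' → A.Obj} (φ : ∀ a, A.Hom tight [F a] (G a))
    {x : Tightness} {as : List A'} {b : A.Obj} (f : A.Hom x (as.map F) b) :
    x = x.subst (Maps.unary (H := A.Hom) φ as).types := by
  cases x with
  | loose => cases as <;> rfl
  | tight =>
    cases as with
    | nil => exact ((A.isEmpty_tight_nil b).false f).elim
    | cons a as => rfl

theorem eq_subst_single {x : Tightness} {as : List A.Obj} {b : A.Obj} (f : A.Hom x as b) :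
    x = tight.subst (Maps.single (H := A.Hom) f).types := by
  cases x <;> rfl

theorem types_map {B : SkewMultiCat.{v, u}} (F : A.Obj → B.Obj)
    (m : ∀ {x : Tightness} {as : List A.Obj} {b : A.Obj},
      A.Hom x as b → B.Hom x (as.map F) (F b)) {as bs : List A.Obj} (fs : Maps A.Hom as bs) :
    (fs.map (K := B.Hom) F m).types = fs.types := by
  induction fs with
  | nil => rfl
  | cons f fs h ih => exact congrArg _ ih

theorem comp_heq {x y y' : Tightness} {as as' bs bs' : List A.Obj} {c : A.Obj}
    {g : A.Hom x bs c} {g' : A.Hom x bs' c} {fs : Maps A.Hom as bs} {fs' : Maps A.Hom as' bs'}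
    (hy : y = y') (ha : as = as') (hb : bs = bs') (hg : HEq g g') (hfs : HEq fs fs')
    (h : y = x.subst fs.types) (h' : y' = x.subst fs'.types) :
    HEq (A.comp g fs h) (A.comp g' fs' h') := by
  subst hy ha hb
  obtain rfl := eq_of_heq hg
  obtain rfl := eq_of_heq hfs
  rfl

theorem cons_heq {x x' : Tightness} {as₁ as₁' as₂ as₂' cs cs' bs bs' : List A.Obj} {b : A.Obj}
    {f : A.Hom x as₁ b} {f' : A.Hom x' as₁' b} {fs : Maps A.Hom as₂ bs} {fs' : Maps A.Hom as₂' bs'}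
    (hx : x = x') (h₁ : as₁ = as₁') (h₂ : as₂ = as₂') (hb : bs = bs') (hf : HEq f f')
    (hfs : HEq fs fs') (h : cs = as₁ ++ as₂) (h' : cs' = as₁' ++ as₂') :
    HEq (Maps.cons (H := A.Hom) f fs h) (Maps.cons (H := A.Hom) f' fs' h') := by
  subst hx h₁ h₂ hb h h'
  obtain rfl := eq_of_heq hf
  obtain rfl := eq_of_heq hfs
  rfl

theorem single_heq {x : Tightness} {as as' : List A.Obj} {b : A.Obj}
    {f : A.Hom x as b} {f' : A.Hom x as' b} (ha : as = as') (hf : HEq f f') :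
    HEq (Maps.single (H := A.Hom) f) (Maps.single (H := A.Hom) f') := by
  subst ha
  obtain rfl := eq_of_heq hf
  rfl

theorem MultiFunctor.map_heq {B : SkewMultiCat.{v, u}} (F : MultiFunctor A B) {x : Tightness}
    {as as' : List A.Obj} {b : A.Obj} {f : A.Hom x as b} {f' : A.Hom x as' b} (ha : as = as')
    (hf : HEq f f') : HEq (F.map f) (F.map f') := by
  subst ha
  obtain rfl := eq_of_heq hf
  rfl

theorem j_heq {as as' : List A.Obj} {b : A.Obj} {f : A.Hom tight as b} {f' : A.Hom tight as' b}
    (ha : as = as') (hf : HEq f f') : HEq (A.j f) (A.j f') := by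
  subst ha
  obtain rfl := eq_of_heq hf
  rfl

theorem MultiFunctor.ext {B : SkewMultiCat.{v, u}} {F G : MultiFunctor A B}
    (hobj : F.obj = G.obj)
    (hmap : ∀ {x : Tightness} {as : List A.Obj} {b : A.Obj} (f : A.Hom x as b),
      HEq (F.map f) (G.map f)) : F = G := by
  obtain ⟨o, m, _, _, _⟩ := F
  obtain ⟨o', m', _, _, _⟩ := G
  obtain rfl : o = o' := hobj
  obtain rfl : @m = @m' := by
    funext x as b f
    exact eq_of_heq (hmap f)
  rfl

/-- The identity morphism. -/
def MultiFunctor.id (A : SkewMultiCat.{v, u}) : MultiFunctor A A where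
  obj a := a
  map {x as b} f := cast (congrArg (fun l => A.Hom x l b) (List.map_id' as).symm) f
  map_j f := eq_of_heq ((cast_heq _ _).trans (j_heq (List.map_id' _) (cast_heq _ _)).symm)
  map_id a := rfl
  map_comp {x y as bs c} g fs h h' := by
    have key : ∀ {as bs : List A.Obj} (fs : Maps A.Hom as bs),
        HEq (fs.map (K := A.Hom) (fun a => a) fun {x as b} f =>
          cast (congrArg (fun l => A.Hom x l b) (List.map_id' as).symm) f) fs := by
      intro as bs fs
      induction fs with
      | nil => rfl
      | cons f fs h ih =>
        exact cons_heq rfl (List.map_id' _) (List.map_id' _) (List.map_id' _) (cast_heq _ _) ih _ _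
    exact eq_of_heq ((cast_heq _ _).trans (comp_heq rfl (List.map_id' _) (List.map_id' _)
      (cast_heq _ _) (key fs) _ _).symm)

/-- Composition of morphisms. -/
def MultiFunctor.comp {A B C : SkewMultiCat.{v, u}} (F : MultiFunctor A B)
    (G : MultiFunctor B C) : MultiFunctor A C where
  obj a := G.obj (F.obj a)
  map {x as b} f :=
    cast (congrArg (fun l => C.Hom x l (G.obj (F.obj b))) List.map_map) (G.map (F.map f))
  map_j f := by
    refine eq_of_heq ((cast_heq _ _).trans ?_)
    rw [F.map_j, G.map_j]
    exact (j_heq List.map_map.symm (cast_heq _ _)).symm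
  map_id a := by
    refine eq_of_heq ((cast_heq _ _).trans ?_)
    rw [F.map_id]
    exact heq_of_eq (G.map_id _)
  map_comp {x y as bs c} g fs h h' := by
    have key : ∀ {as bs : List A.Obj} (fs : Maps A.Hom as bs),
        HEq ((fs.map (K := B.Hom) F.obj F.map).map (K := C.Hom) G.obj G.map)
          (fs.map (K := C.Hom) (fun a => G.obj (F.obj a)) fun {x as b} f =>
            cast (congrArg (fun l => C.Hom x l (G.obj (F.obj b))) List.map_map)
              (G.map (F.map f))) := by
      intro as bs fs
      induction fs with
      | nil => rfl
      | cons f fs h ih =>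
        exact cons_heq rfl List.map_map List.map_map List.map_map (cast_heq _ _).symm ih _ _
    refine eq_of_heq ((cast_heq _ _).trans ?_)
    have h₁ : y = x.subst (fs.map (K := B.Hom) F.obj F.map).types := by rw [types_map, h]
    have h₂ : y = x.subst
        ((fs.map (K := B.Hom) F.obj F.map).map (K := C.Hom) G.obj G.map).types := by
      rw [types_map, h₁]
    rw [F.map_comp g fs h h₁, G.map_comp _ _ h₁ h₂]
    exact comp_heq rfl List.map_map List.map_map (cast_heq _ _).symm (key fs) _ _

instance : CategoryStruct SkewMultiCat.{v, u} where
  Hom := MultiFunctor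
  id := MultiFunctor.id
  comp := MultiFunctor.comp

/-- The composite of tight unary multimaps. -/
def ucomp {a b c : A.Obj} (f : A.Hom tight [a] b) (g : A.Hom tight [b] c) : A.Hom tight [a] c :=
  A.comp g (Maps.single f) rfl

theorem split_append_nil (bs : List A.Obj) {as : List A.Obj} (es : Maps A.Hom as (bs ++ [])) :
    (Maps.split bs es).left = as ∧ (Maps.split bs es).right = [] ∧
      HEq (Maps.split bs es).fst es ∧ HEq (Maps.split bs es).snd (Maps.nil (H := A.Hom)) := by
  induction bs generalizing as with
  | nil =>
    cases es
    exact ⟨rfl, rfl, HEq.rfl, HEq.rfl⟩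
  | cons b bs ih =>
    cases es with
    | cons f fs h =>
      obtain ⟨h₁, h₂, h₃, h₄⟩ := ih fs
      refine ⟨?_, h₂, ?_, h₄⟩
      · change _ ++ (Maps.split bs fs).left = _
        rw [h₁, h]
      · exact cons_heq rfl rfl h₁ (List.append_nil bs).symm HEq.rfl h₃ _ _

theorem single_comp {x y : Tightness} {as bs : List A.Obj} {b : A.Obj} (f : A.Hom x bs b)
    (es : Maps A.Hom as bs) (h : y = x.subst es.types) :
    Maps.comp A.comp (Maps.single f) es = Maps.single (A.comp f es h) := by
  have key : ∀ {bs' : List A.Obj} (e : bs' = bs ++ []) (es' : Maps A.Hom as bs') (_ : HEq es' es),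
      Maps.comp A.comp (Maps.cons f .nil e) es' = Maps.single (A.comp f es h) := by
    intro bs' e es' hes
    subst e
    obtain ⟨h₁, h₂, h₃, h₄⟩ := split_append_nil bs es'
    have ht : x.subst (Maps.split bs es').fst.types = y := by
      rw [h]
      congr 1
      have : ∀ {l l' m m' : List A.Obj} (p : Maps A.Hom l m) (p' : Maps A.Hom l' m'), l = l' →
          m = m' → HEq p p' → p.types = p'.types := by
        intro l l' m m' p p' hl hm hp
        subst hl hm
        rw [eq_of_heq hp]
      exact this _ _ h₁ (by simp) (h₃.trans hes)
    exact eq_of_heq (cons_heq ht h₁ h₂ rfl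
      (comp_heq ht h₁ rfl HEq.rfl (h₃.trans hes) _ _) h₄ _ _)
  exact key (List.append_nil bs).symm es HEq.rfl

theorem unary_comp {A' : Type u} {F G K : A' → A.Obj} (φ : ∀ a, A.Hom tight [F a] (G a))
    (ψ : ∀ a, A.Hom tight [G a] (K a)) (as : List A') :
    Maps.comp A.comp (Maps.unary ψ as) (Maps.unary φ as) =
      Maps.unary (H := A.Hom) (fun a => ucomp (φ a) (ψ a)) as := by
  induction as with
  | nil => rfl
  | cons a as ih => exact congrArg (fun t => Maps.cons (ucomp (φ a) (ψ a)) t _) ih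

theorem unary_id {A' : Type u} (F : A' → A.Obj) (as : List A') :
    Maps.unary (H := A.Hom) (fun a => A.id (F a)) as = Maps.ids A.id (as.map F) := by
  induction as with
  | nil => rfl
  | cons a as ih => exact congrArg (fun t => Maps.cons (A.id (F a)) t _) ih

theorem unary_map {A' A'' : Type u} (F : A' → A'') {G K : A'' → A.Obj}
    (φ : ∀ a, A.Hom tight [G a] (K a)) (as : List A') :
    HEq (Maps.unary (H := A.Hom) φ (as.map F))
      (Maps.unary (H := A.Hom) (fun a => φ (F a)) as) := by
  induction as with
  | nil => rfl
  | cons a as ih =>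
    exact cons_heq rfl rfl List.map_map List.map_map HEq.rfl ih _ _

theorem map_unary {B : SkewMultiCat.{v, u}} (H : MultiFunctor A B) {A' : Type u}
    {F G : A' → A.Obj} (φ : ∀ a, A.Hom tight [F a] (G a)) (as : List A') :
    HEq ((Maps.unary (H := A.Hom) φ as).map (K := B.Hom) H.obj H.map)
      (Maps.unary (H := B.Hom) (F := fun a => H.obj (F a)) (G := fun a => H.obj (G a))
        (fun a => H.map (φ a)) as) := by
  induction as with
  | nil => rfl
  | cons a as ih =>
    exact cons_heq rfl rfl List.map_map List.map_map HEq.rfl ih _ _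

theorem ucomp_id {a b : A.Obj} (f : A.Hom tight [a] b) : ucomp f (A.id b) = f :=
  A.id_comp f rfl

theorem id_ucomp {a b : A.Obj} (f : A.Hom tight [a] b) : ucomp (A.id a) f = f :=
  A.comp_id f rfl

theorem ucomp_assoc {a b c d : A.Obj} (f : A.Hom tight [a] b) (g : A.Hom tight [b] c)
    (h : A.Hom tight [c] d) : ucomp (ucomp f g) h = ucomp f (ucomp g h) := by
  have e := A.assoc h (Maps.single g) (Maps.single f) rfl (z := tight) rfl
    (by rw [single_comp g (Maps.single f) (y := tight) rfl]; rfl)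
  exact Eq.trans (by congr 1) e.symm

theorem map_ucomp {B : SkewMultiCat.{v, u}} (F : MultiFunctor A B) {a b c : A.Obj}
    (f : A.Hom tight [a] b) (g : A.Hom tight [b] c) :
    F.map (ucomp f g) = ucomp (F.map f) (F.map g) :=
  F.map_comp g (Maps.single f) rfl rfl

end

section

variable {A B C D : SkewMultiCat.{v, u}}

/-- The identity 2-cell. -/
def MultiTrans.id (F : MultiFunctor A B) : MultiTrans F F where
  app a := B.id (F.obj a)
  naturality {x as b} f h h' := by
    rw [B.id_comp]
    have e := B.comp_id (F.map f) (by rw [← unary_id]; exact h')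
    refine e.symm.trans ?_
    congr 1
    exact (unary_id _ _).symm

/-- Vertical composition of 2-cells. -/
def MultiTrans.comp {F G K : MultiFunctor A B} (φ : MultiTrans F G) (ψ : MultiTrans G K) :
    MultiTrans F K where
  app a := ucomp (φ.app a) (ψ.app a)
  naturality {x as b} f h h' := by
    have p₁ := eq_subst_single (F.map f)
    have p₂ := eq_subst_single (G.map f)
    have p₃ := eq_subst_unary φ.app (F.map f)
    have p₄ := eq_subst_unary ψ.app (G.map f)
    have n₁ := φ.naturality f p₁ p₃
    have n₂ := ψ.naturality f p₂ p₄
    have s₁ := single_comp (φ.app b) (Maps.single (F.map f)) p₁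
    have s₂ := single_comp (G.map f) (Maps.unary φ.app as) p₃
    have u := unary_comp φ.app ψ.app as
    have q₁ : x = tight.subst
        (Maps.comp B.comp (Maps.single (φ.app b)) (Maps.single (F.map f))).types := by
      rw [s₁]; exact eq_subst_single _
    have q₂ : x = tight.subst
        (Maps.comp B.comp (Maps.single (G.map f)) (Maps.unary φ.app as)).types := by
      rw [s₂]; exact eq_subst_single _
    have q₃ : x = x.subst
        (Maps.comp B.comp (Maps.unary ψ.app as) (Maps.unary φ.app as)).types := by
      rw [u]; exact h'
    have a₁ := B.assoc (ψ.app b) (Maps.single (φ.app b)) (Maps.single (F.map f)) rfl p₁ q₁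
    have a₂ := B.assoc (ψ.app b) (Maps.single (G.map f)) (Maps.unary φ.app as) p₂ p₃ q₂
    have a₃ := B.assoc (K.map f) (Maps.unary ψ.app as) (Maps.unary φ.app as) p₄ p₃ q₃
    refine a₁.trans ?_
    refine Eq.trans ?_ (a₂.symm.trans ?_)
    · congr 1
      rw [s₁, s₂, n₁]
    · rw [n₂]
      refine a₃.trans ?_
      congr 1

instance (A B : SkewMultiCat.{v, u}) : Category (A ⟶ B) where
  Hom F G := MultiTrans F G
  id F := MultiTrans.id F
  comp φ ψ := MultiTrans.comp φ ψ
  id_comp _ := MultiTrans.ext (funext fun _ => id_ucomp _)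
  comp_id _ := MultiTrans.ext (funext fun _ => ucomp_id _)
  assoc _ _ _ := MultiTrans.ext (funext fun _ => ucomp_assoc _ _ _)

theorem hom₂_ext {F G : A ⟶ B} {φ ψ : F ⟶ G}
    (h : ∀ a, MultiTrans.app φ a = MultiTrans.app ψ a) : φ = ψ :=
  MultiTrans.ext (funext h)

/-- The 2-cell with components `φ_{F a}`. -/
def whiskerL (F : A ⟶ B) {G H : B ⟶ C} (φ : G ⟶ H) : F ≫ G ⟶ F ≫ H :=
  MultiTrans.mk (F := F ≫ G) (G := F ≫ H) (fun a => MultiTrans.app φ (F.obj a))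
    (fun {x as b} f h h' => by
      have p₁ := eq_subst_single (G.map (F.map f))
      have p₂ := eq_subst_unary (MultiTrans.app φ) (G.map (F.map f))
      refine eq_of_heq (HEq.trans ?_
        ((heq_of_eq (MultiTrans.naturality φ (F.map f) p₁ p₂)).trans ?_))
      · exact comp_heq rfl List.map_map.symm rfl HEq.rfl
          (single_heq List.map_map.symm (cast_heq _ _)) _ _
      · exact comp_heq rfl List.map_map List.map_map (cast_heq _ _).symm
          (unary_map F.obj (MultiTrans.app φ) as) _ _)

/-- The 2-cell with components `H φ_a`. -/
def whiskerR {F G : A ⟶ B} (φ : F ⟶ G) (H : B ⟶ C) : F ≫ H ⟶ G ≫ H :=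
  MultiTrans.mk (F := F ≫ H) (G := G ≫ H) (fun a => H.map (MultiTrans.app φ a))
    (fun {x as b} f h h' => by
      have p₁ := eq_subst_single (F.map f)
      have p₂ := eq_subst_unary (MultiTrans.app φ) (F.map f)
      have n := congrArg H.map (MultiTrans.naturality φ f p₁ p₂)
      rw [H.map_comp _ _ p₁ (by rw [types_map]; exact p₁),
        H.map_comp _ _ p₂ (by rw [types_map]; exact p₂)] at n
      refine eq_of_heq (HEq.trans ?_ ((heq_of_eq n).trans ?_))
      · exact comp_heq rfl List.map_map.symm rfl HEq.rfl
          (single_heq List.map_map.symm (cast_heq _ _)) _ _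
      · exact comp_heq rfl List.map_map List.map_map (cast_heq _ _).symm
          (map_unary H (MultiTrans.app φ) as) _ _)

theorem id_comp_eq (F : A ⟶ B) : 𝟙 A ≫ F = F :=
  MultiFunctor.ext rfl fun _ =>
    (cast_heq _ _).trans (MultiFunctor.map_heq F (List.map_id' _) (cast_heq _ _))

theorem comp_id_eq (F : A ⟶ B) : F ≫ 𝟙 B = F :=
  MultiFunctor.ext rfl fun _ => (cast_heq _ _).trans (cast_heq _ _)

theorem assoc_eq (F : A ⟶ B) (G : B ⟶ C) (H : C ⟶ D) : (F ≫ G) ≫ H = F ≫ G ≫ H :=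
  MultiFunctor.ext rfl fun _ =>
    ((cast_heq _ _).trans (MultiFunctor.map_heq H List.map_map.symm (cast_heq _ _))).trans
      ((cast_heq _ _).trans (cast_heq _ _)).symm

/-- The identity 2-cell between equal 1-cells. -/
def cellOfEq {F G : A ⟶ B} (h : F = G) : F ⟶ G :=
  MultiTrans.mk
    (fun a => cast (congrArg (fun K : A ⟶ B => B.Hom tight [F.obj a] (K.obj a)) h)
      (B.id (F.obj a)))
    (by subst h; exact (MultiTrans.id F).naturality)

/-- The identity 2-cell between equal 1-cells, as an isomorphism. -/
def isoOfEq {F G : A ⟶ B} (h : F = G) : F ≅ G where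
  hom := cellOfEq h
  inv := cellOfEq h.symm
  hom_inv_id := by subst h; exact hom₂_ext fun a => ucomp_id _
  inv_hom_id := by subst h; exact hom₂_ext fun a => ucomp_id _

theorem isoOfEq_eq {F G : A ⟶ B} (h : F = G) : isoOfEq h = eqToIso h := by
  subst h
  rfl

end

/-- The 2-category of skew multicategories. -/
instance : Bicategory SkewMultiCat.{v, u} where
  whiskerLeft F _ _ φ := whiskerL F φ
  whiskerRight φ H := whiskerR φ H
  associator F G H := isoOfEq (assoc_eq F G H)
  leftUnitor F := isoOfEq (id_comp_eq F)
  rightUnitor F := isoOfEq (comp_id_eq F)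
  whiskerLeft_id _ _ := rfl
  whiskerLeft_comp _ _ _ _ _ _ := rfl
  id_whiskerLeft _ := hom₂_ext fun _ => ((id_ucomp _).trans (ucomp_id _)).symm
  comp_whiskerLeft _ _ _ _ _ := hom₂_ext fun _ => ((id_ucomp _).trans (ucomp_id _)).symm
  id_whiskerRight _ G := hom₂_ext fun _ => G.map_id _
  comp_whiskerRight _ _ H := hom₂_ext fun _ => map_ucomp H _ _
  whiskerRight_id _ := hom₂_ext fun _ => ((id_ucomp _).trans (ucomp_id _)).symm
  whiskerRight_comp _ _ _ := hom₂_ext fun _ => ((id_ucomp _).trans (ucomp_id _)).symm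
  whisker_assoc _ _ _ _ _ := hom₂_ext fun _ => ((id_ucomp _).trans (ucomp_id _)).symm
  whisker_exchange φ ψ := hom₂_ext fun a =>
    (MultiTrans.naturality ψ (MultiTrans.app φ a) rfl rfl).symm
  pentagon _ _ _ K := hom₂_ext fun _ =>
    (congrArg (fun t => ucomp t _) (K.map_id _)).trans (id_ucomp _)
  triangle _ G := hom₂_ext fun _ => (id_ucomp _).trans (G.map_id _).symm

instance : Bicategory.Strict SkewMultiCat.{v, u} where
  id_comp := id_comp_eq
  comp_id := comp_id_eq
  assoc := assoc_eq
  leftUnitor_eqToIso _ := isoOfEq_eq _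
  rightUnitor_eqToIso _ := isoOfEq_eq _
  associator_eqToIso _ _ _ := isoOfEq_eq _

/-- The multimap `g(f, 1, …, 1)`, where `g` is tight. -/
def compFirst (A : SkewMultiCat.{v, u}) {x : Tightness} {as bs : List A.Obj} {m c : A.Obj}
    (g : A.Hom tight (m :: bs) c) (f : A.Hom x as m) : A.Hom x (as ++ bs) c :=
  A.comp g (.cons f (Maps.ids A.id bs) rfl) (by cases x <;> rfl)

/-- A multimap `θ : as ⟶ m` is universal if it represents the multimaps from `as` of its type:
substitution of `θ` gives a bijection from the tight multimaps `m ⟶ b` to the multimaps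
`as ⟶ b`. -/
def IsUniversal (A : SkewMultiCat.{v, u}) {x : Tightness} {as : List A.Obj} {m : A.Obj}
    (θ : A.Hom x as m) : Prop :=
  ∀ b : A.Obj, Function.Bijective fun g : A.Hom tight [m] b => A.compFirst g θ

/-- Every list of objects has a universal multimap of every type. -/
def IsWeaklyRepresentable (A : SkewMultiCat.{v, u}) : Prop :=
  ∀ (x : Tightness) (as : List A.Obj), x.HasArity as.length →
    ∃ (m : A.Obj) (θ : A.Hom x as m), A.IsUniversal θ

/-- A weakly representable skew multicategory is left representable if substitution of a universal
multimap `θ : as ⟶ m` in the first position gives bijections from the tight multimaps `m, bs ⟶ c`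
to the multimaps `as, bs ⟶ c`. -/
def IsLeftRepresentable (A : SkewMultiCat.{v, u}) : Prop :=
  A.IsWeaklyRepresentable ∧
    ∀ {x : Tightness} {as : List A.Obj} {m : A.Obj} (θ : A.Hom x as m), A.IsUniversal θ →
      ∀ (bs : List A.Obj) (c : A.Obj),
        Function.Bijective fun g : A.Hom tight (m :: bs) c => A.compFirst g θ

/-- A skew multicategory is closed if there are objects `[b, c]` and tight multimaps
`e : [b, c], b ⟶ c` such that `f ↦ e(f, 1)` is a bijection from the multimaps `as ⟶ [b, c]` to the
multimaps `as, b ⟶ c`, of each type that multimaps from `as` can have. -/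
def IsClosed (A : SkewMultiCat.{v, u}) : Prop :=
  ∀ b c : A.Obj, ∃ (h : A.Obj) (e : A.Hom tight [h, b] c),
    ∀ (x : Tightness) (as : List A.Obj), x.HasArity as.length →
      Function.Bijective fun f : A.Hom x as h => A.compFirst e f

/-- The comparisons from tight to loose multimaps are inclusions. -/
def ComparisonInjective (A : SkewMultiCat.{v, u}) : Prop :=
  ∀ (as : List A.Obj) (b : A.Obj), as ≠ [] →
    Function.Injective (A.j : A.Hom tight as b → A.Hom loose as b)

end SkewMultiCat

/-! ## The 2-categories to be compared -/

set_option linter.checkUnivs false in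
/-- The 2-category of closed skew monoidal categories, lax monoidal functors and monoidal natural
transformations. -/
abbrev ClosedSkewMonCat : Type (max (u + 1) (v + 1)) :=
  TwoCat.FullSub (SkewMonCat.IsClosed.{v, u})

set_option linter.checkUnivs false in
/-- The full sub-2-category of closed skew monoidal categories with epimorphic left unit maps. -/
abbrev ClosedSkewMonCatEpi : Type (max (u + 1) (v + 1)) :=
  TwoCat.FullSub fun C : ClosedSkewMonCat.{v, u} => C.1.LeftUnitEpi

set_option linter.checkUnivs false in
/-- The 2-category of left representable closed skew multicategories. -/
abbrev LeftRepClosedSkewMultiCat : Type (max (u + 1) (v + 1)) :=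
  TwoCat.FullSub fun A : SkewMultiCat.{v, u} => A.IsLeftRepresentable ∧ A.IsClosed

set_option linter.checkUnivs false in
/-- The full sub-2-category of left representable closed skew multicategories whose comparisons
from tight to loose multimaps are inclusions. -/
abbrev LeftRepClosedSkewMultiCatInj : Type (max (u + 1) (v + 1)) :=
  TwoCat.FullSub fun A : LeftRepClosedSkewMultiCat.{v, u} => A.1.ComparisonInjective

/-! A skew monoidal category `C` yields a skew multicategory `C.toMulti`. Its tight multimaps `a,
a₁, …, aₙ ⟶ b` are the morphisms `((a ⊗ a₁) ⊗ ⋯) ⊗ aₙ ⟶ b`, its loose multimaps are the same with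
`i` put in front, and the comparison is precomposition with `λ`. To substitute `f : i ⊗ a₁ ⊗ ⋯ ⊗ aₙ
⟶ b` behind a variable `x`, one uses its action `x ⊗ a₁ ⊗ ⋯ ⊗ aₙ ⟶ x ⊗ b`, built from `ρ`, `α` and
`f`. The coherence axioms make these actions natural in `x` and compatible with composition, and let
`λ` recover `f` from its action at `x = i`; the laws of substitution follow.

Morphisms `C.toMulti ⟶ A` are the same as lax monoidal maps from `C` to `A`
(`LaxMap.equivMultiFunctor`), because each multimap of `C.toMulti` comes from a unary one by
substituting the identities of `a ⊗ b` and of `i`, regarded as a binary and a nullary multimap. For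
`A = D.toMulti` a lax monoidal map is just a lax monoidal functor, and the same reduction to
generators handles 2-cells. So the 2-functor is bijective on 1-cells and on 2-cells, with no
closedness involved.

If `A` is left representable, chosen universal multimaps `μ : a, b ⟶ a ⊗ b` and `η : () ⟶ i` define
a skew monoidal structure on the tight unary multimaps; an equation between morphisms out of a
tensor product is tested by substituting universal multimaps. The tautological lax monoidal map from
this category to `A` induces a morphism that is bijective on multimaps, since the bijections given
by `μ` and `η` can be iterated, so it is an isomorphism (`Representation.exists_iso`).

Closedness passes in both directions. It makes `- ⊗ b` preserve epimorphisms, and the comparisons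
are precomposition with `λ ⊗ a₁ ⊗ ⋯ ⊗ aₙ`, so they are injective exactly when all `λ` are
epimorphisms. The formal criterion `IsLocallyBijective.exists_twoEquivalence` then gives both
2-equivalences. -/

namespace SkewMultiCat

/-! ### Substitution calculus in a skew multicategory -/

section

variable {A : SkewMultiCat.{v, u}}

theorem types_heq {as as' bs bs' : List A.Obj} {fs : Maps A.Hom as bs} {fs' : Maps A.Hom as' bs'}
    (h₁ : as = as') (h₂ : bs = bs') (h : HEq fs fs') : fs.types = fs'.types := by
  subst h₁ h₂
  rw [eq_of_heq h]

/-- Substitution of a single multimap, up to an equality of domains, in an identity. -/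
theorem id_comp_heq {x y : Tightness} {as as' : List A.Obj} {b : A.Obj} (f : A.Hom x as b)
    (h : as' = as ++ []) (hy : y = tight.subst [x]) :
    HEq (A.comp (A.id b) (Maps.cons f .nil h) (hy : y = tight.subst (Maps.cons f .nil h).types))
      f := by
  obtain rfl : as' = as := h.trans (List.append_nil as)
  obtain rfl : y = x := by rw [hy]; cases x <;> rfl
  exact heq_of_eq (A.id_comp f _)

theorem split_ids (as : List A.Obj) {bs : List A.Obj} :
    (Maps.split as (Maps.ids (H := A.Hom) A.id (as ++ bs))).left = as ∧
    (Maps.split as (Maps.ids (H := A.Hom) A.id (as ++ bs))).right = bs ∧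
    HEq (Maps.split as (Maps.ids (H := A.Hom) A.id (as ++ bs))).fst
      (Maps.ids (H := A.Hom) A.id as) ∧
    HEq (Maps.split as (Maps.ids (H := A.Hom) A.id (as ++ bs))).snd
      (Maps.ids (H := A.Hom) A.id bs) := by
  induction as with
  | nil => exact ⟨rfl, rfl, HEq.rfl, HEq.rfl⟩
  | cons a as ih =>
    obtain ⟨h₁, h₂, h₃, h₄⟩ := ih
    exact ⟨congrArg (a :: ·) h₁, h₂, cons_heq rfl rfl h₁ rfl HEq.rfl h₃ _ _, h₄⟩

theorem ids_comp {as bs : List A.Obj} (fs : Maps A.Hom as bs) :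
    Maps.comp A.comp (Maps.ids A.id bs) fs = fs := by
  induction fs with
  | nil => rfl
  | @cons x as as' cs b bs f fs h ih =>
    subst h
    refine eq_of_heq (cons_heq (by cases x <;> rfl) (List.append_nil _) rfl rfl ?_
      (heq_of_eq ih) _ _)
    exact id_comp_heq f _ _

theorem subst_ids {x : Tightness} {as : List A.Obj} {b : A.Obj} (f : A.Hom x as b) :
    x = x.subst (Maps.ids (H := A.Hom) A.id as).types := by
  cases x with
  | loose => cases as <;> rfl
  | tight =>
    cases as with
    | nil => exact ((A.isEmpty_tight_nil b).false f).elim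
    | cons a as => rfl

theorem maps_comp_ids {as bs : List A.Obj} (fs : Maps A.Hom as bs) :
    Maps.comp A.comp fs (Maps.ids A.id as) = fs := by
  induction fs with
  | nil => rfl
  | @cons x as as' cs b bs f fs h ih =>
    subst h
    obtain ⟨h₁, h₂, h₃, h₄⟩ := split_ids as (bs := as')
    have ht : x.subst (Maps.split as (Maps.ids (H := A.Hom) A.id (as ++ as'))).fst.types = x := by
      rw [types_heq h₁ rfl h₃]
      exact (subst_ids f).symm
    refine eq_of_heq (cons_heq ht h₁ h₂ rfl ?_ ?_ _ _)
    · exact (comp_heq ht h₁ rfl HEq.rfl h₃ _ (subst_ids f)).trans (heq_of_eq (A.comp_id f _))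
    · have : ∀ {l : List A.Obj} (e : l = as') (m : Maps A.Hom l as'),
          HEq m (Maps.ids (H := A.Hom) A.id as') → HEq (Maps.comp A.comp fs m) fs := by
        intro l e m hm
        subst e
        rw [eq_of_heq hm]
        exact heq_of_eq ih
      exact this h₂ _ h₄

theorem map_ids {B : SkewMultiCat.{v, u}} (F : MultiFunctor A B) (as : List A.Obj) :
    (Maps.ids (H := A.Hom) A.id as).map (K := B.Hom) F.obj F.map =
      Maps.ids (H := B.Hom) B.id (as.map F.obj) := by
  induction as with
  | nil => rfl
  | cons a as ih =>
    change Maps.cons (F.map (A.id a)) _ _ = Maps.cons (B.id (F.obj a)) _ _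
    rw [F.map_id, ih]

theorem tight_subst_cons {x : Tightness} {l : List Tightness} : tight.subst (x :: l) = x := by
  cases x <;> rfl

/-- Substitution into a composite `g(1, f₂, …)`. -/
theorem comp_comp_cons_id {x y : Tightness} {a c : A.Obj} {as as' bs bs' cs : List A.Obj}
    (g : A.Hom tight (a :: bs) c) (fs : Maps A.Hom as bs) (e : A.Hom x as' a)
    (es : Maps A.Hom bs' as) (h : cs = as' ++ bs')
    (hy : y = tight.subst (Maps.cons e es h).types) :
    A.comp (A.comp g (.cons (A.id a) fs rfl) (rfl : tight = _)) (.cons e es h) hy =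
      A.comp g (.cons e (Maps.comp A.comp fs es) h)
        ((hy.trans tight_subst_cons).trans tight_subst_cons.symm) := by
  subst h
  have hx : y = x := hy.trans tight_subst_cons
  subst hx
  refine (A.assoc g (.cons (A.id a) fs rfl) (.cons e es rfl) rfl hy ?_).trans ?_
  · exact hy.trans (by cases y <;> rfl)
  · refine eq_of_heq (comp_heq rfl rfl rfl HEq.rfl ?_ _ _)
    exact cons_heq tight_subst_cons (List.append_nil _) rfl rfl (id_comp_heq e _ rfl) HEq.rfl _ _

/-- Substitution into `g(f, 1, …, 1)`, where `f` is unary. -/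
theorem comp_compFirst₁ {x w y : Tightness} {a m c : A.Obj} {as' bs bs' cs : List A.Obj}
    (g : A.Hom tight (m :: bs) c) (f : A.Hom tight [a] m) (e : A.Hom x as' a)
    (es : Maps A.Hom bs' bs) (h : cs = as' ++ bs')
    (hy : y = tight.subst (Maps.cons e es h).types)
    (hw : w = tight.subst (Maps.single e).types) (hy' : y = tight.subst [w]) :
    A.comp (A.compFirst g f) (.cons e es h) hy =
      A.comp g (.cons (A.comp f (Maps.single e) hw) es h)
        (hy'.trans tight_subst_cons |>.trans tight_subst_cons.symm) := by
  subst h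
  have hx : y = x := hy.trans tight_subst_cons
  subst hx
  obtain rfl : w = y := hw.trans tight_subst_cons
  refine (A.assoc g (.cons f (Maps.ids A.id bs) rfl) (.cons e es rfl) rfl hy ?_).trans ?_
  · exact hy.trans (by cases w <;> rfl)
  · refine eq_of_heq (comp_heq rfl rfl rfl HEq.rfl ?_ _ _)
    refine cons_heq tight_subst_cons (List.append_nil _) rfl rfl ?_ (heq_of_eq (ids_comp es)) _ _
    refine comp_heq tight_subst_cons (List.append_nil _) rfl HEq.rfl ?_ _ _
    exact cons_heq rfl rfl rfl rfl HEq.rfl HEq.rfl _ _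

/-- Substitution into `g(f, 1, …, 1)`, where `f` is binary. -/
theorem comp_compFirst₂ {x x' w y : Tightness} {a a' m c : A.Obj}
    {as as' as'' bs bs' cs cs' : List A.Obj}
    (g : A.Hom tight (m :: bs) c) (f : A.Hom tight [a, a'] m) (e : A.Hom x as a)
    (e' : A.Hom x' as' a') (es : Maps A.Hom bs' bs) (h' : cs' = as' ++ bs') (h : cs = as ++ cs')
    (h'' : as'' = as ++ as')
    (hy : y = tight.subst (Maps.cons e (Maps.cons e' es h') h).types)
    (hw : w = tight.subst (Maps.cons e (Maps.single e') h'').types)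
    (hy' : y = tight.subst [w]) :
    A.comp (A.compFirst g f) (.cons e (.cons e' es h') h) hy =
      A.comp g (.cons (A.comp f (.cons e (Maps.single e') h'') hw) es
        (by rw [h, h', h'', List.append_assoc]))
        (hy'.trans tight_subst_cons |>.trans tight_subst_cons.symm) := by
  subst h h' h''
  have hx : y = x := hy.trans tight_subst_cons
  subst hx
  obtain rfl : w = y := hw.trans tight_subst_cons
  refine (A.assoc g (.cons f (Maps.ids A.id bs) rfl) (.cons e (.cons e' es rfl) rfl) rfl hy
    ?_).trans ?_
  · exact hy.trans (by cases w <;> rfl)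
  · refine eq_of_heq (comp_heq rfl rfl rfl HEq.rfl ?_ _ _)
    have hl : as ++ (as' ++ []) = as ++ as' := by rw [List.append_nil]
    refine cons_heq tight_subst_cons hl rfl rfl ?_ (heq_of_eq (ids_comp es)) _ _
    refine comp_heq tight_subst_cons hl rfl HEq.rfl ?_ _ _
    refine cons_heq rfl rfl (List.append_nil _) rfl HEq.rfl ?_ _ _
    exact cons_heq rfl rfl rfl rfl HEq.rfl HEq.rfl _ _

/-- Substitution into `g(f, 1, …, 1)`, where `f` is nullary. -/
theorem comp_compFirst₀ {m c : A.Obj} {bs bs' : List A.Obj}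
    (g : A.Hom tight (m :: bs) c) (f : A.Hom loose [] m) (es : Maps A.Hom bs' bs)
    (hy : loose = loose.subst es.types) :
    A.comp (A.compFirst g f) es hy = A.comp g (.cons f es rfl) (rfl : loose = _) := by
  refine (A.assoc g (.cons f (Maps.ids A.id bs) rfl) es rfl hy rfl).trans ?_
  refine eq_of_heq (comp_heq rfl rfl rfl HEq.rfl ?_ _ _)
  refine cons_heq rfl rfl rfl rfl ?_ (heq_of_eq (ids_comp es)) _ _
  exact heq_of_eq (A.comp_id f rfl)

theorem compFirst_heq {x : Tightness} {as as' bs bs' : List A.Obj} {m c : A.Obj}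
    {g : A.Hom tight (m :: bs) c} {g' : A.Hom tight (m :: bs') c} {f : A.Hom x as m}
    {f' : A.Hom x as' m} (hb : bs = bs') (ha : as = as') (hg : HEq g g') (hf : HEq f f') :
    HEq (A.compFirst g f) (A.compFirst g' f') := by
  subst ha hb
  obtain rfl := eq_of_heq hg
  obtain rfl := eq_of_heq hf
  rfl

/-- Associativity of substitution in the first variable. The equality is heterogeneous because the
domains are `l ++ (ms ++ bs)` and `(l ++ ms) ++ bs`. -/
theorem compFirst_assoc_heq {x : Tightness} {l ms bs : List A.Obj} {n m c : A.Obj}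
    (g : A.Hom tight (m :: bs) c) (f : A.Hom tight (n :: ms) m) (e : A.Hom x l n) :
    HEq (A.compFirst (bs := ms ++ bs) (A.compFirst g f) e)
      (A.compFirst g (A.compFirst f e)) := by
  obtain ⟨h₁, h₂, h₃, h₄⟩ := split_ids ms (bs := bs)
  have a := A.assoc (z := x) g (.cons f (Maps.ids A.id bs) rfl)
    (.cons e (Maps.ids A.id (ms ++ bs)) rfl) (rfl : tight = _) tight_subst_cons.symm
    (by cases x <;> rfl)
  refine (heq_of_eq a).trans (comp_heq rfl (List.append_assoc _ _ _).symm rfl HEq.rfl ?_ _ _)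
  refine cons_heq tight_subst_cons (congrArg _ h₁) h₂ rfl ?_ ?_ _ _
  · refine comp_heq tight_subst_cons (congrArg _ h₁) rfl HEq.rfl ?_ _ _
    exact cons_heq rfl rfl h₁ rfl HEq.rfl h₃ _ _
  · rw [ids_comp]
    exact h₄

theorem compFirst_ucomp {x : Tightness} {as bs : List A.Obj} {a m c : A.Obj}
    (g : A.Hom tight (m :: bs) c) (f : A.Hom tight [a] m) (e : A.Hom x as a) :
    A.compFirst (A.compFirst (as := [a]) g f) e =
      A.compFirst g (A.comp f (Maps.single e) (by cases x <;> rfl)) := by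
  refine eq_of_heq ((compFirst_assoc_heq g f e).trans (compFirst_heq rfl (List.append_nil _)
    HEq.rfl ?_))
  refine comp_heq rfl (List.append_nil _) rfl HEq.rfl ?_ _ _
  exact cons_heq rfl rfl rfl rfl HEq.rfl HEq.rfl _ _

theorem compFirst_id {bs : List A.Obj} {m c : A.Obj} (g : A.Hom tight (m :: bs) c) :
    A.compFirst (as := [m]) g (A.id m) = g :=
  A.comp_id g rfl

/-- Substitution in the first variable of `g(1, f₂, …)`. -/
theorem compFirst_comp_cons_id {x : Tightness} {a c : A.Obj} {as as' bs : List A.Obj}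
    (g : A.Hom tight (a :: bs) c) (fs : Maps A.Hom as bs) (e : A.Hom x as' a) :
    A.compFirst (A.comp g (.cons (A.id a) fs rfl) (rfl : tight = _)) e =
      A.comp g (.cons e fs rfl) (by cases x <;> rfl) := by
  refine (comp_comp_cons_id g fs e _ rfl _).trans ?_
  congr 1
  rw [maps_comp_ids]

theorem map_compFirst_heq {B : SkewMultiCat.{v, u}} (F : MultiFunctor A B) {x : Tightness}
    {as bs : List A.Obj} {m c : A.Obj} (g : A.Hom tight (m :: bs) c) (f : A.Hom x as m) :
    HEq (F.map (A.compFirst g f)) (B.compFirst (bs := bs.map F.obj) (F.map g) (F.map f)) := by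
  refine (heq_of_eq (F.map_comp g (.cons f (Maps.ids A.id bs) rfl) _
    (by cases x <;> rfl))).trans ?_
  refine comp_heq rfl List.map_append rfl HEq.rfl ?_ _ _
  exact cons_heq rfl rfl rfl rfl HEq.rfl (heq_of_eq (map_ids F bs)) _ _

end

end SkewMultiCat

/-! ### The skew multicategory of a skew monoidal category -/

namespace SkewMonCat

section

variable (C : SkewMonCat.{v, u})

/-- The left bracketed tensor product `((x ⊗ a₁) ⊗ ⋯) ⊗ aₙ`. -/
@[reducible]
def tensorList : List C.carrier → C.carrier → C.carrier
  | [], x => x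
  | a :: as, x => tensorList as (C.tensorObj x a)

/-- The morphism `((f ⊗ a₁) ⊗ ⋯) ⊗ aₙ`. -/
def whiskerList : ∀ (as : List C.carrier) {x y : C.carrier},
    (x ⟶ y) → (C.tensorList as x ⟶ C.tensorList as y)
  | [], _, _, f => f
  | a :: as, _, _, f => whiskerList as (C.tensorHom f (𝟙 a))

/-- The morphism `f ⊗ b₁ ⊗ ⋯ ⊗ bₙ` for a morphism `f` with domain `x ⊗ a₁ ⊗ ⋯ ⊗ aₘ`. -/
def extendList : ∀ (as : List C.carrier) {x y : C.carrier} (_ : C.tensorList as x ⟶ y)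
    (bs : List C.carrier), C.tensorList (as ++ bs) x ⟶ C.tensorList bs y
  | [], _, _, f, bs => C.whiskerList bs f
  | _ :: as, _, _, f, bs => extendList as f bs

/-- The associativity map `((x ⊗ y) ⊗ a₁) ⊗ ⋯ ⊗ aₙ ⟶ x ⊗ (y ⊗ a₁ ⊗ ⋯ ⊗ aₙ)`. -/
def assocList : ∀ (as : List C.carrier) (x y : C.carrier),
    C.tensorList as (C.tensorObj x y) ⟶ C.tensorObj x (C.tensorList as y)
  | [], _, _ => 𝟙 _
  | a :: as, x, y => C.whiskerList as (C.assoc x y a) ≫ assocList as x (C.tensorObj y a)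

/-- The action `x ⊗ a₁ ⊗ ⋯ ⊗ aₙ ⟶ x ⊗ b` of a morphism `i ⊗ a₁ ⊗ ⋯ ⊗ aₙ ⟶ b`. -/
def action {as : List C.carrier} {b : C.carrier} (f : C.tensorList as C.unit ⟶ b)
    (x : C.carrier) : C.tensorList as x ⟶ C.tensorObj x b :=
  C.whiskerList as (C.rightUnit x) ≫ C.assocList as x C.unit ≫ C.tensorHom (𝟙 x) f

@[simp]
theorem whiskerList_id (as : List C.carrier) (x : C.carrier) :
    C.whiskerList as (𝟙 x) = 𝟙 (C.tensorList as x) := by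
  induction as generalizing x with
  | nil => rfl
  | cons a as ih => simp only [whiskerList, C.tensor_id, ih]

theorem whiskerList_comp (as : List C.carrier) {x y z : C.carrier} (f : x ⟶ y) (g : y ⟶ z) :
    C.whiskerList as (f ≫ g) = C.whiskerList as f ≫ C.whiskerList as g := by
  induction as generalizing x y z with
  | nil => rfl
  | cons a as ih => simp only [whiskerList, tensorHom_comp_left, ih]

theorem extendList_comp (as : List C.carrier) {x y z : C.carrier} (f : C.tensorList as x ⟶ y)
    (g : y ⟶ z) (bs : List C.carrier) :
    C.extendList as (f ≫ g) bs = C.extendList as f bs ≫ C.whiskerList bs g := by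
  induction as generalizing x with
  | nil => exact C.whiskerList_comp _ _ _
  | cons a as ih => exact ih _

theorem whiskerList_extendList (as : List C.carrier) {w x y : C.carrier} (h : w ⟶ x)
    (f : C.tensorList as x ⟶ y) (bs : List C.carrier) :
    C.whiskerList (as ++ bs) h ≫ C.extendList as f bs =
      C.extendList as (C.whiskerList as h ≫ f) bs := by
  induction as generalizing w x with
  | nil => exact (C.whiskerList_comp _ _ _).symm
  | cons a as ih => exact ih _ _

/-- The `eqToHom` only rebrackets the list of factors; no associativity map of `C` is involved,
since all tensor products are bracketed to the left. -/
theorem extendList_append (as bs cs : List C.carrier) {x y z : C.carrier}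
    (f : C.tensorList as x ⟶ y) (g : C.tensorList bs y ⟶ z) :
    C.extendList (as ++ bs) (C.extendList as f bs ≫ g) cs =
      eqToHom (by rw [List.append_assoc]) ≫ C.extendList as f (bs ++ cs) ≫
        C.extendList bs g cs := by
  induction as generalizing x with
  | nil =>
    refine Eq.trans ?_ (Category.id_comp _).symm
    exact (C.whiskerList_extendList bs f g cs).symm
  | cons a as ih => exact ih f

theorem assocList_naturality_right (as : List C.carrier) (x : C.carrier) {y y' : C.carrier}
    (g : y ⟶ y') :
    C.whiskerList as (C.tensorHom (𝟙 x) g) ≫ C.assocList as x y' =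
      C.assocList as x y ≫ C.tensorHom (𝟙 x) (C.whiskerList as g) := by
  induction as generalizing y y' with
  | nil => exact (Category.comp_id _).trans (Category.id_comp _).symm
  | cons a as ih =>
    simp only [whiskerList, assocList, Category.assoc, ← ih]
    simp only [← Category.assoc, ← C.whiskerList_comp, C.assoc_naturality]

theorem assocList_naturality_left (as : List C.carrier) {x x' : C.carrier} (f : x ⟶ x')
    (y : C.carrier) :
    C.whiskerList as (C.tensorHom f (𝟙 y)) ≫ C.assocList as x' y =
      C.assocList as x y ≫ C.tensorHom f (𝟙 (C.tensorList as y)) := by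
  induction as generalizing y with
  | nil => exact (Category.comp_id _).trans (Category.id_comp _).symm
  | cons a as ih =>
    simp only [tensorList, whiskerList, assocList, Category.assoc, ← ih]
    simp only [← Category.assoc, ← C.whiskerList_comp, C.assoc_naturality, C.tensor_id]

theorem assocList_extendList (as bs : List C.carrier) (x : C.carrier) {y z : C.carrier}
    (f : C.tensorList as y ⟶ z) :
    C.assocList (as ++ bs) x y ≫ C.tensorHom (𝟙 x) (C.extendList as f bs) =
      C.extendList as (C.assocList as x y ≫ C.tensorHom (𝟙 x) f) bs ≫ C.assocList bs x z := by
  induction as generalizing y with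
  | nil =>
    simp only [assocList, extendList, List.nil_append, Category.id_comp]
    exact (C.assocList_naturality_right bs x f).symm
  | cons a as ih =>
    simp only [assocList, extendList, List.cons_append, Category.assoc, ih,
      ← whiskerList_extendList]

/-- The pentagon, iterated along `as`. -/
theorem assocList_assoc (as : List C.carrier) (x y z : C.carrier) :
    C.assocList as (C.tensorObj x y) z ≫ C.assoc x y (C.tensorList as z) =
      C.whiskerList as (C.assoc x y z) ≫ C.assocList as x (C.tensorObj y z) ≫
        C.tensorHom (𝟙 x) (C.assocList as y z) := by
  induction as generalizing z with
  | nil => simp [assocList, whiskerList, tensorList, C.tensor_id]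
  | cons a as ih =>
    simp only [tensorList, whiskerList, assocList, Category.assoc, ih, tensorHom_comp_right]
    rw [← reassoc_of% C.assocList_naturality_right]
    simp only [← Category.assoc, ← C.whiskerList_comp]
    simp only [Category.assoc, C.pentagon]

theorem assocList_leftUnit (as : List C.carrier) (y : C.carrier) :
    C.assocList as C.unit y ≫ C.leftUnit (C.tensorList as y) =
      C.whiskerList as (C.leftUnit y) := by
  induction as generalizing y with
  | nil => exact Category.id_comp _
  | cons a as ih =>
    simp only [tensorList, whiskerList, assocList, Category.assoc, ih, ← C.whiskerList_comp,
      C.assoc_leftUnit]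

theorem action_naturality {as : List C.carrier} {b : C.carrier}
    (f : C.tensorList as C.unit ⟶ b) {x y : C.carrier} (g : x ⟶ y) :
    C.whiskerList as g ≫ C.action f y = C.action f x ≫ C.tensorHom g (𝟙 b) := by
  simp only [action, Category.assoc, ← C.tensor_comp, Category.comp_id, Category.id_comp]
  rw [← Category.assoc, ← C.whiskerList_comp, C.rightUnit_naturality, C.whiskerList_comp,
    Category.assoc, reassoc_of% C.assocList_naturality_left]
  simp only [← C.tensor_comp, Category.comp_id, Category.id_comp]

/-- The action determines the multimap: `λ` passes through `assocList` and then cancels `ρ` at the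
unit by `λ ∘ ρ = 1`. -/
theorem action_leftUnit {as : List C.carrier} {b : C.carrier}
    (f : C.tensorList as C.unit ⟶ b) : C.action f C.unit ≫ C.leftUnit b = f := by
  simp only [action, Category.assoc, C.leftUnit_naturality]
  rw [reassoc_of% C.assocList_leftUnit, ← Category.assoc, ← C.whiskerList_comp,
    C.rightUnit_leftUnit, whiskerList_id, Category.id_comp]

/-- For a loosened tight multimap the triangle axiom cancels the `ρ` of the action against the `λ`
of the loosening, so that no unit remains. -/
theorem action_whiskerList_leftUnit (as : List C.carrier) {a b : C.carrier}
    (f : C.tensorList as a ⟶ b) (x : C.carrier) :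
    C.action (as := a :: as) (C.whiskerList as (C.leftUnit a) ≫ f) x =
      C.assocList as x a ≫ C.tensorHom (𝟙 x) f := by
  simp only [action, whiskerList, assocList, Category.assoc, tensorHom_comp_right]
  rw [← reassoc_of% C.assocList_naturality_right]
  simp only [← Category.assoc, ← C.whiskerList_comp]
  simp only [Category.assoc, C.triangle, whiskerList_id, Category.id_comp]

/-- The iterated pentagon together with `α ∘ ρ = 1 ⊗ ρ`. This is what makes the action of a
composite the composite of the actions. -/
theorem assocList_action {as : List C.carrier} {b : C.carrier}
    (f : C.tensorList as C.unit ⟶ b) (x y : C.carrier) :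
    C.assocList as x y ≫ C.tensorHom (𝟙 x) (C.action f y) =
      C.action f (C.tensorObj x y) ≫ C.assoc x y b := by
  have h := C.assoc_naturality (𝟙 x) (𝟙 y) f
  rw [C.tensor_id] at h
  simp only [action, Category.assoc, tensorHom_comp_right, h]
  rw [reassoc_of% C.assocList_assoc, ← reassoc_of% C.assocList_naturality_right]
  simp only [← Category.assoc, ← C.whiskerList_comp, C.rightUnit_assoc]

/-- The multimaps of a skew monoidal category. -/
@[reducible]
def MultiHom : Tightness → List C.carrier → C.carrier → Type v
  | tight, [], _ => PEmpty
  | tight, a :: as, b => C.tensorList as a ⟶ b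
  | loose, as, b => C.tensorList as C.unit ⟶ b

variable {C}

/-- The loose multimap associated with a multimap. -/
def MultiHom.loosen : ∀ {x : Tightness} {as : List C.carrier} {b : C.carrier},
    C.MultiHom x as b → (C.tensorList as C.unit ⟶ b)
  | loose, _, _, f => f
  | tight, [], _, f => f.elim
  | tight, a :: as, _, f => C.whiskerList as (C.leftUnit a) ≫ f

/-- The action `x ⊗ a₁ ⊗ ⋯ ⊗ aₘ ⟶ x ⊗ b₁ ⊗ ⋯ ⊗ bₙ` of a tuple of multimaps. -/
def mapsAction : ∀ {as bs : List C.carrier} (_ : Maps C.MultiHom as bs) (x : C.carrier),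
    C.tensorList as x ⟶ C.tensorList bs x
  | _, _, .nil, x => 𝟙 x
  | _, _, .cons (as := as) (as' := as') (b := b) f fs h, x =>
    eqToHom (by rw [h]) ≫ C.extendList as (C.action f.loosen x) as' ≫
      mapsAction fs (C.tensorObj x b)

theorem mapsAction_cons {x : Tightness} {as as' bs : List C.carrier} {b : C.carrier}
    (f : C.MultiHom x as b) (fs : Maps C.MultiHom as' bs) (y : C.carrier) :
    mapsAction (Maps.cons f fs rfl) y =
      C.extendList as (C.action f.loosen y) as' ≫ mapsAction fs (C.tensorObj y b) :=
  Category.id_comp _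

theorem mapsAction_naturality {as bs : List C.carrier} (fs : Maps C.MultiHom as bs)
    {x y : C.carrier} (g : x ⟶ y) :
    C.whiskerList as g ≫ mapsAction fs y = mapsAction fs x ≫ C.whiskerList bs g := by
  induction fs generalizing x y with
  | nil => exact (Category.comp_id _).trans (Category.id_comp _).symm
  | @cons w as as' cs b bs f fs h ih =>
    subst h
    rw [mapsAction_cons, mapsAction_cons, Category.assoc, whiskerList, ← ih, ← Category.assoc,
      ← Category.assoc, ← extendList_comp, whiskerList_extendList, action_naturality]

theorem assocList_mapsAction {as bs : List C.carrier} (fs : Maps C.MultiHom as bs)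
    (x y : C.carrier) :
    C.assocList as x y ≫ C.tensorHom (𝟙 x) (mapsAction fs y) =
      mapsAction fs (C.tensorObj x y) ≫ C.assocList bs x y := by
  induction fs generalizing y with
  | nil => simp [mapsAction, assocList, C.tensor_id, tensorList]
  | @cons w as as' cs b bs f fs h ih =>
    subst h
    rw [mapsAction_cons, mapsAction_cons, tensorHom_comp_right, reassoc_of% assocList_extendList,
      assocList_action, ih, extendList_comp, assocList]
    simp only [Category.assoc]
    rw [reassoc_of% mapsAction_naturality]

/-- Acting on `x ⊗ i` and then moving `x` out with `assocList` agrees with acting on `x` first, by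
naturality along `ρ`. -/
theorem action_mapsAction {as bs : List C.carrier} {c : C.carrier} (fs : Maps C.MultiHom as bs)
    (g : C.tensorList bs C.unit ⟶ c) (x : C.carrier) :
    C.action (mapsAction fs C.unit ≫ g) x = mapsAction fs x ≫ C.action g x := by
  simp only [action, tensorHom_comp_right]
  rw [reassoc_of% assocList_mapsAction, reassoc_of% mapsAction_naturality]

/-- The members of `es` behind `bs` do not meet `k`, and naturality of their action lets `k` be
applied before them. Associativity of substitution rests on this exchange. -/
theorem mapsAction_split {bs bs' as : List C.carrier} (es : Maps C.MultiHom as (bs ++ bs'))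
    {x y : C.carrier} (k : C.tensorList bs x ⟶ y) :
    mapsAction es x ≫ C.extendList bs k bs' =
      eqToHom (congrArg (C.tensorList · x) (Maps.split bs es).eq) ≫
        C.extendList (Maps.split bs es).left (mapsAction (Maps.split bs es).fst x ≫ k)
          (Maps.split bs es).right ≫ mapsAction (Maps.split bs es).snd y := by
  induction bs generalizing as x with
  | nil =>
    refine Eq.trans ?_ (Category.id_comp _).symm
    change _ = C.whiskerList as (𝟙 x ≫ k) ≫ mapsAction es y
    rw [Category.id_comp]
    exact (mapsAction_naturality es k).symm
  | cons b bs ih =>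
    cases es with
    | @cons w p as' _ _ _ f fs h =>
      subst h
      have e := ih fs k
      change mapsAction (Maps.cons f fs rfl) x ≫ C.extendList bs k bs' =
        eqToHom _ ≫ C.extendList (p ++ (Maps.split bs fs).left)
          (mapsAction (Maps.cons f (Maps.split bs fs).fst rfl) x ≫ k) (Maps.split bs fs).right ≫
          mapsAction (Maps.split bs fs).snd y
      rw [mapsAction_cons, mapsAction_cons, Category.assoc, e]
      -- The splitting is replaced by a variable `s`, so that the equation `as' = s.left ++ s.right`
      -- can be substituted and the transports collapse.
      have key : ∀ (s : Maps.Split C.MultiHom as' bs bs')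
          (h : C.tensorList as' (C.tensorObj x b) =
            C.tensorList (s.left ++ s.right) (C.tensorObj x b))
          (h' : C.tensorList (p ++ as') x = C.tensorList ((p ++ s.left) ++ s.right) x),
          C.extendList p (C.action f.loosen x) as' ≫ eqToHom h ≫
              C.extendList s.left (mapsAction s.fst (C.tensorObj x b) ≫ k) s.right ≫
                mapsAction s.snd y =
            eqToHom h' ≫ C.extendList (p ++ s.left) ((C.extendList p (C.action f.loosen x) s.left ≫
              mapsAction s.fst (C.tensorObj x b)) ≫ k) s.right ≫ mapsAction s.snd y := by
        rintro ⟨l, r, rfl, s₁, s₂⟩ h h'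
        dsimp only
        rw [Category.assoc, extendList_append]
        simp
      exact key _ _ _

/-- The composite of `f ⊗ a₁ ⊗ ⋯ ⊗ aₙ`, for a tight multimap `f`, with `k` and a tight multimap. -/
def headComp : ∀ {x w : Tightness} {as as' bs cs : List C.carrier} {b c : C.carrier}
    {l : List Tightness} (_ : C.MultiHom x (b :: bs) c) (_ : C.MultiHom w as b)
    (_ : C.tensorList as' b ⟶ C.tensorList bs b) (_ : cs = as ++ as')
    (_ : tight = x.subst (w :: l)), C.MultiHom tight cs c
  | tight, tight, _ :: _, as', _, _, _, _, _, g, f, k, rfl, _ => C.extendList _ f as' ≫ k ≫ g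
  | tight, tight, [], _, _, _, _, _, _, _, f, _, _, _ => PEmpty.elim f
  | loose, _, _, _, _, _, _, _, _, _, _, _, _, h => nomatch h
  | tight, loose, _, _, _, _, _, _, _, _, _, _, _, h => nomatch h

/-- Substitution with tight result. -/
def tightComp {x : Tightness} {c : C.carrier} : ∀ {as bs : List C.carrier}
    (fs : Maps C.MultiHom as bs) (_ : C.MultiHom x bs c) (_ : tight = x.subst fs.types),
    C.MultiHom tight as c
  | _, _, .nil, _, h => absurd h (by cases x <;> exact fun h => nomatch h)
  | _, _, .cons (b := b) f fs e, g, h => headComp g f (mapsAction fs b) e h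

/-- Substitution of multimaps. -/
def multiComp : ∀ {x y : Tightness} {as bs : List C.carrier} {c : C.carrier}
    (_ : C.MultiHom x bs c) (fs : Maps C.MultiHom as bs) (_ : y = x.subst fs.types),
    C.MultiHom y as c
  | _, loose, _, _, _, g, fs, _ => mapsAction fs C.unit ≫ g.loosen
  | _, tight, _, _, _, g, fs, h => tightComp fs g h

theorem multiComp_loose {x : Tightness} {as bs : List C.carrier} {c : C.carrier}
    (g : C.MultiHom x bs c) (fs : Maps C.MultiHom as bs) (h : loose = x.subst fs.types) :
    multiComp g fs h = mapsAction fs C.unit ≫ g.loosen := rfl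

theorem multiComp_tight {a b c : C.carrier} {as as' bs : List C.carrier}
    (g : C.MultiHom tight (b :: bs) c) (f : C.MultiHom tight (a :: as) b)
    (fs : Maps C.MultiHom as' bs) (h : tight = tight.subst (Maps.cons (H := C.MultiHom) (x := tight) f fs rfl).types) :
    multiComp g (Maps.cons (x := tight) f fs rfl) h = C.extendList as f as' ≫ mapsAction fs b ≫ g := rfl

/-- The induction principle for the instances of substitution with tight result. -/
theorem tight_cases {motive : ∀ {x : Tightness} {as bs : List C.carrier} {c : C.carrier}
      (_ : C.MultiHom x bs c) (fs : Maps C.MultiHom as bs), tight = x.subst fs.types → Prop}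
    (H : ∀ {a b c : C.carrier} {as as' bs : List C.carrier} (g : C.MultiHom tight (b :: bs) c)
      (f : C.MultiHom tight (a :: as) b) (fs : Maps C.MultiHom as' bs),
      motive g (Maps.cons (H := C.MultiHom) (x := tight) f fs rfl) rfl)
    {x : Tightness} {as bs : List C.carrier} {c : C.carrier}
    (g : C.MultiHom x bs c) (fs : Maps C.MultiHom as bs) (h : tight = x.subst fs.types) :
    motive g fs h := by
  cases x with
  | loose => exact nomatch h
  | tight =>
    cases fs with
    | nil => exact nomatch h
    | @cons w p _ _ _ _ f fs e =>
      subst e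
      cases w with
      | loose => exact nomatch h
      | tight =>
        cases p with
        | nil => exact PEmpty.elim f
        | cons a p => exact H g f fs

/-- Tight substitution is computed without units, loose substitution with them. The two agree after
loosening: `λ` slides past the later multimaps by naturality and turns the action of the first one
back into that multimap. -/
theorem loosen_multiComp {x y : Tightness} {as bs : List C.carrier} {c : C.carrier}
    (g : C.MultiHom x bs c) (fs : Maps C.MultiHom as bs) (h : y = x.subst fs.types) :
    (multiComp g fs h).loosen = mapsAction fs C.unit ≫ g.loosen := by
  cases y with
  | loose => rfl
  | tight =>
    refine tight_cases (motive := fun g fs h => (multiComp (y := tight) g fs h).loosen =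
      mapsAction fs C.unit ≫ g.loosen) ?_ g fs h
    intro a b c as as' bs g f fs
    rw [mapsAction_cons]
    change C.whiskerList (as ++ as') _ ≫ _ ≫ _ = (_ ≫ _) ≫ C.whiskerList _ _ ≫ g
    rw [Category.assoc, ← reassoc_of% mapsAction_naturality, ← reassoc_of% extendList_comp,
      action_leftUnit, reassoc_of% whiskerList_extendList]
    rfl

/-- Tuples act functorially. For loose results this is already associativity of substitution. -/
theorem mapsAction_comp {as bs cs : List C.carrier} (fs : Maps C.MultiHom bs cs)
    (es : Maps C.MultiHom as bs) (x : C.carrier) :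
    mapsAction (Maps.comp multiComp fs es) x = mapsAction es x ≫ mapsAction fs x := by
  induction fs generalizing as x with
  | nil => exact (Category.comp_id _).symm
  | @cons w p bs' _ c cs f fs h ih =>
    subst h
    have e := mapsAction_split es (C.action f.loosen x)
    rw [mapsAction_cons, reassoc_of% e]
    change eqToHom _ ≫ C.extendList _ (C.action (multiComp f (Maps.split p es).fst rfl).loosen x)
      _ ≫ mapsAction (Maps.comp multiComp fs (Maps.split p es).snd) _ = _
    rw [ih, loosen_multiComp, action_mapsAction]

/-- The action depends only on the loosened multimaps, and loosening is unchanged by applying a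
comparison. -/
theorem mapsAction_arrow {as bs : List C.carrier} {fs fs' : Maps C.MultiHom as bs}
    (h : Maps.Arrow (fun {_ _} f => MultiHom.loosen (x := tight) f) fs fs') (x : C.carrier) :
    mapsAction fs' x = mapsAction fs x := by
  induction h generalizing x with
  | nil => rfl
  | cons t f h hfs ih =>
    subst h
    rw [mapsAction_cons, mapsAction_cons, ih]
    cases t <;> rfl

theorem action_loosen_id (a x : C.carrier) :
    C.action (as := [a]) (C.leftUnit a) x = 𝟙 (C.tensorObj x a) := by
  have h := C.action_whiskerList_leftUnit [] (𝟙 a) x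
  rw [Category.comp_id] at h
  exact h.trans ((Category.id_comp _).trans (C.tensor_id x a))

theorem loosen_id (a : C.carrier) :
    MultiHom.loosen (C := C) (x := tight) (as := [a]) (b := a) (𝟙 a : a ⟶ a) = C.leftUnit a :=
  Category.comp_id _

theorem mapsAction_ids (as : List C.carrier) (x : C.carrier) :
    mapsAction (Maps.ids (H := C.MultiHom) (fun a => (𝟙 a : a ⟶ a)) as) x = 𝟙 _ := by
  induction as generalizing x with
  | nil => rfl
  | cons a as ih =>
    refine (mapsAction_cons (C := C) (x := tight) (as := [a]) (𝟙 a : a ⟶ a) _ x).trans ?_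
    rw [ih, loosen_id, action_loosen_id]
    exact (Category.comp_id _).trans (C.whiskerList_id as _)

theorem extendList_nil (as : List C.carrier) {x y : C.carrier} (f : C.tensorList as x ⟶ y) :
    C.extendList as f [] = eqToHom (by rw [List.append_nil]) ≫ f := by
  induction as generalizing x with
  | nil => exact (Category.id_comp _).symm
  | cons a as ih => exact ih f

theorem mapsAction_single {x : Tightness} {as : List C.carrier} {b : C.carrier}
    (f : C.MultiHom x as b) (y : C.carrier) :
    mapsAction (Maps.single f) y = C.action f.loosen y := by
  refine (congrArg (_ ≫ ·) (Category.comp_id _)).trans ?_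
  rw [extendList_nil]
  simp

theorem headComp_eq {a b c : C.carrier} {as as' bs cs : List C.carrier} {l : List Tightness}
    (g : C.tensorList bs b ⟶ c) (f : C.tensorList as a ⟶ b)
    {k : C.tensorList as' b ⟶ C.tensorList bs b} (e : a :: cs = (a :: as) ++ as')
    (h : tight = tight.subst (tight :: l)) :
    headComp (x := tight) (w := tight) (as := a :: as) g f k e h =
      eqToHom (congrArg (C.tensorList · a) (List.cons.inj e).2) ≫ C.extendList as f as' ≫ k ≫ g := by
  obtain rfl : cs = as ++ as' := (List.cons.inj e).2
  exact (Category.id_comp _).symm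

/-- A tight result forces the leading multimaps `g`, `f`, `e` to be tight, and these compose
directly; only the remaining ones act. The exchange `mapsAction_split` moves `f` past those members
of `es` that feed into `fs`. -/
theorem multiComp_assoc_tight {a b c d : C.carrier} {as as' bs ds ds' : List C.carrier}
    (g : C.MultiHom tight (b :: bs) c) (f : C.MultiHom tight (a :: as) b)
    (fs : Maps C.MultiHom as' bs) (e : C.MultiHom tight (d :: ds) a)
    (es : Maps C.MultiHom ds' (as ++ as')) :
    multiComp (y := tight) (multiComp (y := tight) g (Maps.cons (x := tight) f fs rfl) rfl)
        (Maps.cons (H := C.MultiHom) (x := tight) (bs := as ++ as') e es rfl) rfl =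
      multiComp (y := tight) g (Maps.comp multiComp (Maps.cons (x := tight) f fs rfl)
        (Maps.cons (H := C.MultiHom) (x := tight) (bs := as ++ as') e es rfl)) rfl := by
  have e₁ := mapsAction_split es f
  change C.extendList ds e ds' ≫ mapsAction es a ≫ C.extendList as f as' ≫ mapsAction fs b ≫ g = _
  rw [reassoc_of% e₁, ← reassoc_of% mapsAction_comp]
  have key : ∀ (s : Maps.Split C.MultiHom ds' as as') (k : C.tensorList s.right b ⟶ _)
      (h : C.tensorList ds' a = C.tensorList (s.left ++ s.right) a)
      (h' : d :: (ds ++ ds') = (d :: (ds ++ s.left)) ++ s.right)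
      (h'' : tight = tight.subst (tight :: (Maps.comp multiComp fs s.snd).types)),
      C.extendList ds e ds' ≫ eqToHom h ≫ C.extendList s.left (mapsAction s.fst a ≫ f) s.right ≫
          k ≫ g =
        headComp (x := tight) (w := tight) (as := d :: (ds ++ s.left)) g
          (C.extendList ds e s.left ≫ mapsAction s.fst a ≫ f) k h' h'' := by
    rintro ⟨l, r, rfl, s₁, s₂⟩ k h h' h''
    rw [headComp_eq, extendList_append]
    simp
  exact key _ _ _ _ _

variable (C) in
/-- The skew multicategory of a skew monoidal category. -/
@[reducible]
def toMulti : SkewMultiCat.{v, u} where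
  Obj := C.carrier
  Hom := C.MultiHom
  isEmpty_tight_nil _ := inferInstanceAs (IsEmpty PEmpty)
  j f := MultiHom.loosen (x := tight) f
  id a := (𝟙 a : a ⟶ a)
  comp := multiComp
  comp_naturality {x x' y y' as bs c} s t g {fs fs'} hfs h h' := by
    have hl : ∀ {x x'} (s : x.Arr x') (g : C.MultiHom x bs c),
        (s.act (fun {_ _} f => MultiHom.loosen (x := tight) f) g : C.MultiHom x' bs c).loosen =
          g.loosen := by
      intro x x' s g
      cases s <;> rfl
    cases y' with
    | loose =>
      rw [multiComp_loose, mapsAction_arrow hfs, hl, ← loosen_multiComp g fs h]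
      cases t <;> rfl
    | tight =>
      -- The only arrow into `tight` is an identity. Likewise below, a comparison applied to the
      -- outer or to the first multimap would make the result loose.
      cases t
      revert s
      refine tight_cases (motive := fun {x as bs c} g fs h => ∀ (fs' : Maps C.MultiHom as bs)
        (_ : Maps.Arrow (fun {_ _} f => MultiHom.loosen (x := tight) f) fs fs')
        (s : x.Arr x') (h' : tight = x'.subst fs'.types),
        multiComp (s.act (fun {_ _} f => MultiHom.loosen (x := tight) f) g) fs' h' =
          multiComp g fs h) ?_ g fs h fs' hfs (h' := h')
      intro a b c as as' bs g f fs fs' hfs s h'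
      cases s with
      | lam => exact nomatch h'
      | id =>
        cases hfs with
        | cons t f h hfs =>
          cases t with
          | lam => exact nomatch h'
          | id =>
            refine (multiComp_tight g f _ h').trans (Eq.trans ?_ (multiComp_tight g f _ rfl).symm)
            rw [mapsAction_arrow hfs]
  id_comp {x as b} f h := by
    cases x with
    | loose =>
      rw [multiComp_loose, mapsAction_single, loosen_id, action_leftUnit]
      rfl
    | tight =>
      cases as with
      | nil => exact PEmpty.elim f
      | cons a as =>
        refine (headComp_eq (bs := []) (𝟙 b) f _ _).trans ?_
        rw [extendList_nil]
        change _ ≫ (_ ≫ f) ≫ 𝟙 b ≫ 𝟙 b = f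
        simp
  comp_id {x as b} f h := by
    cases x with
    | loose =>
      rw [multiComp_loose]
      exact (congrArg (· ≫ _) (mapsAction_ids as _)).trans (Category.id_comp _)
    | tight =>
      cases as with
      | nil => exact PEmpty.elim f
      | cons a as =>
        refine (multiComp_tight (as := []) f (𝟙 a : a ⟶ a) _ h).trans ?_
        exact (congrArg (_ ≫ · ≫ _) (mapsAction_ids as _)).trans (by
          rw [Category.id_comp]
          exact (congrArg (· ≫ _) (C.whiskerList_id as _)).trans (Category.id_comp _))
  assoc {x y z as bs cs d} g fs es h h' h'' := by
    cases z with
    | loose =>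
      rw [multiComp_loose, multiComp_loose, mapsAction_comp, loosen_multiComp, Category.assoc]
    | tight =>
      cases y with
      | loose => exact nomatch h'
      | tight =>
        refine tight_cases (motive := fun {x bs cs c} g fs h => ∀ {as} (es : Maps C.MultiHom as bs)
          (h' : tight = tight.subst es.types)
          (h'' : tight = x.subst (Maps.comp multiComp fs es).types),
          multiComp (multiComp g fs h) es h' = multiComp g (Maps.comp multiComp fs es) h'')
          ?_ g fs h es h' h''
        intro a b c as as' bs g f fs cs es h' h''
        change Maps C.MultiHom cs (a :: (as ++ as')) at es
        cases es with
        | @cons w p cs' _ _ _ e es eq =>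
          subst eq
          cases w with
          | loose => exact nomatch h'
          | tight =>
            cases p with
            | nil => exact PEmpty.elim e
            | cons d p => exact multiComp_assoc_tight g f fs e es

end

end SkewMonCat

/-! ### Loosening in an arbitrary skew multicategory -/

namespace SkewMultiCat

section

variable {A : SkewMultiCat.{v, u}}

/-- The loose multimap associated with a multimap. -/
def toLoose : ∀ {x : Tightness} {as : List A.Obj} {b : A.Obj}, A.Hom x as b → A.Hom loose as b
  | loose, _, _, f => f
  | tight, _, _, f => A.j f

theorem exists_act_eq_toLoose {x : Tightness} {as : List A.Obj} {b : A.Obj} (f : A.Hom x as b) :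
    ∃ s : x.Arr loose, s.act (H := A.Hom) A.j f = toLoose f := by
  cases x with
  | loose => exact ⟨.id _, rfl⟩
  | tight => exact ⟨.lam, rfl⟩

theorem arrow_refl {as bs : List A.Obj} (fs : Maps A.Hom as bs) : Maps.Arrow A.j fs fs := by
  induction fs with
  | nil => exact .nil
  | cons f fs h ih => exact .cons (.id _) f h ih

theorem toLoose_comp {x y : Tightness} {as bs : List A.Obj} {c : A.Obj} (g : A.Hom x bs c)
    (fs : Maps A.Hom as bs) (h : y = x.subst fs.types)
    (h' : loose = loose.subst fs.types) :
    toLoose (A.comp g fs h) = A.comp (toLoose g) fs h' := by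
  obtain ⟨s, hs⟩ := exists_act_eq_toLoose g
  obtain ⟨t, ht⟩ := exists_act_eq_toLoose (A.comp g fs h)
  rw [← hs, ← ht]
  exact (A.comp_naturality s t g (arrow_refl fs) h h').symm

/-- Only the outer multimap and the first argument decide the type of a composite, so naturality
makes the comparison invisible in the second variable. -/
theorem comp_cons_toLoose_second {x : Tightness} {a b c : A.Obj} {as cs : List A.Obj}
    (g : A.Hom tight [a, b] c) (f : A.Hom x as b) (h : cs = [a] ++ as) :
    A.comp g (.cons (A.id a) (Maps.single (toLoose f)) h) (rfl : tight = _) =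
      A.comp g (.cons (A.id a) (Maps.single f) h) (rfl : tight = _) := by
  obtain ⟨s, hs⟩ := exists_act_eq_toLoose f
  rw [← hs]
  exact A.comp_naturality (.id _) (.id _) g
    (.cons (.id _) _ _ (.cons s f _ .nil)) rfl rfl

end

end SkewMultiCat

/-! ### Lax monoidal maps and the morphisms of skew multicategories they induce -/

open SkewMultiCat

/-- A lax monoidal map from a skew monoidal category to a skew multicategory. -/
structure LaxMap (C : SkewMonCat.{v, u}) (A : SkewMultiCat.{v, u}) where
  obj : C.carrier → A.Obj
  map : ∀ {a b : C.carrier}, (a ⟶ b) → A.Hom tight [obj a] (obj b)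
  map_id : ∀ a : C.carrier, map (𝟙 a) = A.id (obj a)
  map_comp : ∀ {a b c : C.carrier} (f : a ⟶ b) (g : b ⟶ c),
    map (f ≫ g) = A.compFirst (map g) (map f)
  mu : ∀ a b : C.carrier, A.Hom tight [obj a, obj b] (obj (C.tensorObj a b))
  eta : A.Hom loose [] (obj C.unit)
  mu_naturality : ∀ {a a' b b' : C.carrier} (f : a ⟶ a') (g : b ⟶ b'),
    A.compFirst (map (C.tensorHom f g)) (mu a b) =
      A.comp (mu a' b') (.cons (map f) (Maps.single (map g)) rfl) rfl
  associativity : ∀ a b c : C.carrier,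
    A.compFirst (as := [obj a, obj b, obj c]) (map (C.assoc a b c))
        (A.compFirst (mu (C.tensorObj a b) c) (mu a b)) =
      A.comp (mu a (C.tensorObj b c)) (.cons (A.id (obj a)) (Maps.single (mu b c)) rfl) rfl
  left_unitality : ∀ a : C.carrier,
    A.compFirst (as := [obj a]) (map (C.leftUnit a)) (A.compFirst (mu C.unit a) eta) =
      A.j (A.id (obj a))
  right_unitality : ∀ a : C.carrier,
    map (C.rightUnit a) = A.comp (mu a C.unit) (.cons (A.id (obj a)) (Maps.single eta) rfl) rfl

namespace LaxMap

variable {C : SkewMonCat.{v, u}} {A : SkewMultiCat.{v, u}} (F : LaxMap C A)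

/-- The tight multimap corresponding to a morphism `a ⊗ a₁ ⊗ ⋯ ⊗ aₙ ⟶ b`. -/
def tightMap : ∀ (as : List C.carrier) {a b : C.carrier} (_ : C.tensorList as a ⟶ b),
    A.Hom tight (F.obj a :: as.map F.obj) (F.obj b)
  | [], _, _, f => F.map f
  | c :: as, a, _, f => A.compFirst (tightMap as f) (F.mu a c)

/-- The action on multimaps. -/
def multiMap : ∀ {x : Tightness} {as : List C.carrier} {b : C.carrier},
    C.MultiHom x as b → A.Hom x (as.map F.obj) (F.obj b)
  | loose, as, _, f => A.compFirst (as := []) (F.tightMap as f) F.eta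
  | tight, [], _, f => PEmpty.elim f
  | tight, _ :: as, _, f => F.tightMap as f

theorem compFirst_mu_map {x y b : C.carrier} (k : x ⟶ y) :
    A.compFirst (as := [F.obj x]) (F.mu y b) (F.map k) =
      A.compFirst (F.map (C.tensorHom k (𝟙 b))) (F.mu x b) := by
  rw [F.mu_naturality, F.map_id]
  rfl

theorem tightMap_whiskerList (as : List C.carrier) {x y z : C.carrier} (k : x ⟶ y)
    (g : C.tensorList as y ⟶ z) :
    F.tightMap as (C.whiskerList as k ≫ g) =
      A.compFirst (as := [F.obj x]) (F.tightMap as g) (F.map k) := by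
  induction as generalizing x y with
  | nil => exact F.map_comp k g
  | cons b as ih =>
    have h := compFirst_assoc_heq (F.tightMap as g) (F.mu y b) (F.map k)
    refine Eq.trans ?_ (eq_of_heq h.symm)
    rw [F.compFirst_mu_map]
    refine (congrArg (fun t => A.compFirst t (F.mu x b)) (ih _ g)).trans ?_
    exact compFirst_ucomp _ _ _

/-- Composition in `C` becomes substitution in the first variable. With `as = []` this is naturality
of `mu` in its first argument. -/
theorem tightMap_extendList_heq (as bs : List C.carrier) {x y z : C.carrier}
    (k : C.tensorList as x ⟶ y) (g : C.tensorList bs y ⟶ z) :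
    HEq (F.tightMap (as ++ bs) (C.extendList as k bs ≫ g))
      (A.compFirst (F.tightMap bs g) (F.tightMap as k)) := by
  induction as generalizing x with
  | nil => exact heq_of_eq (F.tightMap_whiskerList bs k g)
  | cons a as ih =>
    have h := compFirst_assoc_heq (F.tightMap bs g) (F.tightMap as k) (F.mu x a)
    exact (compFirst_heq List.map_append rfl (ih k) HEq.rfl).trans h

/-- The associativity axiom of a lax monoidal map, iterated along `as`. -/
theorem compFirst_tightMap_assocList (as : List C.carrier) (x : C.carrier) {y b : C.carrier}
    (k : C.tensorList as y ⟶ b) :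
    A.compFirst (F.tightMap as (C.assocList as x y ≫ C.tensorHom (𝟙 x) k)) (F.mu x y) =
      A.comp (F.mu x b) (.cons (A.id _) (Maps.single (F.tightMap as k)) rfl) rfl := by
  induction as generalizing y with
  | nil =>
    refine (congrArg (fun t => A.compFirst (F.map t) (F.mu x y)) (Category.id_comp _)).trans ?_
    rw [F.mu_naturality, F.map_id]
    rfl
  | cons a as ih =>
    have e : F.tightMap as (C.assocList (a :: as) x y ≫ C.tensorHom (𝟙 x) k) =
        A.compFirst (as := [F.obj _])
          (F.tightMap as (C.assocList as x (C.tensorObj y a) ≫ C.tensorHom (𝟙 x) k))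
          (F.map (C.assoc x y a)) := by
      rw [← tightMap_whiskerList, SkewMonCat.assocList, Category.assoc]
    refine (congrArg (fun t => A.compFirst (as := [F.obj x, F.obj y])
      (bs := F.obj a :: as.map F.obj) (A.compFirst t (F.mu (C.tensorObj x y) a)) (F.mu x y)) e).trans
        ?_
    rw [compFirst_ucomp]
    have h := compFirst_assoc_heq (F.tightMap as
      (C.assocList as x (C.tensorObj y a) ≫ C.tensorHom (𝟙 x) k))
      (A.compFirst (F.map (C.assoc x y a)) (F.mu (C.tensorObj x y) a)) (F.mu x y)
    refine (eq_of_heq h).trans ?_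
    have h' := compFirst_assoc_heq (F.map (C.assoc x y a)) (F.mu (C.tensorObj x y) a) (F.mu x y)
    rw [eq_of_heq h']
    refine (congrArg (A.compFirst _) (F.associativity x y a)).trans ?_
    -- Read backwards, associativity of substitution puts `mu x (y ⊗ a)` alone in the first
    -- variable, the form to which the induction hypothesis applies.
    refine (comp_compFirst₂ _ (F.mu x (C.tensorObj y a)) (A.id (F.obj x)) (F.mu y a)
      (Maps.ids A.id (as.map F.obj)) rfl rfl rfl rfl rfl rfl).symm.trans ?_
    rw [ih]
    refine (comp_comp_cons_id _ _ _ _ _ _).trans ?_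
    rw [single_comp _ _ (rfl : tight = _)]
    rfl

/-- Right unitality replaces the `ρ` inside the action by `mu(1, eta)`; the iterated associativity
axiom then collects `eta` and the variables `as` into the image of `f`. -/
theorem tightMap_action {as : List C.carrier} {b : C.carrier} (f : C.tensorList as C.unit ⟶ b)
    (x : C.carrier) :
    F.tightMap as (C.action f x) = A.comp (F.mu x b) (.cons (A.id _)
      (Maps.single (F.multiMap (x := loose) f)) rfl) rfl := by
  refine (F.tightMap_whiskerList as (C.rightUnit x) _).trans ?_
  rw [F.right_unitality]
  refine (comp_compFirst₂ _ (F.mu x C.unit) (A.id (F.obj x)) F.eta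
      (Maps.ids A.id (as.map F.obj)) rfl rfl rfl rfl rfl rfl).symm.trans ?_
  rw [F.compFirst_tightMap_assocList]
  refine (comp_comp_cons_id _ _ _ _ _ _).trans ?_
  rw [single_comp _ _ (rfl : loose = _)]
  rfl

/-- Left unitality: the comparison of `C.toMulti` is precomposition with `λ`, and `λ` evaluated at
`eta` is the loose identity. -/
theorem multiMap_loosen {x : Tightness} {as : List C.carrier} {b : C.carrier}
    (f : C.MultiHom x as b) :
    F.multiMap (x := loose) f.loosen = toLoose (F.multiMap f) := by
  cases x with
  | loose => rfl
  | tight =>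
    cases as with
    | nil => exact PEmpty.elim f
    | cons a as =>
      have e := F.tightMap_whiskerList as (C.leftUnit a) f
      refine (congrArg (fun t => A.compFirst (as := []) (bs := F.obj a :: as.map F.obj)
        (A.compFirst (as := [F.obj C.unit, F.obj a]) t (F.mu C.unit a)) F.eta) e).trans ?_
      rw [compFirst_ucomp]
      have h := compFirst_assoc_heq (F.tightMap as f)
        (A.compFirst (F.map (C.leftUnit a)) (F.mu C.unit a)) F.eta
      refine (eq_of_heq h).trans ?_
      have h' := compFirst_assoc_heq (F.map (C.leftUnit a)) (F.mu C.unit a) F.eta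
      rw [eq_of_heq h']
      refine (congrArg (A.compFirst _) (F.left_unitality a)).trans ?_
      refine Eq.trans ?_ (congrArg A.j (compFirst_id (F.tightMap as f)))
      -- `g(j 1, 1, …, 1) = j (g(1, …, 1))`: loosening the first argument loosens the result.
      exact A.comp_naturality (.id _) .lam (F.tightMap as f)
        (.cons .lam (A.id _) _ (arrow_refl _)) rfl rfl

/-- The heart of functoriality: the action of a tuple behind `x` is sent to substitution of its
image behind an identity. Each member contributes `mu(1, f)`, where the type of `f` does not matter
because it stands in the second variable. -/
theorem tightMap_mapsAction {as bs : List C.carrier} (fs : Maps C.MultiHom as bs)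
    {x c : C.carrier} (g : C.tensorList bs x ⟶ c) :
    F.tightMap as (SkewMonCat.mapsAction fs x ≫ g) =
      A.comp (F.tightMap bs g) (.cons (A.id _) (fs.map (K := A.Hom) F.obj F.multiMap) rfl) rfl := by
  induction fs generalizing x with
  | nil =>
    rw [SkewMonCat.mapsAction]
    exact (congrArg F.map (Category.id_comp g)).trans (compFirst_id (F.map g)).symm
  | @cons w as as' cs b bs f fs h ih =>
    subst h
    have e := F.tightMap_extendList_heq as as' (C.action f.loosen x)
      (SkewMonCat.mapsAction fs (C.tensorObj x b) ≫ g)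
    have e' : F.tightMap as (C.action f.loosen x) = A.comp (F.mu x b) (.cons (A.id _)
        (Maps.single (F.multiMap f)) rfl) rfl := by
      rw [F.tightMap_action, F.multiMap_loosen]
      exact comp_cons_toLoose_second _ _ _
    replace e := e.trans (heq_of_eq ((congrArg₂ (A.compFirst · ·) (ih g) e').trans
      (compFirst_comp_cons_id _ _ _)))
    rw [SkewMonCat.mapsAction_cons, Category.assoc]
    refine (eq_of_heq ?_).trans (comp_compFirst₂ (F.tightMap bs g) (F.mu x b) (A.id (F.obj x))
      (F.multiMap f) (fs.map (K := A.Hom) F.obj F.multiMap) List.map_append rfl rfl rfl rfl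
      rfl).symm
    refine e.trans (comp_heq rfl (congrArg _ List.map_append.symm) rfl HEq.rfl ?_ _ _)
    exact cons_heq rfl rfl rfl rfl HEq.rfl HEq.rfl _ _

/-- The morphism of skew multicategories induced by a lax monoidal map. -/
def toMultiFunctor : MultiFunctor C.toMulti A where
  obj := F.obj
  map f := F.multiMap f
  map_j f := F.multiMap_loosen f
  map_id a := F.map_id a
  map_comp {x y as bs c} g fs h h' := by
    cases y with
    | loose =>
      have hl : loose = loose.subst (fs.map (K := A.Hom) F.obj F.multiMap).types := by
        cases fs <;> rfl
      -- A loose composite is the action at `x = i`; filling that variable with `eta` gives the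
      -- substitution in `A`.
      have e := F.tightMap_mapsAction fs (x := C.unit) g.loosen
      refine (congrArg (fun t => A.compFirst (as := []) t F.eta) e).trans ?_
      refine (compFirst_comp_cons_id _ _ _).trans ?_
      refine (comp_compFirst₀ _ _ _ hl).symm.trans ?_
      refine (congrArg (fun t => A.comp t _ hl) (F.multiMap_loosen g)).trans ?_
      exact (toLoose_comp (F.multiMap g) _ h' hl).symm
    | tight =>
      refine SkewMonCat.tight_cases (motive := fun {x as bs c} g fs h =>
        ∀ h' : tight = x.subst (fs.map (K := A.Hom) F.obj F.multiMap).types,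
          F.multiMap (C.toMulti.comp g fs h) =
            A.comp (F.multiMap g) (fs.map (K := A.Hom) F.obj F.multiMap) h') ?_ g fs h h'
      intro a b c as as' bs g f fs h'
      have e := F.tightMap_extendList_heq as as' f (SkewMonCat.mapsAction fs b ≫ g)
      replace e := e.trans (heq_of_eq ((congrArg (A.compFirst · (F.tightMap as f))
        (F.tightMap_mapsAction fs g)).trans (compFirst_comp_cons_id _ _ _)))
      refine eq_of_heq (e.trans (comp_heq rfl ?_ rfl HEq.rfl ?_ _ _))
      · exact congrArg (F.obj a :: ·) List.map_append.symm
      · exact cons_heq rfl rfl rfl rfl HEq.rfl HEq.rfl _ _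

end LaxMap

/-! ### Lax monoidal functors as lax monoidal maps, and the universal property -/

namespace SkewMonCat

variable {D : SkewMonCat.{v, u}}

theorem toMulti_compFirst {a m c : D.carrier} {as bs : List D.carrier}
    (g : D.tensorList bs m ⟶ c) (f : D.tensorList as a ⟶ m) :
    D.toMulti.compFirst (x := tight) (as := a :: as) (bs := bs) g f =
      (D.extendList as f bs ≫ g : D.tensorList (as ++ bs) a ⟶ c) :=
  congrArg (_ ≫ ·) ((congrArg (· ≫ g) (mapsAction_ids bs m)).trans (Category.id_comp g))

/-- The substitution loosens `g` by a `λ`, and `action_leftUnit` absorbs it. -/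
theorem toMulti_compFirst_loose {m c : D.carrier} {as bs : List D.carrier}
    (g : D.tensorList bs m ⟶ c) (f : D.tensorList as D.unit ⟶ m) :
    D.toMulti.compFirst (x := loose) (as := as) (bs := bs) g f =
      (D.extendList as f bs ≫ g : D.tensorList (as ++ bs) D.unit ⟶ c) := by
  refine (congrArg (· ≫ D.whiskerList bs (D.leftUnit m) ≫ g) (mapsAction_cons (x := loose)
    f _ D.unit)).trans ?_
  refine (congrArg (fun t => (D.extendList as (D.action f D.unit) bs ≫ t) ≫ _)
    (mapsAction_ids bs _)).trans ?_
  rw [Category.comp_id, ← reassoc_of% extendList_comp, action_leftUnit]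

theorem toMulti_comp_cons_single {x : Tightness} {a a' b' c : D.carrier}
    {as : List D.carrier} (g : D.tensorObj a' b' ⟶ c) (f : a ⟶ a')
    (h : D.MultiHom x as b') :
    D.toMulti.comp (x := tight) (bs := [a', b']) g (.cons (H := D.MultiHom) (x := tight)
        (as := [a]) f (Maps.single h) rfl) (rfl : tight = _) =
      (D.whiskerList as f ≫ D.action h.loosen a' ≫ g : D.tensorList as a ⟶ c) :=
  congrArg (fun t => D.whiskerList as f ≫ t ≫ g) (mapsAction_single h a')

/-- Unary multimaps act by `1 ⊗ f` alone, binary ones through `α` and nullary ones through `ρ`.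
These three computations translate the axioms of a lax monoidal map into those of a lax monoidal
functor. -/
theorem action_tight_unary {a b : D.carrier} (f : a ⟶ b) (x : D.carrier) :
    D.action (MultiHom.loosen (C := D) (x := tight) (as := [a]) f) x =
      D.tensorHom (𝟙 x) f :=
  (D.action_whiskerList_leftUnit [] f x).trans (Category.id_comp _)

theorem action_tight_binary {a a' b : D.carrier} (f : D.tensorObj a a' ⟶ b) (x : D.carrier) :
    D.action (MultiHom.loosen (C := D) (x := tight) (as := [a, a']) f) x =
      D.assoc x a a' ≫ D.tensorHom (𝟙 x) f :=
  (D.action_whiskerList_leftUnit [a'] f x).trans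
    (congrArg (· ≫ _) (Category.comp_id (D.assoc x a a')))

theorem action_nullary {b : D.carrier} (f : D.unit ⟶ b) (x : D.carrier) :
    D.action (as := []) f x = D.rightUnit x ≫ D.tensorHom (𝟙 x) f :=
  congrArg (_ ≫ ·) (Category.id_comp _)

end SkewMonCat

namespace LaxMap

open SkewMonCat

variable {C D : SkewMonCat.{v, u}} {A B : SkewMultiCat.{v, u}}

theorem ext_heq {F G : LaxMap C A} (hobj : F.obj = G.obj)
    (hmap : ∀ {a b : C.carrier} (f : a ⟶ b), HEq (F.map f) (G.map f))
    (hmu : ∀ a b, HEq (F.mu a b) (G.mu a b)) (heta : HEq F.eta G.eta) : F = G := by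
  obtain ⟨o, m, _, _, t, e, _, _, _, _⟩ := F
  obtain ⟨o', m', _, _, t', e', _, _, _, _⟩ := G
  obtain rfl : o = o' := hobj
  obtain rfl : @m = @m' := by
    funext a b f
    exact eq_of_heq (hmap f)
  obtain rfl : t = t' := by
    funext a b
    exact eq_of_heq (hmu a b)
  obtain rfl : e = e' := eq_of_heq heta
  rfl

/-- The lax monoidal map given by a lax monoidal functor. -/
def ofLaxFunctor (F : LaxFunctor C D) : LaxMap C D.toMulti where
  obj := F.functor.obj
  map f := F.functor.map f
  map_id a := F.functor.map_id a
  map_comp f g := (F.functor.map_comp f g).trans (toMulti_compFirst (as := []) (bs := []) _ _).symm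
  mu := F.mu
  eta := F.eps
  mu_naturality {a a' b b'} f g := by
    refine (toMulti_compFirst (as := [_]) (bs := []) _ _).trans
      (Eq.trans ?_ (toMulti_comp_cons_single (x := tight) (as := [_]) _ _ _).symm)
    rw [action_tight_unary]
    refine (F.mu_naturality f g).symm.trans ?_
    change _ = D.tensorHom _ _ ≫ _
    rw [← Category.assoc, ← D.tensor_comp, Category.comp_id, Category.id_comp]
  associativity a b c := by
    refine (toMulti_compFirst (as := [_, _]) (bs := []) _ _).trans
      (Eq.trans ?_ (toMulti_comp_cons_single (x := tight) (as := [_, _]) _ _ _).symm)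
    rw [action_tight_binary, toMulti_compFirst (as := [_]) (bs := [_])]
    refine Eq.trans ?_ ((F.associativity a b c).trans ?_)
    · exact Category.assoc _ _ _
    · refine Eq.symm ((congrArg (· ≫ _) (D.whiskerList_id [_, _] _)).trans ?_)
      rw [Category.id_comp, Category.assoc]
  left_unitality a := by
    refine (toMulti_compFirst_loose (as := [_]) (bs := []) _ _).trans ?_
    rw [toMulti_compFirst_loose (as := []) (bs := [_])]
    refine (Category.assoc _ _ _).trans ((F.left_unitality a).trans (Category.comp_id _).symm)
  right_unitality a := by
    refine Eq.trans ?_ (toMulti_comp_cons_single (x := loose) (as := []) _ _ _).symm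
    refine (F.right_unitality a).symm.trans ?_
    refine Eq.symm ((Category.id_comp _).trans ?_)
    refine (congrArg (· ≫ F.mu a C.unit) (action_nullary _ _)).trans ?_
    exact Category.assoc _ _ _

/-- The lax monoidal functor given by a lax monoidal map. -/
def toLaxFunctor (F : LaxMap C D.toMulti) : LaxFunctor C D where
  functor :=
    { obj := F.obj
      map := F.map
      map_id := F.map_id
      map_comp f g := (F.map_comp f g).trans (toMulti_compFirst (as := []) (bs := []) _ _) }
  mu := F.mu
  eps := F.eta
  mu_naturality {a a' b b'} f g := by
    refine Eq.trans ?_ ((F.mu_naturality f g).symm.trans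
      (toMulti_compFirst (as := [_]) (bs := []) _ _))
    refine Eq.symm ((toMulti_comp_cons_single (x := tight) (as := [_]) _ _ _).trans ?_)
    rw [action_tight_unary]
    change D.tensorHom _ _ ≫ _ = _
    rw [← Category.assoc, ← D.tensor_comp, Category.comp_id, Category.id_comp]
  associativity a b c := by
    have h := F.associativity a b c
    replace h := (toMulti_compFirst (as := [_, _]) (bs := []) _ _).symm.trans
      (h.trans (toMulti_comp_cons_single (x := tight) (as := [_, _]) _ _ _))
    rw [action_tight_binary, toMulti_compFirst (as := [_]) (bs := [_])] at h
    refine Eq.trans ?_ (h.trans ?_)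
    · exact (Category.assoc _ _ _).symm
    · refine ((congrArg (· ≫ _) (D.whiskerList_id [_, _] _)).trans ?_)
      rw [Category.id_comp, Category.assoc]
  left_unitality a := by
    have h := F.left_unitality a
    replace h := (toMulti_compFirst_loose (as := [_]) (bs := []) _ _).symm.trans h
    rw [toMulti_compFirst_loose (as := []) (bs := [_])] at h
    exact (Category.assoc _ _ _).symm.trans (h.trans (Category.comp_id _))
  right_unitality a := by
    refine Eq.trans ?_ ((F.right_unitality a).trans
      (toMulti_comp_cons_single (x := loose) (as := []) _ _ _)).symm
    refine Eq.symm ((Category.id_comp _).trans ?_)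
    refine (congrArg (· ≫ F.mu a C.unit) (action_nullary _ _)).trans ?_
    exact Category.assoc _ _ _

/-- The composite of a lax monoidal map with a morphism of skew multicategories. -/
def postcomp (F : LaxMap C A) (G : MultiFunctor A B) : LaxMap C B where
  obj a := G.obj (F.obj a)
  map f := G.map (F.map f)
  map_id a := (congrArg _ (F.map_id a)).trans (G.map_id _)
  map_comp f g := (congrArg _ (F.map_comp f g)).trans (eq_of_heq (map_compFirst_heq G _ _))
  mu a b := G.map (F.mu a b)
  eta := G.map F.eta
  mu_naturality f g :=
    (eq_of_heq (map_compFirst_heq G _ _)).symm.trans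
      ((congrArg _ (F.mu_naturality f g)).trans (G.map_comp _ _ _ rfl))
  associativity a b c := by
    have h := congrArg G.map (F.associativity a b c)
    replace h := h.trans (G.map_comp (F.mu a (C.tensorObj b c)) _ _ rfl)
    refine (congrArg (B.compFirst _) (eq_of_heq (map_compFirst_heq G _ _))).symm.trans
      ((eq_of_heq (map_compFirst_heq G _ _)).symm.trans (h.trans ?_))
    simp only [Maps.map, Maps.single, G.map_id]
    rfl
  left_unitality a := by
    have h := congrArg G.map (F.left_unitality a)
    rw [G.map_j, G.map_id] at h
    exact (congrArg (B.compFirst _) (eq_of_heq (map_compFirst_heq G _ _))).symm.trans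
      ((eq_of_heq (map_compFirst_heq G _ _)).symm.trans h)
  right_unitality a := by
    have h := congrArg G.map (F.right_unitality a)
    replace h := h.trans (G.map_comp (F.mu a C.unit) _ _ rfl)
    refine h.trans ?_
    simp only [Maps.map, Maps.single, G.map_id]
    rfl

/-- The restriction of a morphism of skew multicategories to a lax monoidal map. -/
def ofMultiFunctor (G : MultiFunctor C.toMulti A) : LaxMap C A :=
  (ofLaxFunctor (LaxFunctor.id C)).postcomp G

/-- A morphism `f` out of `(a ⊗ c) ⊗ ⋯`, read as a multimap in `a, c, …`, is its reading in `a ⊗ c,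
…` with `𝟙 (a ⊗ c)` substituted as a binary multimap. Hence `G` is determined by its values on
morphisms and on these identities. -/
theorem tightMap_ofMultiFunctor (G : MultiFunctor C.toMulti A) (as : List C.carrier)
    {a b : C.carrier} (f : C.tensorList as a ⟶ b) :
    (ofMultiFunctor G).tightMap as f = G.map (x := tight) (as := a :: as) f := by
  induction as generalizing a with
  | nil => rfl
  | cons c as ih =>
    have h := map_compFirst_heq G (x := tight) (as := [a, c]) (bs := as) f
      (𝟙 (C.tensorObj a c) : C.tensorObj a c ⟶ C.tensorObj a c)
    refine (congrArg (A.compFirst · _) (ih f)).trans ((eq_of_heq h).symm.trans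
      (congrArg (G.map (x := tight) (as := a :: c :: as)) ?_))
    refine (toMulti_compFirst (as := [c]) _ _).trans ?_
    exact (congrArg (· ≫ f) (C.whiskerList_id as _)).trans (Category.id_comp f)

theorem toMultiFunctor_ofMultiFunctor (G : MultiFunctor C.toMulti A) :
    (ofMultiFunctor G).toMultiFunctor = G := by
  refine MultiFunctor.ext rfl fun {x as b} f => heq_of_eq ?_
  cases x with
  | loose =>
    have h := map_compFirst_heq G (x := loose) (as := []) (bs := as) f
      (𝟙 C.unit : C.unit ⟶ C.unit)
    refine (congrArg (A.compFirst · _) (tightMap_ofMultiFunctor G as f)).trans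
      ((eq_of_heq h).symm.trans (congrArg (G.map (x := loose) (as := as)) ?_))
    refine (toMulti_compFirst_loose (as := []) _ _).trans ?_
    exact (congrArg (· ≫ f) (C.whiskerList_id as _)).trans (Category.id_comp f)
  | tight =>
    cases as with
    | nil => exact PEmpty.elim f
    | cons a as => exact tightMap_ofMultiFunctor G as f

theorem compFirst_id_left {x : Tightness} {as : List A.Obj} {b : A.Obj} (f : A.Hom x as b) :
    HEq (A.compFirst (A.id b) f) f :=
  id_comp_heq f _ (by cases x <;> rfl)

theorem ofMultiFunctor_toMultiFunctor (F : LaxMap C A) : ofMultiFunctor F.toMultiFunctor = F := by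
  refine ext_heq rfl (fun f => HEq.rfl) (fun a b => ?_) ?_
  · refine HEq.trans (heq_of_eq (congrArg (A.compFirst · (F.mu a b)) (F.map_id _))) ?_
    exact compFirst_id_left _
  · refine HEq.trans (heq_of_eq (congrArg (A.compFirst · F.eta) (F.map_id _))) ?_
    exact compFirst_id_left _

/-- The universal property of the skew multicategory of a skew monoidal category. -/
def equivMultiFunctor : LaxMap C A ≃ MultiFunctor C.toMulti A where
  toFun := toMultiFunctor
  invFun := ofMultiFunctor
  left_inv := ofMultiFunctor_toMultiFunctor
  right_inv := toMultiFunctor_ofMultiFunctor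

/-- Lax monoidal functors are lax monoidal maps to the skew multicategory of the codomain. -/
def equivLaxFunctor : LaxFunctor C D ≃ LaxMap C D.toMulti where
  toFun := ofLaxFunctor
  invFun := toLaxFunctor
  left_inv _ := rfl
  right_inv _ := rfl

end LaxMap

/-! ### 2-cells between morphisms induced by lax monoidal maps -/

namespace SkewMultiCat

variable {A B : SkewMultiCat.{v, u}}

theorem comp_single_compFirst {x : Tightness} {as bs : List A.Obj} {m b c : A.Obj}
    (h : A.Hom tight [b] c) (g : A.Hom tight (m :: bs) b) (f : A.Hom x as m)
    (hx : x = tight.subst (Maps.single (A.compFirst g f)).types) :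
    A.comp h (Maps.single (A.compFirst g f)) hx =
      A.compFirst (A.comp h (Maps.single g) (rfl : tight = _)) f := by
  have s := single_comp g (.cons f (Maps.ids A.id bs) rfl) (y := x) (by cases x <;> rfl)
  refine Eq.symm ((A.assoc h (Maps.single g) (.cons f (Maps.ids A.id bs) rfl) rfl
    (by cases x <;> rfl) (by rw [s]; cases x <;> rfl)).trans ?_)
  exact eq_of_heq (comp_heq rfl rfl rfl HEq.rfl (heq_of_eq s) _ _)

theorem compFirst_comp_cons {x : Tightness} {a a' c : A.Obj} {as as' bs : List A.Obj}
    (g : A.Hom tight (a :: bs) c) (h : A.Hom tight [a'] a) (fs : Maps A.Hom as bs)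
    (e : A.Hom x as' a') (hx : x = tight.subst (Maps.single e).types) :
    A.compFirst (A.comp g (.cons h fs rfl) (rfl : tight = _)) e =
      A.comp g (.cons (A.comp h (Maps.single e) hx) fs rfl) tight_subst_cons.symm := by
  rw [← compFirst_comp_cons_id g fs (A.comp h (Maps.single e) hx)]
  refine (congrArg (A.compFirst · e) (compFirst_comp_cons_id g fs h).symm).trans ?_
  exact compFirst_ucomp _ _ _

/-- The whiskering laws of a 2-functor involve conjugation by identity 2-cells between equal
1-cells; on components this conjugation disappears. -/
theorem app_eqToHom_comp_eqToHom {F G H K : A ⟶ B} (h : F = G) (h' : H = K) (φ : G ⟶ H)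
    (a : A.Obj) (f : B.Hom tight [F.obj a] (K.obj a)) (hf : HEq (MultiTrans.app φ a) f) :
    MultiTrans.app (eqToHom h ≫ φ ≫ eqToHom h') a = f := by
  subst h h'
  rw [eqToHom_refl, eqToHom_refl, Category.id_comp, Category.comp_id]
  exact eq_of_heq hf

end SkewMultiCat

namespace LaxMap

variable {C : SkewMonCat.{v, u}} {A : SkewMultiCat.{v, u}} {F G : LaxMap C A}

/-- Naturality for all tight multimaps follows from the generators, the morphisms of `C` and the
maps `mu`, by removing one `mu` at a time. -/
theorem comp_tightMap (φ : ∀ a : C.carrier, A.Hom tight [F.obj a] (G.obj a))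
    (hmap : ∀ {a b : C.carrier} (f : a ⟶ b),
      A.compFirst (φ b) (F.map f) = A.compFirst (G.map f) (φ a))
    (hmu : ∀ a b : C.carrier, A.compFirst (φ (C.tensorObj a b)) (F.mu a b) =
      A.comp (G.mu a b) (.cons (φ a) (Maps.single (φ b)) rfl) rfl)
    (as : List C.carrier) {a b : C.carrier} (f : C.tensorList as a ⟶ b) :
    A.comp (φ b) (Maps.single (F.tightMap as f)) (rfl : tight = _) =
      A.comp (G.tightMap as f) (Maps.unary (H := A.Hom) φ (a :: as)) (rfl : tight = _) := by
  induction as generalizing a with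
  | nil => exact hmap f
  | cons c as ih =>
    refine (comp_single_compFirst (φ b) (F.tightMap as f) (F.mu a c) rfl).trans ?_
    refine (congrArg (A.compFirst · (F.mu a c)) (ih f)).trans ?_
    refine (compFirst_comp_cons (G.tightMap as f) (φ _) _ (F.mu a c) rfl).trans ?_
    refine Eq.trans ?_ (comp_compFirst₂ (G.tightMap as f) (G.mu a c) (φ a) (φ c)
      (Maps.unary (H := A.Hom) φ as) rfl rfl rfl rfl rfl rfl).symm
    exact congrArg (fun t => A.comp (G.tightMap as f) (.cons t _ rfl) (rfl : tight = _)) (hmu a c)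

theorem comp_multiMap (φ : ∀ a : C.carrier, A.Hom tight [F.obj a] (G.obj a))
    (hmap : ∀ {a b : C.carrier} (f : a ⟶ b),
      A.compFirst (φ b) (F.map f) = A.compFirst (G.map f) (φ a))
    (hmu : ∀ a b : C.carrier, A.compFirst (φ (C.tensorObj a b)) (F.mu a b) =
      A.comp (G.mu a b) (.cons (φ a) (Maps.single (φ b)) rfl) rfl)
    (heta : A.compFirst (φ C.unit) F.eta = G.eta) {x : Tightness} {as : List C.carrier} {b : C.carrier}
    (f : C.MultiHom x as b) (h : x = tight.subst (Maps.single (F.multiMap f)).types)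
    (h' : x = x.subst (Maps.unary (H := A.Hom) φ as).types) :
    A.comp (φ b) (Maps.single (F.multiMap f)) h =
      A.comp (G.multiMap f) (Maps.unary (H := A.Hom) φ as) h' := by
  cases x with
  | loose =>
    refine (comp_single_compFirst (φ b) (F.tightMap as f) F.eta rfl).trans ?_
    refine (congrArg (A.compFirst · F.eta) (comp_tightMap φ hmap hmu as f)).trans ?_
    refine (compFirst_comp_cons (G.tightMap as f) (φ _) _ F.eta rfl).trans ?_
    refine Eq.trans ?_ (comp_compFirst₀ (G.tightMap as f) G.eta _ h').symm
    exact congrArg (fun t => A.comp (G.tightMap as f) (.cons t _ rfl) (rfl : loose = _)) heta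
  | tight =>
    cases as with
    | nil => exact PEmpty.elim f
    | cons a as => exact comp_tightMap φ hmap hmu as f

end LaxMap

/-! ### The 2-functor to skew multicategories and its local bijectivity -/

namespace SkewMonCat

open LaxMap

variable {C D E : SkewMonCat.{v, u}}

/-- The morphism of skew multicategories induced by a lax monoidal functor. -/
def toMultiMap (F : C ⟶ D) : C.toMulti ⟶ D.toMulti :=
  (ofLaxFunctor F).toMultiFunctor

theorem ofMultiFunctor_toMultiMap (F : C ⟶ D) :
    ofMultiFunctor (toMultiMap F) = ofLaxFunctor F :=
  ofMultiFunctor_toMultiFunctor _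

theorem toMultiMap_bijective : Function.Bijective (toMultiMap : (C ⟶ D) → _) :=
  (equivLaxFunctor.trans equivMultiFunctor).bijective

theorem toMultiMap_map_binary (F : C ⟶ D) {a b c : C.carrier} (f : C.tensorObj a b ⟶ c) :
    (toMultiMap F).map (x := tight) (as := [a, b]) f = (F.mu a b ≫ F.functor.map f :) :=
  toMulti_compFirst (D := D) (as := [F.functor.obj b]) (bs := []) (F.functor.map f) (F.mu a b)

theorem toMultiMap_map_nullary (F : C ⟶ D) {c : C.carrier} (f : C.unit ⟶ c) :
    (toMultiMap F).map (x := loose) (as := []) f = (F.eps ≫ F.functor.map f :) :=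
  toMulti_compFirst_loose (D := D) (as := []) (bs := []) (F.functor.map f) F.eps

theorem toMultiMap_id (C : SkewMonCat.{v, u}) : toMultiMap (𝟙 C) = 𝟙 C.toMulti := by
  refine equivMultiFunctor.symm.injective ((ofMultiFunctor_toMultiMap (𝟙 C)).trans ?_)
  exact ext_heq rfl (fun f => HEq.rfl) (fun a b => HEq.rfl) HEq.rfl

/-- By the universal property, morphisms out of `C.toMulti` are compared on morphisms, on the
identities of `a ⊗ b` as binary multimaps and on the identity of `i` as a nullary one. -/
theorem toMultiMap_comp (F : C ⟶ D) (G : D ⟶ E) :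
    toMultiMap (F ≫ G) = toMultiMap F ≫ toMultiMap G := by
  refine equivMultiFunctor.symm.injective ((ofMultiFunctor_toMultiMap (F ≫ G)).trans ?_)
  refine ext_heq rfl (fun f => HEq.rfl) (fun a b => heq_of_eq ?_) (heq_of_eq ?_)
  · have e : (toMultiMap F).map (x := tight) (as := [a, b]) (𝟙 (C.tensorObj a b)) = F.mu a b := by
      rw [toMultiMap_map_binary, F.functor.map_id, Category.comp_id]
    exact Eq.symm ((congrArg ((toMultiMap G).map (x := tight)
      (as := [F.functor.obj a, F.functor.obj b])) e).trans (toMultiMap_map_binary G _))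
  · have e : (toMultiMap F).map (x := loose) (as := []) (𝟙 C.unit) = F.eps := by
      rw [toMultiMap_map_nullary, F.functor.map_id, Category.comp_id]
    exact Eq.symm ((congrArg ((toMultiMap G).map (x := loose) (as := [])) e).trans
      (toMultiMap_map_nullary G _))

theorem toMulti_comp_pair {a a' b b' c : D.carrier} (g : D.tensorObj a' b' ⟶ c) (f : a ⟶ a')
    (f' : b ⟶ b') :
    D.toMulti.comp (x := tight) (bs := [a', b']) g (.cons (H := D.MultiHom) (x := tight)
        (as := [a]) f (Maps.single (H := D.MultiHom) (x := tight) (as := [b]) f') rfl)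
        (rfl : tight = _) =
      (D.tensorHom f f' ≫ g : D.tensorObj a b ⟶ c) := by
  refine (toMulti_comp_cons_single (x := tight) (as := [b]) g f f').trans ?_
  rw [action_tight_unary]
  change D.tensorHom _ _ ≫ _ = _
  rw [← Category.assoc, ← D.tensor_comp, Category.comp_id, Category.id_comp]

/-- The 2-cell induced by a monoidal natural transformation. -/
def toMultiMap₂ {F G : C ⟶ D} (φ : F ⟶ G) : toMultiMap F ⟶ toMultiMap G :=
  MultiTrans.mk (F := toMultiMap F) (G := toMultiMap G) (fun a => MonTrans.app φ a)
    (fun f h h' => comp_multiMap (F := ofLaxFunctor F) (G := ofLaxFunctor G)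
      (fun a => MonTrans.app φ a)
      (fun f => (toMulti_compFirst (as := []) (bs := []) _ _).trans
        ((MonTrans.naturality φ f).trans (toMulti_compFirst (as := []) (bs := []) _ _).symm))
      (fun a b => (toMulti_compFirst (as := [F.functor.obj b]) (bs := []) _ _).trans
        ((MonTrans.tensor φ a b).trans (toMulti_comp_pair _ _ _).symm))
      ((toMulti_compFirst_loose (as := []) (bs := []) _ _).trans (MonTrans.unit φ)) f h h')

/-- For surjectivity, naturality of `ψ` is evaluated at unary multimaps, at the binary identity of
`a ⊗ b` and at the nullary identity of `i`. This gives exactly the three conditions on a monoidal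
natural transformation. -/
theorem toMultiMap₂_bijective (F G : C ⟶ D) :
    Function.Bijective (toMultiMap₂ : (F ⟶ G) → _) := by
  constructor
  · intro φ ψ h
    exact SkewMonCat.hom₂_ext fun a => congrFun (congrArg MultiTrans.app h) a
  · intro ψ
    have hmap : ∀ {a b : C.carrier} (f : a ⟶ b), F.functor.map f ≫ MultiTrans.app ψ b =
        MultiTrans.app ψ a ≫ G.functor.map f := fun f =>
      (toMulti_compFirst (as := []) (bs := []) _ _).symm.trans
        ((MultiTrans.naturality ψ (x := tight) (as := [_]) f rfl rfl).trans
          (toMulti_compFirst (as := []) (bs := []) _ _))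
    have hmu : ∀ a b : C.carrier, F.mu a b ≫ MultiTrans.app ψ (C.tensorObj a b) =
        D.tensorHom (MultiTrans.app ψ a) (MultiTrans.app ψ b) ≫ G.mu a b := fun a b => by
      have e := MultiTrans.naturality ψ (x := tight) (as := [a, b]) (𝟙 (C.tensorObj a b)) rfl rfl
      rw [toMultiMap_map_binary, toMultiMap_map_binary, F.functor.map_id, G.functor.map_id,
        Category.comp_id, Category.comp_id] at e
      exact (toMulti_compFirst (D := D) (as := [F.functor.obj b]) (bs := [])
        (MultiTrans.app ψ (C.tensorObj a b)) (F.mu a b)).symm.trans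
        (e.trans (toMulti_comp_pair (D := D) (G.mu a b) (MultiTrans.app ψ a) (MultiTrans.app ψ b)))
    have heps : F.eps ≫ MultiTrans.app ψ C.unit = G.eps := by
      have e := MultiTrans.naturality ψ (x := loose) (as := []) (𝟙 C.unit) rfl rfl
      rw [toMultiMap_map_nullary, toMultiMap_map_nullary, F.functor.map_id, G.functor.map_id,
        Category.comp_id, Category.comp_id] at e
      exact (toMulti_compFirst_loose (D := D) (as := []) (bs := []) (MultiTrans.app ψ C.unit)
        F.eps).symm.trans (e.trans (D.toMulti.comp_id (x := loose) (as := []) G.eps rfl))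
    exact ⟨MonTrans.mk (F := F) (G := G) (fun a => MultiTrans.app ψ a) hmap hmu heps,
      SkewMultiCat.hom₂_ext fun a => rfl⟩

/-- The 2-functor from skew monoidal categories to skew multicategories. -/
def toMultiFunctor : StrictPseudofunctor SkewMonCat.{v, u} SkewMultiCat.{v, u} :=
  StrictPseudofunctor.mk''
    { obj := toMulti
      map := toMultiMap
      map₂ := toMultiMap₂
      map₂_id := fun _ => SkewMultiCat.hom₂_ext fun _ => rfl
      map₂_comp := fun φ ψ => SkewMultiCat.hom₂_ext fun a =>
        (toMulti_compFirst (as := []) (bs := []) (MonTrans.app ψ a) (MonTrans.app φ a)).symm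
      map_id := toMultiMap_id
      map_comp := toMultiMap_comp
      map₂_whisker_left := fun {_ _ _} F {G H} φ => SkewMultiCat.hom₂_ext fun a =>
        (app_eqToHom_comp_eqToHom (toMultiMap_comp F G) (toMultiMap_comp F H).symm
          (Bicategory.whiskerLeft (toMultiMap F) (toMultiMap₂ φ)) a
          (MonTrans.app φ (F.functor.obj a)) HEq.rfl).symm
      map₂_whisker_right := fun {_ _ _ F G} φ H => SkewMultiCat.hom₂_ext fun a =>
        (app_eqToHom_comp_eqToHom (toMultiMap_comp F H) (toMultiMap_comp G H).symm
          (Bicategory.whiskerRight (toMultiMap₂ φ) (toMultiMap H)) a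
          (H.functor.map (MonTrans.app φ a)) HEq.rfl).symm }

end SkewMonCat

/-! ### Representability, closedness and comparisons of `C.toMulti` -/

namespace SkewMonCat

variable {C : SkewMonCat.{v, u}}

/-- This morphism is the identification of the equal objects `tensorList (as ++ bs) x` and
`tensorList bs (tensorList as x)`. -/
instance isIso_extendList_id (as bs : List C.carrier) (x : C.carrier) :
    IsIso (C.extendList as (𝟙 (C.tensorList as x)) bs) := by
  induction as generalizing x with
  | nil =>
    change IsIso (C.whiskerList bs (𝟙 x))
    rw [whiskerList_id]
    infer_instance
  | cons a as ih => exact ih _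

theorem extendList_eq (as bs : List C.carrier) {x y : C.carrier} (f : C.tensorList as x ⟶ y) :
    C.extendList as f bs = C.extendList as (𝟙 _) bs ≫ C.whiskerList bs f := by
  rw [← extendList_comp, Category.id_comp]

instance isIso_whiskerList (as : List C.carrier) {x y : C.carrier} (f : x ⟶ y) [IsIso f] :
    IsIso (C.whiskerList as f) :=
  ⟨C.whiskerList as (inv f), by rw [← whiskerList_comp, IsIso.hom_inv_id, whiskerList_id],
    by rw [← whiskerList_comp, IsIso.inv_hom_id, whiskerList_id]⟩

instance isIso_extendList (as bs : List C.carrier) {x y : C.carrier} (f : C.tensorList as x ⟶ y)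
    [IsIso f] : IsIso (C.extendList as f bs) := by
  rw [extendList_eq]
  infer_instance

theorem bijective_comp_left {x y z : C.carrier} (f : x ⟶ y) [IsIso f] :
    Function.Bijective fun g : y ⟶ z => f ≫ g :=
  (asIso f).homFromEquiv.symm.bijective

/-- The Yoneda lemma. The morphism `extendList as f []` occurs in place of `f` because `compFirst`
without further variables has domain `as ++ []`. -/
theorem isIso_of_bijective (as : List C.carrier) {x y : C.carrier} (f : C.tensorList as x ⟶ y)
    (h : ∀ b, Function.Bijective fun g : y ⟶ b => C.extendList as f [] ≫ g) : IsIso f := by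
  have : IsIso (C.extendList as f []) := by
    rw [isIso_iff_coyoneda_map_bijective]
    exact h
  rw [extendList_eq] at this
  exact IsIso.of_isIso_comp_left (C.extendList as (𝟙 _) []) (C.whiskerList [] f)

theorem toMulti_isUniversal_iff_tight {a m : C.carrier} {as : List C.carrier}
    (θ : C.tensorList as a ⟶ m) :
    C.toMulti.IsUniversal (x := tight) (as := a :: as) θ ↔ IsIso θ := by
  have e : ∀ b, (fun g : m ⟶ b => C.toMulti.compFirst (x := tight) (as := a :: as) (bs := []) g θ) =
      fun g : m ⟶ b => C.extendList as θ [] ≫ g := fun b =>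
    funext fun g => toMulti_compFirst (bs := []) g θ
  constructor
  · intro h
    exact isIso_of_bijective as θ fun b => by rw [← e]; exact h b
  · intro _ b
    refine Eq.mpr (congrArg Function.Bijective (e b)) ?_
    exact bijective_comp_left _

theorem toMulti_isUniversal_iff_loose {m : C.carrier} {as : List C.carrier}
    (θ : C.tensorList as C.unit ⟶ m) :
    C.toMulti.IsUniversal (x := loose) (as := as) θ ↔ IsIso θ := by
  have e : ∀ b, (fun g : m ⟶ b => C.toMulti.compFirst (x := loose) (as := as) (bs := []) g θ) =
      fun g : m ⟶ b => C.extendList as θ [] ≫ g := fun b =>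
    funext fun g => toMulti_compFirst_loose (bs := []) g θ
  constructor
  · intro h
    exact isIso_of_bijective as θ fun b => by rw [← e]; exact h b
  · intro _ b
    refine Eq.mpr (congrArg Function.Bijective (e b)) ?_
    exact bijective_comp_left _

variable (C) in
-- Universal multimaps are the isomorphisms, and tensoring with further objects keeps them
-- invertible. Closedness plays no role.
theorem toMulti_isLeftRepresentable : C.toMulti.IsLeftRepresentable := by
  refine ⟨fun x as hx => ?_, fun {x as m} θ hθ bs c => ?_⟩
  · cases x with
    | loose => exact ⟨_, _, (toMulti_isUniversal_iff_loose (𝟙 (C.tensorList as C.unit))).2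
        inferInstance⟩
    | tight =>
      cases as with
      | nil => exact hx.elim
      | cons a as => exact ⟨_, _, (toMulti_isUniversal_iff_tight (𝟙 (C.tensorList as a))).2
          inferInstance⟩
  · cases x with
    | loose =>
      have := (toMulti_isUniversal_iff_loose θ).1 hθ
      refine Eq.mpr (congrArg Function.Bijective (funext fun g =>
        toMulti_compFirst_loose (bs := bs) g θ)) ?_
      exact bijective_comp_left _
    | tight =>
      cases as with
      | nil => exact PEmpty.elim θ
      | cons a as =>
        have := (toMulti_isUniversal_iff_tight θ).1 hθ
        refine Eq.mpr (congrArg Function.Bijective (funext fun g =>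
          toMulti_compFirst (bs := bs) g θ)) ?_
        exact bijective_comp_left _

theorem toMulti_isClosed (hC : C.IsClosed) : C.toMulti.IsClosed := by
  intro b c
  obtain ⟨h, e, he⟩ := hC b c
  refine ⟨h, e, fun x as hx => ?_⟩
  -- Up to the isomorphism `extendList as (𝟙 _) [b]` the morphism `extendList as f [b]` is `f ⊗ b`,
  -- so the universal property of `h` at the object `tensorList as y` applies.
  have key : ∀ (as : List C.carrier) (y : C.carrier),
      Function.Bijective fun f : C.tensorList as y ⟶ h => C.extendList as f [b] ≫ e := by
    intro as y
    refine Eq.mpr (congrArg Function.Bijective (funext fun f => ?_))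
      ((bijective_comp_left (C.extendList as (𝟙 (C.tensorList as y)) [b])).comp
        (he (C.tensorList as y)))
    rw [extendList_eq, Category.assoc]
    rfl
  cases x with
  | loose =>
    refine Eq.mpr (congrArg Function.Bijective (funext fun f =>
      toMulti_compFirst_loose (bs := [b]) e f)) ?_
    exact key as C.unit
  | tight =>
    cases as with
    | nil => exact hx.elim
    | cons a as =>
      refine Eq.mpr (congrArg Function.Bijective (funext fun f =>
        toMulti_compFirst (bs := [b]) e f)) ?_
      exact key as a

/-- The functor `- ⊗ b` has a right adjoint and therefore preserves epimorphisms. -/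
theorem epi_tensorHom_id (hC : C.IsClosed) {a a' : C.carrier} (f : a ⟶ a') [Epi f]
    (b : C.carrier) : Epi (C.tensorHom f (𝟙 b)) := by
  refine ⟨fun {c} g g' hg => ?_⟩
  obtain ⟨h, e, he⟩ := hC b c
  obtain ⟨k, rfl⟩ := (he a').2 g
  obtain ⟨k', rfl⟩ := (he a').2 g'
  have : f ≫ k = f ≫ k' := by
    apply (he a).1
    dsimp only at hg ⊢
    rw [tensorHom_comp_left, tensorHom_comp_left, Category.assoc, Category.assoc, hg]
  rw [(cancel_epi f).1 this]

theorem epi_whiskerList (hC : C.IsClosed) (as : List C.carrier) {a a' : C.carrier} (f : a ⟶ a')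
    [Epi f] : Epi (C.whiskerList as f) := by
  induction as generalizing a a' with
  | nil => assumption
  | cons b as ih =>
    have := epi_tensorHom_id hC f b
    exact ih (C.tensorHom f (𝟙 b))

/-- The comparison at `a :: as` is precomposition with `λ_a ⊗ a₁ ⊗ ⋯ ⊗ aₙ`. Unary multimaps force
`λ` to be epic; the converse uses closedness to keep it epic after tensoring. -/
theorem toMulti_comparisonInjective_iff (hC : C.IsClosed) :
    C.toMulti.ComparisonInjective ↔ C.LeftUnitEpi := by
  constructor
  · intro h a
    exact ⟨fun {b} f g hfg => h [a] b (List.cons_ne_nil _ _) hfg⟩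
  · intro h as b has f g hfg
    cases as with
    | nil => exact (has rfl).elim
    | cons a as =>
      have := h a
      have := epi_whiskerList hC as (C.leftUnit a)
      exact (cancel_epi (C.whiskerList as (C.leftUnit a))).1 hfg

end SkewMonCat

/-! ### The skew monoidal category of a left representable skew multicategory -/

namespace SkewMultiCat

/-- A choice of universal binary and nullary multimaps that are universal with respect to
substitution in the first variable. -/
structure Representation (A : SkewMultiCat.{v, u}) where
  tensorObj : A.Obj → A.Obj → A.Obj
  unit : A.Obj
  mu : ∀ a b : A.Obj, A.Hom tight [a, b] (tensorObj a b)
  eta : A.Hom loose [] unit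
  mu_bijective : ∀ (a b : A.Obj) (cs : List A.Obj) (d : A.Obj),
    Function.Bijective fun g : A.Hom tight (tensorObj a b :: cs) d =>
      (A.compFirst g (mu a b) : A.Hom tight (a :: b :: cs) d)
  eta_bijective : ∀ (cs : List A.Obj) (d : A.Obj),
    Function.Bijective fun g : A.Hom tight (unit :: cs) d =>
      (A.compFirst g eta : A.Hom loose cs d)

theorem IsLeftRepresentable.nonempty_representation {A : SkewMultiCat.{v, u}}
    (h : A.IsLeftRepresentable) : Nonempty A.Representation := by
  choose t mu hmu using fun a b : A.Obj => h.1 tight [a, b] trivial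
  obtain ⟨i, eta, heta⟩ := h.1 loose [] trivial
  exact ⟨⟨t, i, mu, eta, fun a b => h.2 (mu a b) (hmu a b), h.2 eta heta⟩⟩

namespace Representation

variable {A : SkewMultiCat.{v, u}} (R : A.Representation)

/-- The multimap `e ⊗ e'`. -/
def pair {x y : Tightness} {as bs : List A.Obj} {a b : A.Obj} (e : A.Hom x as a)
    (e' : A.Hom y bs b) : A.Hom x (as ++ bs) (R.tensorObj a b) :=
  A.comp (R.mu a b) (.cons e (Maps.single e') rfl) tight_subst_cons.symm

/-- The composite of a multimap with a tight unary multimap. -/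
def apply {x : Tightness} {as : List A.Obj} {a b : A.Obj} (f : A.Hom tight [a] b)
    (e : A.Hom x as a) : A.Hom x as b :=
  A.comp f (Maps.single e) (eq_subst_single e)

theorem apply_comp {x y : Tightness} {as bs : List A.Obj} {a b : A.Obj} (f : A.Hom tight [a] b)
    (g : A.Hom x bs a) (es : Maps A.Hom as bs) (h : y = x.subst es.types) :
    apply f (A.comp g es h) = A.comp (apply f g) es h := by
  have s := single_comp g es h
  refine Eq.symm ((A.assoc f (Maps.single g) es (eq_subst_single g) h
    (by rw [s]; exact eq_subst_single _)).trans ?_)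
  exact eq_of_heq (comp_heq rfl rfl rfl HEq.rfl (heq_of_eq s) _ _)

theorem apply_apply {x : Tightness} {as : List A.Obj} {a b c : A.Obj} (g : A.Hom tight [b] c)
    (f : A.Hom tight [a] b) (e : A.Hom x as a) :
    apply g (apply f e) = apply (ucomp f g) e :=
  apply_comp g f _ _

theorem id_apply {x : Tightness} {as : List A.Obj} {a : A.Obj} (e : A.Hom x as a) :
    apply (A.id a) e = e :=
  A.id_comp e _

theorem apply_id {a b : A.Obj} (f : A.Hom tight [a] b) : apply f (A.id a) = f :=
  id_ucomp f

theorem apply_heq_compFirst {x : Tightness} {as : List A.Obj} {a b : A.Obj}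
    (f : A.Hom tight [a] b) (e : A.Hom x as a) : HEq (apply f e) (A.compFirst f e) :=
  comp_heq rfl (List.append_nil _).symm rfl HEq.rfl
    (cons_heq rfl rfl rfl rfl HEq.rfl HEq.rfl _ _) _ _

theorem apply_toLoose {x : Tightness} {as : List A.Obj} {a b : A.Obj} (f : A.Hom tight [a] b)
    (e : A.Hom x as a) : apply f (toLoose e) = toLoose (apply f e) := by
  obtain ⟨s, hs⟩ := exists_act_eq_toLoose e
  obtain ⟨t, ht⟩ := exists_act_eq_toLoose (apply f e)
  rw [← hs, ← ht]
  exact A.comp_naturality (.id _) t f (.cons s e _ .nil) _ _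

/-- The second argument does not affect the type of the composite, whereas loosening the first, in
the next lemma, loosens the whole. -/
theorem pair_toLoose {x y : Tightness} {as bs : List A.Obj} {a b : A.Obj} (e : A.Hom x as a)
    (e' : A.Hom y bs b) : R.pair e (toLoose e') = R.pair e e' := by
  obtain ⟨s, hs⟩ := exists_act_eq_toLoose e'
  rw [← hs]
  exact A.comp_naturality (.id _) (.id _) (R.mu a b)
    (.cons (.id _) _ _ (.cons s e' _ .nil)) _ _

theorem toLoose_pair {x y : Tightness} {as bs : List A.Obj} {a b : A.Obj} (e : A.Hom x as a)
    (e' : A.Hom y bs b) : R.pair (toLoose e) e' = toLoose (R.pair e e') := by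
  obtain ⟨s, hs⟩ := exists_act_eq_toLoose e
  obtain ⟨t, ht⟩ := exists_act_eq_toLoose (R.pair e e')
  rw [← hs, ← ht]
  exact A.comp_naturality (.id _) t (R.mu a b)
    (.cons s e _ (.cons (.id _) e' _ .nil)) _ _

theorem pair_id_id (a b : A.Obj) : R.pair (A.id a) (A.id b) = R.mu a b :=
  A.comp_id (R.mu a b) rfl

theorem comp_comp_cons_single {x y : Tightness} {a a' b b' c : A.Obj} {as bs : List A.Obj}
    (g : A.Hom tight [a', b'] c) (f : A.Hom tight [a] a') (f' : A.Hom tight [b] b')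
    (e : A.Hom x as a) (e' : A.Hom y bs b) :
    A.comp (A.comp g (.cons f (Maps.single f') rfl) (rfl : tight = _))
        (.cons e (Maps.single e') rfl) tight_subst_cons.symm =
      A.comp g (.cons (apply f e) (Maps.single (apply f' e')) rfl) tight_subst_cons.symm := by
  refine (congrArg (fun t => A.comp t (.cons e (Maps.single e') rfl) tight_subst_cons.symm)
    (compFirst_comp_cons_id g (Maps.single f') f).symm).trans ?_
  refine (comp_compFirst₁ _ f e (Maps.single e') rfl tight_subst_cons.symm (eq_subst_single e)
    tight_subst_cons.symm).trans ?_
  refine (comp_comp_cons_id g (Maps.single f') _ (Maps.single e') rfl _).trans ?_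
  exact eq_of_heq (comp_heq rfl rfl rfl HEq.rfl (cons_heq rfl rfl rfl rfl HEq.rfl
    (heq_of_eq (single_comp f' (Maps.single e') (eq_subst_single e'))) _ _) _ _)

/-- The morphism `a ⊗ b ⟶ c` corresponding to a binary multimap. -/
noncomputable def desc {a b c : A.Obj} (f : A.Hom tight [a, b] c) :
    A.Hom tight [R.tensorObj a b] c :=
  ((R.mu_bijective a b [] c).2 f).choose

theorem apply_desc {a b c : A.Obj} (f : A.Hom tight [a, b] c) :
    apply (R.desc f) (R.mu a b) = f :=
  ((R.mu_bijective a b [] c).2 f).choose_spec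

/-- The action of the tensor product on morphisms. -/
noncomputable def tensorHom {a a' b b' : A.Obj} (f : A.Hom tight [a] a') (g : A.Hom tight [b] b') :
    A.Hom tight [R.tensorObj a b] (R.tensorObj a' b') :=
  R.desc (R.pair f g)

/-- This rule, with `assoc_pair_heq`, `leftUnit_pair` and `rightUnit_apply_heq`, evaluates the
structure maps on arbitrary multimaps as if these were elements, which reduces each axiom to
rewriting. -/
theorem tensorHom_pair {x y : Tightness} {as bs : List A.Obj} {a a' b b' : A.Obj}
    (f : A.Hom tight [a] a') (g : A.Hom tight [b] b') (e : A.Hom x as a) (e' : A.Hom y bs b) :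
    apply (R.tensorHom f g) (R.pair e e') = R.pair (apply f e) (apply g e') := by
  refine (apply_comp _ _ _ _).trans ?_
  rw [tensorHom, apply_desc]
  exact comp_comp_cons_single _ _ _ _ _

/-- The associativity map. -/
noncomputable def assoc (a b c : A.Obj) : A.Hom tight [R.tensorObj (R.tensorObj a b) c]
    (R.tensorObj a (R.tensorObj b c)) :=
  -- The first factorisation is along `mu a b` with a spare variable `c`: here universality with
  -- respect to further variables is needed, and universality for unary multimaps alone would not
  -- suffice.
  R.desc ((R.mu_bijective a b [c] _).2 (R.pair (as := [a]) (A.id a) (R.mu b c))).choose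

theorem compFirst_assoc (a b c : A.Obj) :
    apply (R.assoc a b c) (A.compFirst (bs := [c]) (R.mu (R.tensorObj a b) c) (R.mu a b)) =
      R.pair (A.id a) (R.mu b c) := by
  refine (apply_comp _ _ _ _).trans ?_
  rw [assoc, apply_desc]
  exact ((R.mu_bijective a b [c] _).2 (R.pair (as := [a]) (A.id a) (R.mu b c))).choose_spec

theorem assoc_pair_heq {x y z : Tightness} {as bs cs : List A.Obj} {a b c : A.Obj}
    (e : A.Hom x as a) (e' : A.Hom y bs b) (e'' : A.Hom z cs c) :
    HEq (apply (R.assoc a b c) (R.pair (R.pair e e') e''))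
      (R.pair e (R.pair e' e'')) := by
  have h₁ := comp_compFirst₂ (R.mu (R.tensorObj a b) c) (R.mu a b) e e' (Maps.single e'') rfl rfl
    rfl tight_subst_cons.symm tight_subst_cons.symm tight_subst_cons.symm
  have h₂ : HEq (R.pair (R.pair e e') e'') (A.comp
      (A.compFirst (bs := [c]) (R.mu (R.tensorObj a b) c) (R.mu a b))
      (.cons e (.cons e' (Maps.single e'') rfl) rfl) tight_subst_cons.symm) := by
    refine HEq.trans ?_ (heq_of_eq h₁.symm)
    refine comp_heq rfl (List.append_assoc _ _ _) rfl HEq.rfl ?_ _ _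
    exact cons_heq rfl rfl rfl rfl HEq.rfl HEq.rfl _ _
  have h₃ : ∀ {l l' : List A.Obj} {p : A.Hom x l _} {q : A.Hom x l' _}, l = l' → HEq p q →
      HEq (apply (R.assoc a b c) p) (apply (R.assoc a b c) q) := by
    rintro l _ p q rfl h
    rw [eq_of_heq h]
  refine (h₃ (List.append_assoc _ _ _) h₂).trans (heq_of_eq ?_)
  refine (apply_comp _ _ _ _).trans ?_
  rw [compFirst_assoc]
  refine (comp_comp_cons_id _ _ _ _ _ _).trans ?_
  exact congrArg (fun t => A.comp (R.mu a (R.tensorObj b c)) (.cons e t rfl)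
    tight_subst_cons.symm) (single_comp (R.mu b c) (.cons e' (Maps.single e'') rfl)
      tight_subst_cons.symm)

/-- The left unit map. -/
noncomputable def leftUnit (a : A.Obj) : A.Hom tight [R.tensorObj R.unit a] a :=
  R.desc ((R.eta_bijective [a] a).2 (A.j (A.id a))).choose

theorem compFirst_leftUnit (a : A.Obj) :
    apply (R.leftUnit a) (A.compFirst (bs := [a]) (R.mu R.unit a) R.eta) = A.j (A.id a) := by
  refine (apply_comp _ _ _ _).trans ?_
  rw [leftUnit, apply_desc]
  exact ((R.eta_bijective [a] a).2 (A.j (A.id a))).choose_spec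

theorem leftUnit_pair {x : Tightness} {as : List A.Obj} {a : A.Obj} (e : A.Hom x as a) :
    apply (R.leftUnit a) (R.pair R.eta e) = toLoose e := by
  have h : loose = loose.subst (Maps.single e).types := rfl
  have h₁ := comp_compFirst₀ (R.mu R.unit a) R.eta (Maps.single e) h
  refine (congrArg (apply (R.leftUnit a)) h₁.symm).trans ?_
  refine (apply_comp _ _ _ _).trans ?_
  rw [compFirst_leftUnit]
  refine (toLoose_comp (A.id a) (Maps.single e) (eq_subst_single e) h).symm.trans ?_
  rw [A.id_comp]

/-- The right unit map. -/
def rightUnit (a : A.Obj) : A.Hom tight [a] (R.tensorObj a R.unit) :=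
  R.pair (A.id a) R.eta

theorem rightUnit_apply_heq {x : Tightness} {as : List A.Obj} {a : A.Obj} (e : A.Hom x as a) :
    HEq (apply (R.rightUnit a) e) (R.pair e R.eta) := by
  have h : HEq (A.comp (R.rightUnit a) (.cons e .nil rfl) tight_subst_cons.symm)
      (R.pair e R.eta) :=
    (heq_of_eq (comp_comp_cons_id (R.mu a R.unit) (Maps.single R.eta) e .nil rfl
      tight_subst_cons.symm)).trans (heq_of_eq (congrArg (fun t => A.comp (R.mu a R.unit)
        (.cons e t rfl) tight_subst_cons.symm) (maps_comp_ids (Maps.single R.eta))))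
  refine HEq.trans ?_ h
  refine comp_heq rfl (List.append_nil _).symm rfl HEq.rfl ?_ _ _
  exact cons_heq rfl rfl rfl rfl HEq.rfl HEq.rfl _ _

/-- Substitution of `e` in the first variable is injective. -/
def IsEpic {x : Tightness} {as : List A.Obj} {a : A.Obj} (e : A.Hom x as a) : Prop :=
  ∀ (bs : List A.Obj) (d : A.Obj),
    Function.Injective fun g : A.Hom tight (a :: bs) d => A.compFirst g e

theorem IsEpic.eq {x : Tightness} {as : List A.Obj} {a d : A.Obj} {e : A.Hom x as a}
    (he : IsEpic e) {f g : A.Hom tight [a] d} (h : apply f e = apply g e) : f = g := by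
  refine he [] d (eq_of_heq ?_)
  exact (apply_heq_compFirst f e).symm.trans ((heq_of_eq h).trans (apply_heq_compFirst g e))

theorem isEpic_id (a : A.Obj) : IsEpic (A.id a) := by
  intro bs d f g h
  exact (compFirst_id f).symm.trans (h.trans (compFirst_id g))

theorem isEpic_eta : IsEpic R.eta := fun bs d => (R.eta_bijective bs d).1

/-- By associativity, substituting `e ⊗ 1` is substituting `mu` and then `e`, both injective. The
passive variables in the definition of `IsEpic` are what allow iteration to longer tensor products.
-/
theorem IsEpic.pair {x : Tightness} {as : List A.Obj} {a : A.Obj} {e : A.Hom x as a}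
    (he : IsEpic e) (b : A.Obj) : IsEpic (R.pair e (A.id b)) := by
  intro bs d f g h
  refine (R.mu_bijective a b bs d).1 (he (b :: bs) d (eq_of_heq ?_))
  exact (compFirst_assoc_heq f (R.mu a b) e).trans ((heq_of_eq h).trans
    (compFirst_assoc_heq g (R.mu a b) e).symm)

/-- The skew monoidal category of tight unary multimaps. -/
noncomputable def toSkewMonCat : SkewMonCat.{v, u} where
  carrier := A.Obj
  category :=
    { Hom := fun a b => A.Hom tight [a] b
      id := fun a => A.id a
      comp := fun f g => ucomp f g
      id_comp := fun f => id_ucomp f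
      comp_id := fun f => ucomp_id f
      assoc := fun f g h => ucomp_assoc f g h }
  tensorObj := R.tensorObj
  tensorHom f g := R.tensorHom f g
  tensor_id a b := by
    -- Each axiom is tested by substituting an epic tensor of identities, with `eta` in the first
    -- place where the domain begins with the unit.
    refine ((isEpic_id a).pair R b).eq ?_
    rw [tensorHom_pair]
    exact (congrArg₂ R.pair (id_apply _) (id_apply _)).trans (id_apply _).symm
  tensor_comp {a a' a'' b b' b''} f f' g g' := by
    refine ((isEpic_id a).pair R b).eq ?_
    change _ = apply (ucomp _ _) _
    rw [tensorHom_pair, ← apply_apply, tensorHom_pair, tensorHom_pair, apply_apply, apply_apply]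
    rfl
  unit := R.unit
  assoc := R.assoc
  leftUnit := R.leftUnit
  rightUnit := R.rightUnit
  assoc_naturality {a a' b b' c c'} f g h := by
    refine (((isEpic_id a).pair R b).pair R c).eq ?_
    change apply (ucomp _ _) _ = apply (ucomp _ _) _
    rw [← apply_apply, ← apply_apply, tensorHom_pair, tensorHom_pair,
      eq_of_heq (R.assoc_pair_heq (A.id a) (A.id b) (A.id c)), tensorHom_pair, tensorHom_pair]
    exact eq_of_heq (R.assoc_pair_heq _ _ _)
  leftUnit_naturality {a a'} f := by
    refine (R.isEpic_eta.pair R a).eq ?_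
    change apply (ucomp _ _) _ = apply (ucomp _ _) _
    rw [← apply_apply, ← apply_apply, tensorHom_pair, leftUnit_pair, apply_toLoose, apply_id]
    refine (congrArg (fun t => apply (R.leftUnit a') (R.pair t f)) (id_apply R.eta)).trans ?_
    exact R.leftUnit_pair f
  rightUnit_naturality {a a'} f := by
    have h := eq_of_heq (R.rightUnit_apply_heq f)
    refine h.trans ?_
    change _ = apply (R.tensorHom f (A.id R.unit)) (R.pair (A.id a) R.eta)
    rw [tensorHom_pair, apply_id, id_apply]
  pentagon a b c d := by
    refine ((((isEpic_id a).pair R b).pair R c).pair R d).eq ?_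
    change apply (ucomp _ (ucomp _ _)) _ = apply (ucomp _ _) _
    rw [← apply_apply, ← apply_apply, ← apply_apply, tensorHom_pair,
      eq_of_heq (R.assoc_pair_heq (A.id a) (A.id b) (A.id c)),
      eq_of_heq (R.assoc_pair_heq (R.pair (A.id a) (A.id b)) (A.id c) (A.id d)),
      eq_of_heq (R.assoc_pair_heq (A.id a) (A.id b) (R.pair (A.id c) (A.id d)))]
    refine (congrArg (fun t => apply _ (apply _ (R.pair _ t))) (id_apply _)).trans ?_
    rw [eq_of_heq (R.assoc_pair_heq (A.id a) (R.pair (A.id b) (A.id c)) (A.id d)), tensorHom_pair,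
      eq_of_heq (R.assoc_pair_heq (A.id b) (A.id c) (A.id d))]
    exact congrArg₂ R.pair (id_apply _) rfl
  assoc_leftUnit a b := by
    refine ((R.isEpic_eta.pair R a).pair R b).eq ?_
    change apply (ucomp _ _) _ = _
    rw [← apply_apply, eq_of_heq (R.assoc_pair_heq R.eta (A.id a) (A.id b)), leftUnit_pair,
      tensorHom_pair, leftUnit_pair, toLoose_pair]
    exact congrArg (fun t => toLoose (R.pair (A.id a) t)) (id_apply _).symm
  rightUnit_assoc a b := by
    refine ((isEpic_id a).pair R b).eq ?_
    change apply (ucomp _ _) _ = _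
    rw [← apply_apply, eq_of_heq (R.rightUnit_apply_heq (R.pair (A.id a) (A.id b))),
      eq_of_heq (R.assoc_pair_heq (A.id a) (A.id b) R.eta), tensorHom_pair, apply_id]
    exact congrArg (R.pair (A.id a)) (apply_id _).symm
  triangle a b := by
    refine ((isEpic_id a).pair R b).eq ?_
    change apply (ucomp _ (ucomp _ _)) _ = _
    rw [← apply_apply, ← apply_apply, tensorHom_pair, apply_id]
    refine (congrArg (fun t => apply _ (apply _ (R.pair _ t))) (id_apply _)).trans ?_
    refine (congrArg (apply _) (eq_of_heq (R.assoc_pair_heq (A.id a) R.eta (A.id b)))).trans ?_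
    -- The left unit map returns the loose identity of `b`; in the second variable it may be
    -- exchanged for the tight one.
    rw [tensorHom_pair, leftUnit_pair, pair_toLoose]
    exact (congrArg (fun t => R.pair t _) (id_apply _)).trans (id_apply _).symm
  rightUnit_leftUnit := by
    refine R.isEpic_eta.eq ?_
    change apply (ucomp _ _) _ = _
    rw [← apply_apply, eq_of_heq (R.rightUnit_apply_heq R.eta), leftUnit_pair]
    exact (id_apply _).symm

end Representation

end SkewMultiCat

/-! ### Recovering a left representable skew multicategory from its skew monoidal category -/

namespace SkewMultiCat

section

variable {A B : SkewMultiCat.{v, u}}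

theorem comp_heq_of_eq {x y y' : Tightness} {as as' bs bs' : List A.Obj} {c c' : A.Obj}
    {g : A.Hom x bs c} {g' : A.Hom x bs' c'} {fs : Maps A.Hom as bs} {fs' : Maps A.Hom as' bs'}
    (hy : y = y') (ha : as = as') (hb : bs = bs') (hc : c = c') (hg : HEq g g')
    (hfs : HEq fs fs') (h : y = x.subst fs.types) (h' : y' = x.subst fs'.types) :
    HEq (A.comp g fs h) (A.comp g' fs' h') := by
  subst hc
  exact comp_heq hy ha hb hg hfs h h'

theorem cons_heq_of_eq {x x' : Tightness} {as₁ as₁' as₂ as₂' cs cs' bs bs' : List A.Obj}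
    {b b' : A.Obj} {f : A.Hom x as₁ b} {f' : A.Hom x' as₁' b'} {fs : Maps A.Hom as₂ bs}
    {fs' : Maps A.Hom as₂' bs'} (hx : x = x') (h₁ : as₁ = as₁') (h₂ : as₂ = as₂') (hb : b = b')
    (hbs : bs = bs') (hf : HEq f f') (hfs : HEq fs fs') (h : cs = as₁ ++ as₂)
    (h' : cs' = as₁' ++ as₂') :
    HEq (Maps.cons (H := A.Hom) f fs h) (Maps.cons (H := A.Hom) f' fs' h') := by
  subst hb
  exact cons_heq hx h₁ h₂ hbs hf hfs h h'

theorem j_heq_of_eq {as as' : List A.Obj} {b b' : A.Obj} {f : A.Hom tight as b}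
    {f' : A.Hom tight as' b'} (ha : as = as') (hb : b = b') (hf : HEq f f') :
    HEq (A.j f) (A.j f') := by
  subst hb
  exact j_heq ha hf

theorem MultiFunctor.heq_of_map_heq (F : MultiFunctor A B)
    (hF : ∀ (x : Tightness) (as : List A.Obj) (b : A.Obj),
      Function.Injective (F.map : A.Hom x as b → _)) {x : Tightness} {as as' : List A.Obj}
    {b b' : A.Obj} {f : A.Hom x as b} {f' : A.Hom x as' b'} (ha : as = as') (hb : b = b')
    (h : HEq (F.map f) (F.map f')) : HEq f f' := by
  subst ha hb
  exact heq_of_eq (hF x as b (eq_of_heq h))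

/-- A morphism that is bijective on objects and on multimaps is an isomorphism. -/
theorem MultiFunctor.exists_inverse (F : A ⟶ B) (g : B.Obj → A.Obj)
    (hg : ∀ a, g (F.obj a) = a) (hg' : ∀ b, F.obj (g b) = b)
    (hF : ∀ (x : Tightness) (as : List A.Obj) (b : A.Obj),
      Function.Bijective (F.map : A.Hom x as b → _)) :
    ∃ G : B ⟶ A, F ≫ G = 𝟙 A ∧ G ≫ F = 𝟙 B := by
  have hl : ∀ as : List B.Obj, (as.map g).map F.obj = as := fun as =>
    List.map_map.trans ((congrArg (List.map · as) (funext hg')).trans (List.map_id' as))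
  have hl' : ∀ as : List A.Obj, (as.map F.obj).map g = as := fun as =>
    List.map_map.trans ((congrArg (List.map · as) (funext hg)).trans (List.map_id' as))
  have hinj := fun x as b => (hF x as b).1
  -- The inverse on multimaps is chosen as a preimage, up to the equalities `F.obj (g b) = b`. Its
  -- laws follow by applying `F.map`, which is injective.
  have hsurj : ∀ {x : Tightness} {as : List B.Obj} {b : B.Obj} (f : B.Hom x as b),
      ∃ f' : A.Hom x (as.map g) (g b), HEq (F.map f') f := by
    intro x as b f
    obtain ⟨f', hf'⟩ := (hF x (as.map g) (g b)).2
      (cast (congrArg₂ (B.Hom x) (hl as).symm (hg' b).symm) f)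
    exact ⟨f', (heq_of_eq hf').trans (cast_heq _ _)⟩
  choose m hm using @hsurj
  have hmaps : ∀ {as bs : List B.Obj} (fs : Maps B.Hom as bs),
      HEq ((fs.map (K := A.Hom) g fun {x as b} => @m x as b).map (K := B.Hom) F.obj F.map)
        fs := by
    intro as bs fs
    induction fs with
    | nil => rfl
    | cons f fs h ih =>
      exact cons_heq_of_eq rfl (hl _) (hl _) (hg' _) (hl _) (hm f) ih _ _
  have hid : ∀ b b' : B.Obj, b = b' → HEq (B.id b) (B.id b') := by
    rintro b _ rfl
    rfl
  let G : MultiFunctor B A :=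
    { obj := g
      map := fun {x as b} => @m x as b
      map_j := fun {as b} f => hinj _ _ _ (eq_of_heq ((hm (B.j f)).trans
        (HEq.trans (j_heq_of_eq (hl as) (hg' b) (hm f)).symm (heq_of_eq (F.map_j _)).symm)))
      map_id := fun b => hinj _ _ _ (eq_of_heq ((hm (B.id b)).trans
        (HEq.trans (hid _ _ (hg' b).symm) (heq_of_eq (F.map_id (g b))).symm)))
      map_comp := fun {x y as bs c} k fs h h' => by
        refine hinj _ _ _ (eq_of_heq ((hm _).trans (HEq.trans ?_
          (heq_of_eq (F.map_comp _ _ h' ?_)).symm)))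
        · exact (comp_heq_of_eq rfl (hl _) (hl _) (hg' _) (hm k) (hmaps fs) _ _).symm
        · rw [types_map, ← h'] }
  refine ⟨G, MultiFunctor.ext (funext hg) fun f => ?_, MultiFunctor.ext (funext hg') fun f => ?_⟩
  · refine (cast_heq _ _).trans (HEq.trans ?_ (cast_heq _ _).symm)
    exact F.heq_of_map_heq hinj (hl' _) (hg _) (hm (F.map f))
  · exact (cast_heq _ _).trans ((hm f).trans (cast_heq _ _).symm)

end

namespace Representation

variable {A : SkewMultiCat.{v, u}} (R : A.Representation)

/-- The universal lax monoidal map. -/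
noncomputable def laxMap : LaxMap R.toSkewMonCat A where
  obj a := a
  map f := f
  map_id _ := rfl
  map_comp _ _ := rfl
  mu := R.mu
  eta := R.eta
  mu_naturality f g := R.apply_desc (R.pair f g)
  associativity := R.compFirst_assoc
  left_unitality := R.compFirst_leftUnit
  right_unitality _ := rfl

/-- Each tensor factor is split off by one use of `mu_bijective`, with the remaining factors as
passive variables. -/
theorem tightMap_bijective (as : List A.Obj) (a b : A.Obj) :
    Function.Bijective fun f : R.toSkewMonCat.tensorList as a ⟶ b =>
      R.laxMap.tightMap as f := by
  induction as generalizing a with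
  | nil => exact Function.bijective_id
  | cons c as ih => exact (R.mu_bijective a c (as.map R.laxMap.obj) b).comp (ih (R.tensorObj a c))

theorem toMultiFunctor_map_bijective (x : Tightness) (as : List A.Obj) (b : A.Obj) :
    Function.Bijective (R.laxMap.toMultiFunctor.map : R.toSkewMonCat.toMulti.Hom x as b → _) := by
  cases x with
  | loose =>
    exact (R.eta_bijective (as.map R.laxMap.obj) b).comp (R.tightMap_bijective as R.unit b)
  | tight =>
    cases as with
    | nil => exact ⟨fun f => PEmpty.elim f, fun f => ((A.isEmpty_tight_nil b).false f).elim⟩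
    | cons a as => exact R.tightMap_bijective as a b

theorem exists_iso : ∃ (F : R.toSkewMonCat.toMulti ⟶ A) (G : A ⟶ R.toSkewMonCat.toMulti),
    F ≫ G = 𝟙 _ ∧ G ≫ F = 𝟙 _ :=
  ⟨R.laxMap.toMultiFunctor, MultiFunctor.exists_inverse R.laxMap.toMultiFunctor (fun a => a)
    (fun _ => rfl) (fun _ => rfl) R.toMultiFunctor_map_bijective⟩

theorem tensorHom_desc {a b c h : A.Obj} (e : A.Hom tight [h, b] c) (f : A.Hom tight [a] h) :
    apply (ucomp (R.tensorHom f (A.id b)) (R.desc e)) (R.mu a b) = A.compFirst e f := by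
  rw [← apply_apply, ← pair_id_id, tensorHom_pair, apply_id, apply_id]
  refine (apply_comp _ _ _ _).trans ?_
  rw [apply_desc]
  rfl

/-- Under the universal property of `R.unit ⊗ a` precomposition with the left unit map is the
comparison, so injective comparisons make that map an epimorphism. -/
theorem leftUnit_ucomp {a b : A.Obj} (f : A.Hom tight [a] b) :
    apply (ucomp (R.leftUnit a) f) (R.pair R.eta (A.id a)) = A.j f := by
  rw [← apply_apply, leftUnit_pair, apply_toLoose, apply_id]
  rfl

theorem toSkewMonCat_isClosed (hA : A.IsClosed) : R.toSkewMonCat.IsClosed := by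
  intro b c
  obtain ⟨h, e, he⟩ := hA b c
  refine ⟨h, R.desc e, fun a => ?_⟩
  -- Followed by the bijection `g ↦ g(mu a b)`, the map in question becomes `f ↦ e(f, 1)`.
  refine (Function.Bijective.of_comp_iff' (R.mu_bijective a b [] c) _).1 ?_
  exact Eq.mpr (congrArg Function.Bijective (funext fun f => R.tensorHom_desc e f))
    (he tight [a] trivial)

theorem toSkewMonCat_leftUnitEpi (hA : A.ComparisonInjective) : R.toSkewMonCat.LeftUnitEpi :=
  fun a => ⟨fun {b} f g h => hA [a] b (List.cons_ne_nil _ _)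
    ((R.leftUnit_ucomp f).symm.trans
      ((congrArg (fun t => apply t (R.pair R.eta (A.id a))) h).trans (R.leftUnit_ucomp g)))⟩

end Representation

end SkewMultiCat

/-! ### A criterion for 2-equivalences, and restriction to full sub-2-categories -/

namespace TwoCat

open Bicategory

universe w₁ w₂ v₁ v₂ u₁ u₂

section

variable {C : Type u₁} [Bicategory.{w₁, v₁} C]

theorem comp_eqToHom_eq_of_heq {D : Type u₁} [Category.{v₁} D] {a b b' c : D} {f : a ⟶ b}
    {g : b' ⟶ c} (ha : a = b') (hb : b = c) (h : HEq f g) :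
    f ≫ eqToHom hb = eqToHom ha ≫ g := by
  subst ha hb
  rw [eq_of_heq h, eqToHom_refl, eqToHom_refl, Category.comp_id, Category.id_comp]

theorem eq_eqToHom_comp_of_heq {D : Type u₁} [Category.{v₁} D] {a b a' b' : D} {f : a ⟶ b}
    {g : a' ⟶ b'} (ha : a = a') (hb : b' = b) (h : HEq f g) :
    f = eqToHom ha ≫ g ≫ eqToHom hb := by
  subst ha hb
  rw [eq_of_heq h, eqToHom_refl, eqToHom_refl, Category.comp_id, Category.id_comp]

theorem eqToHom_conj_heq {D : Type u₁} [Category.{v₁} D] {a b a' b' : D} (g : a' ⟶ b')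
    (ha : a = a') (hb : b' = b) : HEq (eqToHom ha ≫ g ≫ eqToHom hb) g := by
  subst ha hb
  rw [eqToHom_refl, eqToHom_refl, Category.comp_id, Category.id_comp]

theorem comp_heq {D : Type u₁} [Category.{v₁} D] {a b c a' b' c' : D} {f : a ⟶ b} {g : b ⟶ c}
    {f' : a' ⟶ b'} {g' : b' ⟶ c'} (ha : a = a') (hb : b = b') (hc : c = c') (hf : HEq f f')
    (hg : HEq g g') : HEq (f ≫ g) (f' ≫ g') := by
  subst ha hb hc
  rw [eq_of_heq hf, eq_of_heq hg]

theorem id_heq {D : Type u₁} [Category.{v₁} D] {a b : D} (h : a = b) : HEq (𝟙 a) (𝟙 b) := by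
  subst h
  rfl

theorem whiskerLeft_heq {X Y Z : C} {f f' : X ⟶ Y} {g g' h h' : Y ⟶ Z} {η : g ⟶ h} {η' : g' ⟶ h'}
    (hf : f = f') (hg : g = g') (hh : h = h') (hη : HEq η η') : HEq (f ◁ η) (f' ◁ η') := by
  subst hf hg hh
  rw [eq_of_heq hη]

theorem whiskerRight_heq {X Y Z : C} {f f' : Y ⟶ Z} {g g' h h' : X ⟶ Y} {η : g ⟶ h} {η' : g' ⟶ h'}
    (hf : f = f') (hg : g = g') (hh : h = h') (hη : HEq η η') : HEq (η ▷ f) (η' ▷ f') := by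
  subst hf hg hh
  rw [eq_of_heq hη]

variable [Strict C]

/-- In a strict bicategory unitors and associators are identities between equal 1-cells, so up to
heterogeneous equality they drop out of the whiskering laws. -/
theorem id_whiskerLeft_heq {X Y : C} {f g : X ⟶ Y} (η : f ⟶ g) : HEq (𝟙 X ◁ η) η := by
  rw [id_whiskerLeft, Strict.leftUnitor_eqToIso, Strict.leftUnitor_eqToIso, eqToIso.hom,
    eqToIso.inv]
  exact eqToHom_conj_heq _ _ _

theorem whiskerRight_id_heq {X Y : C} {f g : X ⟶ Y} (η : f ⟶ g) : HEq (η ▷ 𝟙 Y) η := by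
  rw [whiskerRight_id, Strict.rightUnitor_eqToIso, Strict.rightUnitor_eqToIso, eqToIso.hom,
    eqToIso.inv]
  exact eqToHom_conj_heq _ _ _

theorem comp_whiskerLeft_heq {W X Y Z : C} (k : W ⟶ X) (l : X ⟶ Y) {f g : Y ⟶ Z} (η : f ⟶ g) :
    HEq ((k ≫ l) ◁ η) (k ◁ l ◁ η) := by
  rw [comp_whiskerLeft, Strict.associator_eqToIso, Strict.associator_eqToIso, eqToIso.hom,
    eqToIso.inv]
  exact eqToHom_conj_heq _ _ _

theorem whiskerRight_comp_heq {W X Y Z : C} {f g : W ⟶ X} (η : f ⟶ g) (k : X ⟶ Y) (l : Y ⟶ Z) :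
    HEq (η ▷ (k ≫ l)) (η ▷ k ▷ l) := by
  rw [whiskerRight_comp, Strict.associator_eqToIso, Strict.associator_eqToIso, eqToIso.hom,
    eqToIso.inv]
  exact eqToHom_conj_heq _ _ _

theorem whisker_assoc_heq {W X Y Z : C} (k : W ⟶ X) {f g : X ⟶ Y} (η : f ⟶ g) (l : Y ⟶ Z) :
    HEq ((k ◁ η) ▷ l) (k ◁ η ▷ l) := by
  rw [whisker_assoc, Strict.associator_eqToIso, Strict.associator_eqToIso, eqToIso.hom,
    eqToIso.inv]
  exact eqToHom_conj_heq _ _ _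

end

section

variable {B : Type u₁} [Bicategory.{w₁, v₁} B] {C : Type u₂} [Bicategory.{w₂, v₂} C]

theorem map₂_whiskerLeft_heq (F : StrictPseudofunctor B C) {X Y Z : B} (f : X ⟶ Y) {g h : Y ⟶ Z}
    (η : g ⟶ h) : HEq (F.map₂ (f ◁ η)) (F.map f ◁ F.map₂ η) := by
  rw [F.map₂_whisker_left, F.mapComp_eq_eqToIso, F.mapComp_eq_eqToIso, eqToIso.hom,
    eqToIso.inv]
  exact eqToHom_conj_heq _ _ _

theorem map₂_whiskerRight_heq (F : StrictPseudofunctor B C) {X Y Z : B} {f g : X ⟶ Y}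
    (η : f ⟶ g) (h : Y ⟶ Z) : HEq (F.map₂ (η ▷ h)) (F.map₂ η ▷ F.map h) := by
  rw [F.map₂_whisker_right, F.mapComp_eq_eqToIso, F.mapComp_eq_eqToIso, eqToIso.hom,
    eqToIso.inv]
  exact eqToHom_conj_heq _ _ _

/-- The coherence isomorphisms are forced to be `eqToIso`, so the action on cells determines the
2-functor. -/
theorem StrictPseudofunctor.ext {F G : StrictPseudofunctor B C}
    (h : F.toPrelaxFunctor = G.toPrelaxFunctor) : F = G := by
  obtain ⟨⟨⟨F, i, c, _, _, _, _, _⟩, _, hi⟩, _, hc⟩ := F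
  obtain ⟨⟨⟨G, i', c', _, _, _, _, _⟩, _, hi'⟩, _, hc'⟩ := G
  obtain rfl : F = G := h
  obtain rfl : i = i' := funext fun X => (hi X).trans (hi' X).symm
  obtain rfl : @c = @c' := by
    funext X Y Z f g
    exact (hc f g).trans (hc' f g).symm
  rfl

/-- A 2-functor that is bijective on 1-cells and on 2-cells. -/
structure IsLocallyBijective (F : StrictPseudofunctor B C) : Prop where
  map_bijective : ∀ X Y : B, Function.Bijective (F.map : (X ⟶ Y) → _)
  map₂_bijective : ∀ {X Y : B} (f g : X ⟶ Y), Function.Bijective (F.map₂ : (f ⟶ g) → _)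

theorem IsLocallyBijective.heq_of_map₂_heq {F : StrictPseudofunctor B C}
    (hF : IsLocallyBijective F) {X Y : B} {f g f' g' : X ⟶ Y} {η : f ⟶ g} {θ : f' ⟶ g'}
    (hf : f = f') (hg : g = g') (h : HEq (F.map₂ η) (F.map₂ θ)) : HEq η θ := by
  subst hf hg
  exact heq_of_eq ((hF.map₂_bijective f g).1 (eq_of_heq h))

/-- A 2-functor that is bijective on 1-cells and on 2-cells, and surjective on objects up to
isomorphism, is a 2-equivalence. -/
theorem IsLocallyBijective.exists_twoEquivalence [Strict B] [Strict C]
    {F : StrictPseudofunctor B C} (hF : IsLocallyBijective F)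
    (hF' : ∀ Z : C, ∃ (X : B) (p : F.obj X ⟶ Z) (q : Z ⟶ F.obj X), p ≫ q = 𝟙 _ ∧ q ≫ p = 𝟙 _) :
    ∃ E : TwoEquivalence B C, E.functor = F := by
  choose G p q hpq hqp using hF'
  have hqp' : ∀ {Z W : C} (f : Z ⟶ W), q Z ≫ p Z ≫ f = f := fun {Z W} f => by
    rw [← Strict.assoc, hqp, Strict.id_comp]
  -- The inverse 2-functor takes `f : Z ⟶ W` to the 1-cell lying over `p Z ≫ f ≫ q W`, and treats
  -- 2-cells likewise. Its laws are checked after applying `F`, where `q Z ≫ p Z` cancels.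
  choose m hm using fun X Y => (hF.map_bijective X Y).2
  have hinj : ∀ {X Y : B} {f g : X ⟶ Y}, F.map f = F.map g → f = g :=
    fun h => (hF.map_bijective _ _).1 h
  have h₂ : ∀ {Z W : C} {f g : Z ⟶ W} (η : f ⟶ g),
      ∃ θ : m _ _ (p Z ≫ f ≫ q W) ⟶ m _ _ (p Z ≫ g ≫ q W), HEq (F.map₂ θ) (p Z ◁ η ▷ q W) := by
    intro Z W f g η
    obtain ⟨θ, hθ⟩ := (hF.map₂_bijective _ _).2
      (eqToHom (hm _ _ _) ≫ (p Z ◁ η ▷ q W) ≫ eqToHom (hm _ _ _).symm)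
    exact ⟨θ, (heq_of_eq hθ).trans (eqToHom_conj_heq _ _ _)⟩
  choose m₂ hm₂ using @h₂
  have hl : ∀ {Z W : C} {f g : Z ⟶ W} (η : f ⟶ g), HEq (q Z ◁ p Z ◁ η) η := fun {Z W f g} η =>
    (comp_whiskerLeft_heq _ _ η).symm.trans
      ((whiskerLeft_heq (hqp Z) rfl rfl HEq.rfl).trans (id_whiskerLeft_heq η))
  have hr : ∀ {Z W : C} {f g : Z ⟶ W} (η : f ⟶ g), HEq (η ▷ q W ▷ p W) η := fun {Z W f g} η =>
    (whiskerRight_comp_heq η _ _).symm.trans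
      ((whiskerRight_heq (hqp W) rfl rfl HEq.rfl).trans (whiskerRight_id_heq η))
  have hc₁ : ∀ {Z W : C} (f : Z ⟶ W), F.map (m _ _ (p Z ≫ f ≫ q W)) ≫ p W = p Z ≫ f := by
    intro Z W f
    rw [hm, Strict.assoc, Strict.assoc, hqp, Strict.comp_id]
  have hc₂ : ∀ {Z W : C} {f g : Z ⟶ W} (η : f ⟶ g), HEq (F.map₂ (m₂ η) ▷ p W) (p Z ◁ η) := by
    intro Z W f g η
    refine (whiskerRight_heq rfl (hm _ _ _) (hm _ _ _) (hm₂ η)).trans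
      ((whisker_assoc_heq _ _ _).trans (whiskerLeft_heq rfl ?_ ?_ (hr η)))
    · rw [Strict.assoc, hqp, Strict.comp_id]
    · rw [Strict.assoc, hqp, Strict.comp_id]
  have hmc : ∀ {X Y Z : C} (f : X ⟶ Y) (g : Y ⟶ Z), m _ _ (p X ≫ (f ≫ g) ≫ q Z) =
      m _ _ (p X ≫ f ≫ q Y) ≫ m _ _ (p Y ≫ g ≫ q Z) := by
    intro X Y Z f g
    refine hinj ?_
    rw [F.map_comp, hm, hm, hm]
    simp only [Strict.assoc, hqp']
  let K : StrictPseudofunctor C B := StrictPseudofunctor.mk''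
    { obj := G
      map := fun {Z W} f => m _ _ (p Z ≫ f ≫ q W)
      map₂ := fun η => m₂ η
      map₂_id := fun f => by
        refine eq_of_heq (hF.heq_of_map₂_heq rfl rfl ((hm₂ _).trans ?_))
        rw [F.map₂_id, id_whiskerRight, whiskerLeft_id]
        exact id_heq (hm _ _ _).symm
      map₂_comp := fun η θ => by
        refine eq_of_heq (hF.heq_of_map₂_heq rfl rfl ((hm₂ _).trans ?_))
        rw [F.map₂_comp, comp_whiskerRight, whiskerLeft_comp]
        exact comp_heq (hm _ _ _).symm (hm _ _ _).symm (hm _ _ _).symm (hm₂ η).symm (hm₂ θ).symm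
      map_id := fun Z => by
        refine hinj ?_
        rw [hm, F.map_id, Strict.id_comp, hpq]
      map_comp := hmc
      map₂_whisker_left := fun {X Y Z} f g h η => by
        refine eq_eqToHom_comp_of_heq _ _ (hF.heq_of_map₂_heq (hmc f g) (hmc f h)
          ((hm₂ _).trans (HEq.trans ?_ (map₂_whiskerLeft_heq F _ _).symm)))
        refine HEq.trans ?_ (whiskerLeft_heq (hm _ _ _) (hm _ _ _) (hm _ _ _) (hm₂ η)).symm
        refine HEq.trans ?_ (comp_whiskerLeft_heq _ _ _).symm
        refine whiskerLeft_heq rfl ?_ ?_ ((whisker_assoc_heq _ _ _).trans (HEq.trans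
          (whiskerLeft_heq rfl (hqp' _).symm (hqp' _).symm (hl _).symm)
          (comp_whiskerLeft_heq _ _ _).symm))
        · simp only [Strict.assoc, hqp']
        · simp only [Strict.assoc, hqp']
      map₂_whisker_right := fun {X Y Z f g} η h => by
        refine eq_eqToHom_comp_of_heq _ _ (hF.heq_of_map₂_heq (hmc f h) (hmc g h)
          ((hm₂ _).trans (HEq.trans ?_ (map₂_whiskerRight_heq F _ _).symm)))
        refine HEq.trans ?_ (whiskerRight_heq (hm _ _ _) rfl rfl HEq.rfl).symm
        refine HEq.trans ?_ (whiskerRight_comp_heq _ _ _).symm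
        refine HEq.trans ?_ (whiskerRight_heq rfl (hc₁ _) (hc₁ _) (hc₂ η)).symm
        refine HEq.trans ?_ (whisker_assoc_heq _ _ _).symm
        exact whiskerLeft_heq rfl (Strict.assoc _ _ _) (Strict.assoc _ _ _)
          (whiskerRight_comp_heq _ _ _).symm }
  have hu : ∀ {X Y : B} (f : X ⟶ Y), f ≫ m _ _ (q (F.obj Y)) =
      m _ _ (q (F.obj X)) ≫ m _ _ (p (F.obj X) ≫ F.map f ≫ q (F.obj Y)) := by
    intro X Y f
    refine hinj ?_
    rw [F.map_comp, F.map_comp, hm, hm, hm, hqp']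
  have hu₁ : ∀ X : B, m _ _ (q (F.obj X)) ≫ m _ _ (p (F.obj X)) = 𝟙 X := fun X => hinj (by
    rw [F.map_comp, hm, hm, F.map_id]
    exact hqp _)
  have hu₂ : ∀ X : B, m _ _ (p (F.obj X)) ≫ m _ _ (q (F.obj X)) = 𝟙 _ := fun X => hinj (by
    rw [F.map_comp, hm, hm, F.map_id]
    exact hpq _)
  -- The unit at `X` is the 1-cell lying over `q (F.obj X)`, and the counit is `p` itself.
  refine ⟨⟨F, K, ⟨fun X => m _ _ (q (F.obj X)), fun X => m _ _ (p (F.obj X)), hu₁, hu₂, hu,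
    fun {X Y f g} η => comp_eqToHom_eq_of_heq _ _ (hF.heq_of_map₂_heq (hu f) (hu g) ?_)⟩,
    ⟨p, q, hpq, hqp, hc₁, fun η => comp_eqToHom_eq_of_heq _ _ (hc₂ η)⟩⟩, rfl⟩
  refine (map₂_whiskerRight_heq F η _).trans
    (HEq.trans ?_ (map₂_whiskerLeft_heq F _ (m₂ (F.map₂ η))).symm)
  refine (whiskerRight_heq (hm _ _ _) rfl rfl HEq.rfl).trans
    (HEq.trans ?_ (whiskerLeft_heq (hm _ _ _) (hm _ _ _) (hm _ _ _) (hm₂ (F.map₂ η))).symm)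
  exact (hl _).symm

theorem fullSub_heq {P : C → Prop} {X Y : FullSub P} {f g f' g' : X ⟶ Y} {η : f ⟶ g}
    {θ : f' ⟶ g'} (hf : f = f') (hg : g = g') (h : HEq η.hom θ.hom) : HEq η θ := by
  subst hf hg
  exact heq_of_eq (InducedBicategory.hom₂_ext (eq_of_heq h))

/-- The restriction of a 2-functor to full sub-2-categories. -/
def restrict [Strict B] [Strict C] (F : StrictPseudofunctor B C) {P : B → Prop} {Q : C → Prop}
    (h : ∀ X, P X → Q (F.obj X)) : StrictPseudofunctor (FullSub P) (FullSub Q) :=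
  StrictPseudofunctor.mk''
    { obj := fun X => ⟨F.obj X.1, h X.1 X.2⟩
      map := fun f => InducedBicategory.mkHom (F.map f.hom)
      map₂ := fun η => InducedBicategory.Hom₂.mk (F.map₂ η.hom)
      map₂_id := fun f => InducedBicategory.hom₂_ext (F.map₂_id f.hom)
      map₂_comp := fun η θ => InducedBicategory.hom₂_ext (F.map₂_comp η.hom θ.hom)
      map_id := fun X => InducedBicategory.hom_ext (F.map_id X.1)
      map_comp := fun f g => InducedBicategory.hom_ext (F.map_comp f.hom g.hom)
      map₂_whisker_left := fun f _ _ η =>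
        eq_eqToHom_comp_of_heq _ _ (fullSub_heq (InducedBicategory.hom_ext (F.map_comp _ _))
          (InducedBicategory.hom_ext (F.map_comp _ _)) (map₂_whiskerLeft_heq F f.hom η.hom))
      map₂_whisker_right := fun η f =>
        eq_eqToHom_comp_of_heq _ _ (fullSub_heq (InducedBicategory.hom_ext (F.map_comp _ _))
          (InducedBicategory.hom_ext (F.map_comp _ _)) (map₂_whiskerRight_heq F η.hom f.hom)) }

theorem IsLocallyBijective.restrict [Strict B] [Strict C] {F : StrictPseudofunctor B C}
    (hF : IsLocallyBijective F) {P : B → Prop} {Q : C → Prop} (h : ∀ X, P X → Q (F.obj X)) :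
    IsLocallyBijective (TwoCat.restrict F h) where
  map_bijective X Y := by
    refine ⟨fun f g hfg => InducedBicategory.hom_ext ((hF.map_bijective _ _).1
      (congrArg (fun k : (TwoCat.restrict F h).obj X ⟶ (TwoCat.restrict F h).obj Y => k.hom)
        hfg)), fun f => ?_⟩
    obtain ⟨f', hf'⟩ := (hF.map_bijective _ _).2 f.hom
    exact ⟨InducedBicategory.mkHom f', InducedBicategory.hom_ext hf'⟩
  map₂_bijective f g := by
    refine ⟨fun η θ hηθ => InducedBicategory.hom₂_ext ((hF.map₂_bijective _ _).1
      (congrArg (fun k : (TwoCat.restrict F h).map f ⟶ (TwoCat.restrict F h).map g => k.hom)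
        hηθ)), fun η => ?_⟩
    obtain ⟨η', hη'⟩ := (hF.map₂_bijective _ _).2 η.hom
    exact ⟨InducedBicategory.Hom₂.mk η', InducedBicategory.hom₂_ext hη'⟩

end

end TwoCat

/-! ### The two 2-equivalences -/

open TwoCat

theorem SkewMonCat.toMultiFunctor_isLocallyBijective :
    IsLocallyBijective SkewMonCat.toMultiFunctor.{v, u} :=
  ⟨fun _ _ => SkewMonCat.toMultiMap_bijective, fun F G => SkewMonCat.toMultiMap₂_bijective F G⟩

theorem mainTheorem7 :
    ∃ (E : TwoCat.TwoEquivalence ClosedSkewMonCat.{v, u} LeftRepClosedSkewMultiCat.{v, u})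
      (E' : TwoCat.TwoEquivalence ClosedSkewMonCatEpi.{v, u} LeftRepClosedSkewMultiCatInj.{v, u}),
      E'.functor.comp (TwoCat.FullSub.incl _) = (TwoCat.FullSub.incl _).comp E.functor := by
  have h : ∀ C : SkewMonCat.{v, u}, C.IsClosed →
      C.toMulti.IsLeftRepresentable ∧ C.toMulti.IsClosed :=
    fun C hC => ⟨C.toMulti_isLeftRepresentable, C.toMulti_isClosed hC⟩
  have h' : ∀ C : ClosedSkewMonCat.{v, u}, C.1.LeftUnitEpi → C.1.toMulti.ComparisonInjective :=
    fun C => (C.1.toMulti_comparisonInjective_iff C.2).2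
  have hF := SkewMonCat.toMultiFunctor_isLocallyBijective.{v, u}.restrict
    (P := SkewMonCat.IsClosed) (Q := fun A => A.IsLeftRepresentable ∧ A.IsClosed) h
  have hF' := hF.restrict (P := fun C : ClosedSkewMonCat.{v, u} => C.1.LeftUnitEpi)
    (Q := fun A : LeftRepClosedSkewMultiCat.{v, u} => A.1.ComparisonInjective) h'
  obtain ⟨E, hE⟩ := hF.exists_twoEquivalence fun A => by
    obtain ⟨R⟩ := A.2.1.nonempty_representation
    obtain ⟨p, q, hpq, hqp⟩ := R.exists_iso
    exact ⟨⟨R.toSkewMonCat, R.toSkewMonCat_isClosed A.2.2⟩,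
      Bicategory.InducedBicategory.mkHom p, Bicategory.InducedBicategory.mkHom q,
      Bicategory.InducedBicategory.hom_ext hpq, Bicategory.InducedBicategory.hom_ext hqp⟩
  -- The criterion is applied again, to the restricted 2-functor. The same kind of preimage serves,
  -- since injective comparisons make its left unit maps epimorphisms.
  obtain ⟨E', hE'⟩ := hF'.exists_twoEquivalence fun A => by
    obtain ⟨R⟩ := A.1.2.1.nonempty_representation
    obtain ⟨p, q, hpq, hqp⟩ := R.exists_iso
    exact ⟨⟨⟨R.toSkewMonCat, R.toSkewMonCat_isClosed A.1.2.2⟩, R.toSkewMonCat_leftUnitEpi A.2⟩,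
      Bicategory.InducedBicategory.mkHom (Bicategory.InducedBicategory.mkHom p),
      Bicategory.InducedBicategory.mkHom (Bicategory.InducedBicategory.mkHom q),
      Bicategory.InducedBicategory.hom_ext (Bicategory.InducedBicategory.hom_ext hpq),
      Bicategory.InducedBicategory.hom_ext (Bicategory.InducedBicategory.hom_ext hqp)⟩
  refine ⟨E, E', ?_⟩
  rw [hE, hE']
  -- Both 2-functors are restrictions of `SkewMonCat.toMultiFunctor`, so they agree definitionally
  -- on cells.
  exact TwoCat.StrictPseudofunctor.ext rfl
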